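/- Let $n\ge 1$ and $G^\vee=PSL_{n+1}(\mathbb C)$, with $B^\vee_\pm$, $T^\vee$, $U^\vee_+$ the upper/lower triangular Borel subgroups, the diagonal torus and the upper unipotent subgroup, $x_i(t)=1+tE_{i,i+1}$, $y_i(t)=1+tE_{i+1,i}$, $\dot s_i=x_i(1)y_i(-1)x_i(1)$, $\mathbf i_0=(n,\dots,1,n,\dots,2,\dots,n)$ (a reduced expression of the longest element $w_0$ of $S_{n+1}$), $\dot w_0$ the corresponding product of the $\dot s_i$, and $n_B=n(n+1)/2$. *Givental's family.* The quiver has vertices $v_{ij}$ ($1\le j\le i\le n+1$), vertical arrows $c_{ij}:v_{i+1,j}\to v_{ij}$ ($1\le j\le i\le n$) and horizontal arrows $d_{ij}:v_{ij}\to v_{i,j-1}$ ($2\le j\le i\le n+1$). Let $\mathcal A$ be the set of arrows and $\mathcal Z\subset(\mathbb C^*)^{\mathcal A}$ the variety given by the equations $\sigma_{d_{i,j+1}}\sigma_{c_{i,j+1}}=\sigma_{c_{ij}}\sigma_{d_{i+1,j+1}}$ ($1\le j<i\le n$). Put $\tilde q_i=\sigma_{c_{ii}}\sigma_{d_{i+1,i+1}}$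 and let $\mathcal Z_Q$ be the fibre of $\tilde q$ over $Q\in(\mathbb C^*)^n$. The vertex coordinates $t_v$ are determined by $\sigma_a=t_{\mathrm{head}(a)}/t_{\mathrm{tail}(a)}$ and $t_{v_{n+1,n+1}}=1$; those with $v\in\mathcal V_-=\{v_{ij}: j<i\}$ are coordinates on $\mathcal Z_Q$. Let $\tilde{\mathcal F}(\sigma)=\sum_{a}\sigma_a$, and let $\mathcal Z^{crit}\subset\mathcal Z$ be the critical locus of $\tilde{\mathcal F}$ along the fibres of $\tilde q$. Put $$x_{\mathbf c}(\sigma)=\prod_{k=1}^{n}\ \prod_{j=n}^{k}x_j(\sigma_{c_{jk}}),\qquad x_{\mathbf d}(\sigma)=\prod_{k=n}^{1}\ \prod_{j=1}^{k}x_{n-j+1}(\sigma_{d_{k+1,j+1}})$$ (the indices running in the indicated order), let $\tau(\sigma)\in T^\vee$ be the class of the diagonal matrix with entries $\tilde q_1\cdots\tilde q_n,\ \dots,\ \tilde q_n,\ 1$, and let $\beta(\sigma)=x_{\mathbf c}(\sigma)\,\tau(\sigma)\,\dot w_0^{-1}\,x_{\mathbf d}(-\sigma)^{-1}\in G^\vee$.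 *The Lie theoretic family.* Let $Z_B=\{(t,b)\in T^\vee\times B^\vee_-: b\in U^\vee_+t\dot w_0^{-1}U^\vee_+\}$ and $$\mathcal F_B(t,b)=\frac{\langle f\,\tilde b\cdot v^+_\rho,v^-_\rho\rangle+\langle\tilde b\,f\cdot v^+_\rho,v^-_\rho\rangle}{\langle\tilde b\cdot v^+_\rho,v^-_\rho\rangle},\qquad f=\sum_iE_{i+1,i},$$ where $\tilde b\in SL_{n+1}(\mathbb C)$ lifts $b$, $v^-_\rho$ is a lowest weight vector of the irreducible representation $V(\rho)$ of highest weight $\rho$ (the sum of the fundamental weights), $v^+_\rho=\dot w_0\cdot v^-_\rho$, and $\langle v,v^-_\rho\rangle$ is the coefficient of $v$ at $v^-_\rho$ in the weight decomposition. Let $\mathcal R^\vee_{1,w_0}=(B^\vee_+B^\vee_-\cap B^\vee_-\dot w_0B^\vee_-)/B^\vee_-\subset G^\vee/B^\vee_-$. For a reduced expression $\mathbf i=(i_1,\dots,i_{n_B})$ of $w_0$ its open Deodhar stratum is $\mathcal R^\vee_{\mathbf i}=\{x_{i_1}(t_1)\cdots x_{i_{n_B}}(t_{n_B})B^\vee_-: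 t_l\in\mathbb C^*\}$, with standard coordinates $t_l$. Let $F$ be the functional $X\mapsto\sum_iX_{i,i+1}$, and let $Y_B$ be the subscheme of the big cell $B^\vee_+B^\vee_- /B^\vee_-$ given by the condition on $gB^\vee_-$ that $X\mapsto F(gXg^{-1})$ vanishes on $[\mathfrak u^\vee_-,\mathfrak u^\vee_-]$, where $\mathfrak u^\vee_-$ is the space of strictly lower triangular matrices. **Theorem 8.2.** 1. $\beta$ has image in $B^\vee_-$, and $(\tau,\beta):\mathcal Z\to Z_B$ is an open embedding. 2. $(\tau,\beta)^*\mathcal F_B=\tilde{\mathcal F}$. The map $\sigma\mapsto x_{\mathbf c}(\sigma)B^\vee_-$ identifies $\mathcal Z^{crit}$ with the intersection of $Y_B$ and the open Deodhar stratum $\mathcal R^\vee_{\mathbf i_0}$ (on points and as schemes). 3. For $Q\in(\mathbb C^*)^n$ the map $\gamma_Q:\mathcal Z_Q\to\mathcal R^\vee_{1,w_0}$, $\sigma\mapsto x_{\mathbf c}(\sigma)B^\vee_-$, is an (open) embedding. Let $\omega$ be a holomorphic $n_B$-form on $\mathcal R^\vee_{1,w_0}$ such that for every reduced expression $\mathbf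 i$ of $w_0$ one has $\omega|_{\mathcal R^\vee_{\mathbf i}}=\epsilon_{\mathbf i}\,\frac{dt_1}{t_1}\wedge\dots\wedge\frac{dt_{n_B}}{t_{n_B}}$ in the standard coordinates with $\epsilon_{\mathbf i}\in\{\pm1\}$, and $\epsilon_{\mathbf i_1}=1$ for one fixed reduced expression $\mathbf i_1$. Then $\gamma_Q^*\omega=\epsilon\bigwedge_{v\in\mathcal V_-}\frac{dt_v}{t_v}$ (for any ordering of $\mathcal V_-$), where $\epsilon\in\{\pm1\}$ is independent of $Q$. -/

import Mathlib

noncomputable section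

namespace GiventalMirror

/-! ### Quasi-affine varieties, regular functions and open embeddings

A (reduced) quasi-affine complex variety is given by a locally closed set `S` of points of a type
`X` together with a map `x : X → (κ → ℂ)`, injective on `S`, whose components are the affine
coordinates. -/

section Varieties

variable {X Y κ μ : Type*}

/-- `f` is a regular function on `S`: locally (on basic Zariski open sets `Q ≠ 0`) it is a quotient
of two polynomials in the coordinates. -/
def IsRegular (x : X → κ → ℂ) (S : Set X) (f : S → ℂ) : Prop :=
  ∀ p : S, ∃ P Q : MvPolynomial κ ℂ, MvPolynomial.eval (x p) Q ≠ 0 ∧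
    ∀ q : S, MvPolynomial.eval (x q) Q ≠ 0 →
      f q = MvPolynomial.eval (x q) P / MvPolynomial.eval (x q) Q

/-- The ring of regular functions on `S`. -/
def regularRing (x : X → κ → ℂ) (S : Set X) : Subalgebra ℂ (S → ℂ) where
  carrier := {f | IsRegular x S f}
  mul_mem' := by
    intro f g hf hg p
    obtain ⟨P, Q, hQ, h⟩ := hf p
    obtain ⟨P', Q', hQ', h'⟩ := hg p
    refine ⟨P * P', Q * Q', by simp [hQ, hQ'], fun q hq => ?_⟩
    simp only [map_mul, ne_eq, mul_eq_zero, not_or] at hq ⊢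
    rw [Pi.mul_apply, h q hq.1, h' q hq.2, div_mul_div_comm]
  add_mem' := by
    intro f g hf hg p
    obtain ⟨P, Q, hQ, h⟩ := hf p
    obtain ⟨P', Q', hQ', h'⟩ := hg p
    refine ⟨P * Q' + Q * P', Q * Q', by simp [hQ, hQ'], fun q hq => ?_⟩
    simp only [map_mul, map_add, ne_eq, mul_eq_zero, not_or] at hq ⊢
    rw [Pi.add_apply, h q hq.1, h' q hq.2, div_add_div _ _ hq.1 hq.2]
  algebraMap_mem' := by
    intro c p
    exact ⟨MvPolynomial.C c, 1, by simp, fun q _ => by simp⟩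

/-- `U` is a Zariski open subset of `S`. -/
def IsZariskiOpenIn (x : X → κ → ℂ) (S U : Set X) : Prop :=
  U ⊆ S ∧ ∀ p ∈ U, ∃ Q : MvPolynomial κ ℂ, MvPolynomial.eval (x p) Q ≠ 0 ∧
    ∀ q ∈ S, MvPolynomial.eval (x q) Q ≠ 0 → q ∈ U

/-- `φ` restricts to a morphism of varieties `S → R`. -/
structure IsMorphism (x : X → κ → ℂ) (S : Set X) (y : Y → μ → ℂ) (R : Set Y)
    (φ : X → Y) : Prop where
  mapsTo : Set.MapsTo φ S R
  regular : ∀ l, IsRegular x S (fun p => y (φ p) l)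

/-- `φ` restricts to an open embedding of varieties `S ↪ R`: an isomorphism of `S` onto a Zariski
open subset of `R`. -/
structure IsOpenEmbedding (x : X → κ → ℂ) (S : Set X) (y : Y → μ → ℂ) (R : Set Y)
    (φ : X → Y) : Prop extends IsMorphism x S y R φ where
  injOn : Set.InjOn φ S
  isOpen_image : IsZariskiOpenIn y R (φ '' S)
  regular_inverse : ∀ k, ∃ h : (φ '' S : Set Y) → ℂ, IsRegular y (φ '' S) h ∧
    ∀ p : S, h ⟨φ p, Set.mem_image_of_mem φ p.2⟩ = x p k

end Varieties

/-! ### The groups `G^∨ = PSL_{n+1}(ℂ)` and its universal covering group `SL_{n+1}(ℂ)` -/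

/-- `SL_{n+1}(ℂ)`, the universal covering group of `G^∨`. -/
abbrev SLv (n : ℕ) : Type := Matrix.SpecialLinearGroup (Fin (n + 1)) ℂ

/-- `G^∨ = PSL_{n+1}(ℂ)`, in the form `GL_{n+1}(ℂ)` modulo scalars. -/
abbrev Gv (n : ℕ) : Type := Matrix.ProjGenLinGroup (Fin (n + 1)) ℂ

abbrev Mat (n : ℕ) : Type := Matrix (Fin (n + 1)) (Fin (n + 1)) ℂ

variable {n : ℕ}

/-- The covering map `SL_{n+1} → G^∨`. -/
def cover : SLv n →* Gv n := Matrix.SpecialLinearGroup.toPGL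

theorem cover_surjective : Function.Surjective (cover (n := n)) := by
  intro g
  have hroots : ∀ r : ℂˣ, ∃ k : ℂˣ, k ^ Fintype.card (Fin (n + 1)) = r := by
    intro r
    obtain ⟨z, hz⟩ := IsAlgClosed.exists_pow_nat_eq (r : ℂ)
      (n := Fintype.card (Fin (n + 1))) Fintype.card_pos
    have hz0 : z ≠ 0 := by
      rintro rfl
      rw [zero_pow Fintype.card_ne_zero] at hz
      exact r.ne_zero hz.symm
    exact ⟨Units.mk0 z hz0, Units.ext (by simpa using hz)⟩
  obtain ⟨p, hp⟩ := Matrix.ProjectiveSpecialLinearGroup.toPGL_surj_of_roots hroots g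
  obtain ⟨s, rfl⟩ := QuotientGroup.mk_surjective p
  exact ⟨s, hp⟩

/-- The simple root subgroup `x_i(t) = exp(t e_i)`. -/
def xRoot (i : Fin n) (t : ℂ) : SLv n :=
  Matrix.SpecialLinearGroup.transvection (Fin.castSucc_lt_succ (i := i)).ne t

/-- The simple root subgroup `y_i(t) = exp(t f_i)`. -/
def yRoot (i : Fin n) (t : ℂ) : SLv n :=
  Matrix.SpecialLinearGroup.transvection (Fin.castSucc_lt_succ (i := i)).ne' t

/-- `ṡ_i = x_i(1) y_i(-1) x_i(1)`. -/
def sDot (i : Fin n) : SLv n := xRoot i 1 * yRoot i (-1) * xRoot i 1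

/-- The Borel subgroup `B_-^∨` of lower triangular matrices. -/
def Bminus (n : ℕ) : Subgroup (Gv n) :=
  Subgroup.map Matrix.ProjGenLinGroup.mk
    { carrier := {g : Matrix.GeneralLinearGroup (Fin (n + 1)) ℂ |
        ∀ i j, i < j → (g : Mat n) i j = 0}
      one_mem' := fun i j hij => by simp [hij.ne]
      mul_mem' := fun {a b} ha hb i j hij => by
        have hA : (a : Mat n).BlockTriangular OrderDual.toDual := fun i j h => ha i j h
        have hB : (b : Mat n).BlockTriangular OrderDual.toDual := fun i j h => hb i j h
        exact (hA.mul hB) hij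
      inv_mem' := fun {a} ha i j hij => by
        have hA : (a : Mat n).BlockTriangular OrderDual.toDual := fun i j h => ha i j h
        have : Invertible (a : Mat n) := a.invertible
        have := Matrix.blockTriangular_inv_of_blockTriangular hA hij
        simpa using this }

/-- The Borel subgroup `B_+^∨` of upper triangular matrices, as a set. -/
def Bplus (n : ℕ) : Set (Gv n) :=
  Matrix.ProjGenLinGroup.mk '' {g : Matrix.GeneralLinearGroup (Fin (n + 1)) ℂ |
    ∀ i j, j < i → (g : Mat n) i j = 0}

/-- The maximal torus `T^∨` of diagonal matrices, as a set. -/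
def Tv (n : ℕ) : Set (Gv n) :=
  Matrix.ProjGenLinGroup.mk '' {g : Matrix.GeneralLinearGroup (Fin (n + 1)) ℂ |
    ∀ i j, i ≠ j → (g : Mat n) i j = 0}

/-- Positions strictly above the diagonal. -/
abbrev UIdx (n : ℕ) : Type := {p : Fin (n + 1) × Fin (n + 1) // p.1 < p.2}

/-- The unipotent upper triangular matrix with given entries above the diagonal. -/
def unip (u : UIdx n → ℂ) : SLv n :=
  ⟨Matrix.of fun i j => if h : i < j then u ⟨(i, j), h⟩ else if i = j then 1 else 0, by
    rw [Matrix.det_of_isUpperTriangular]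
    · simp
    · intro i j hij
      have hij' : j < i := hij
      simp [hij'.not_gt, hij'.ne']⟩

/-- The unipotent radical `U_+^∨` of `B_+^∨`. -/
def Uplus (n : ℕ) : Set (Gv n) := Set.range fun u : UIdx n → ℂ => cover (unip u)

/-- The adjoint action of `G^∨`: `Ad(g) X = g X g⁻¹` for any matrix representing `g`. -/
def Ad : Gv n →* Module.End ℂ (Mat n) :=
  Matrix.ProjGenLinGroup.lift
    { toFun := fun g =>
        { toFun := fun X => (g : Mat n) * X * ((g⁻¹ : Matrix.GeneralLinearGroup _ ℂ) : Mat n)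
          map_add' := fun X Y => by rw [mul_add, add_mul]
          map_smul' := fun c X => by simp }
      map_one' := by ext; simp
      map_mul' := fun g h => by
        ext1 X
        simp only [mul_inv_rev, Units.val_mul, LinearMap.coe_mk, AddHom.coe_mk, Module.End.mul_apply,
          mul_assoc] }
    (by
      refine MonoidHom.ext fun u => LinearMap.ext fun X => ?_
      simp only [MonoidHom.comp_apply, MonoidHom.coe_mk, OneHom.coe_mk, LinearMap.coe_mk,
        AddHom.coe_mk, MonoidHom.one_apply, Module.End.one_apply]
      rw [Matrix.GeneralLinearGroup.coe_scalar, Matrix.scalar_comm _ (Commute.all _),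
        ← Matrix.GeneralLinearGroup.coe_scalar, mul_assoc, Units.mul_inv, mul_one])

/-- The matrix coefficients of `Ad(g)`; they embed the affine variety `G^∨` into affine space. -/
def adCoord (g : Gv n) :
    (Fin (n + 1) × Fin (n + 1)) × (Fin (n + 1) × Fin (n + 1)) → ℂ :=
  fun k => Ad g (Matrix.single k.1.1 k.1.2 1) k.2.1 k.2.2

/-- Affine coordinates on `G^∨ × G^∨`. -/
def pairCoord (p : Gv n × Gv n) :
    ((Fin (n + 1) × Fin (n + 1)) × (Fin (n + 1) × Fin (n + 1))) ⊕
      ((Fin (n + 1) × Fin (n + 1)) × (Fin (n + 1) × Fin (n + 1))) → ℂ :=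
  Sum.elim (adCoord p.1) (adCoord p.2)

/-! ### The quiver and the mirror family `𝒵` of Givental

With zero-based indices the vertices are the `v_{ij}`, `0 ≤ j ≤ i ≤ n`. The vertical arrows and the
horizontal arrows are both labelled by the pairs `0 ≤ j ≤ i < n`: the vertical one goes
`v_{i+1,j} → v_{ij}` and the horizontal one `v_{i+1,j+1} → v_{i+1,j}`. In one-based indices these
are `c_{ij}` and `d_{i+1,j+1}`, `1 ≤ j ≤ i ≤ n`. -/

/-- All vertices of the quiver. -/
abbrev Vertex (n : ℕ) : Type := {p : Fin (n + 1) × Fin (n + 1) // p.2 ≤ p.1}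

/-- The vertices `𝒱_-` below the diagonal. -/
abbrev Below (n : ℕ) : Type := {p : Fin (n + 1) × Fin (n + 1) // p.2 < p.1}

abbrev Tri (n : ℕ) : Type := {p : Fin n × Fin n // p.2 ≤ p.1}

/-- The arrows: `Sum.inl` for vertical arrows, `Sum.inr` for horizontal ones. -/
abbrev Arrow (n : ℕ) : Type := Tri n ⊕ Tri n

/-- The head of an arrow. -/
def head : Arrow n → Vertex n
  | Sum.inl a => ⟨(a.1.1.castSucc, a.1.2.castSucc), Fin.castSucc_le_castSucc_iff.2 a.2⟩
  | Sum.inr a => ⟨(a.1.1.succ, a.1.2.castSucc),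
      (Fin.castSucc_le_castSucc_iff.2 a.2).trans Fin.castSucc_lt_succ.le⟩

/-- The tail of an arrow. -/
def tail : Arrow n → Vertex n
  | Sum.inl a => ⟨(a.1.1.succ, a.1.2.castSucc),
      (Fin.castSucc_le_castSucc_iff.2 a.2).trans Fin.castSucc_lt_succ.le⟩
  | Sum.inr a => ⟨(a.1.1.succ, a.1.2.succ), Fin.succ_le_succ_iff.2 a.2⟩

/-- `𝒵`: nonzero arrow variables with `σ_d σ_c = σ_{c'} σ_{d'}` for every square, where `c` followed
by `d` and `d'` followed by `c'` are the two paths from the lower right to the upper left corner. -/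
def Zquiver (n : ℕ) : Set (Arrow n → ℂ) :=
  {σ | (∀ a, σ a ≠ 0) ∧ ∀ c c' d d' : Tri n,
    head (.inl c) = tail (.inr d) → head (.inr d') = tail (.inl c') →
    tail (.inl c) = tail (.inr d') → head (.inr d) = head (.inl c') →
    σ (.inr d) * σ (.inl c) = σ (.inl c') * σ (.inr d')}

/-- The arrow coordinates themselves. -/
def arrowCoord (σ : Arrow n → ℂ) : Arrow n → ℂ := σ

/-- `q̃_i = c_{ii} d_{i+1,i+1}` (one-based indices). -/
def qTilde (σ : Arrow n → ℂ) (i : Fin n) : ℂ :=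
  σ (.inl ⟨(i, i), le_rfl⟩) * σ (.inr ⟨(i, i), le_rfl⟩)

/-- The fibre `𝒵_Q`. -/
def Zfiber (Q : Fin n → ℂ) : Set (Arrow n → ℂ) := {σ ∈ Zquiver n | qTilde σ = Q}

/-- The vertex variables in the fibre over `Q`: free below the diagonal, and
`t_{ii} = Q_i Q_{i+1} ⋯ Q_n`, `t_{n+1,n+1} = 1` (one-based indices) on the diagonal. -/
def vertexExtend (Q : Fin n → ℂ) (z : Below n → ℂ) (v : Vertex n) : ℂ :=
  if h : v.1.2 < v.1.1 then z ⟨v.1, h⟩ else ∏ k : Fin n with v.1.1 ≤ k.castSucc, Q k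

/-- The parametrization of `𝒵_Q` by the vertex coordinates: `σ_a = t_{h_a} / t_{t_a}`. -/
def arrowsOf (Q : Fin n → ℂ) (z : Below n → ℂ) (a : Arrow n) : ℂ :=
  vertexExtend Q z (head a) / vertexExtend Q z (tail a)

/-- The vertex coordinates `t_v`, `v ∈ 𝒱_-`, of a point of `𝒵`: the product of the arrow variables
along the path from `v_{n+1,n+1}` to `v` which first follows the bottom row and then a column. -/
def vertexCoord (σ : Arrow n → ℂ) (v : Below n) : ℂ :=
  (∏ a : Tri n with v.1.1 ≤ a.1.1.castSucc ∧ a.1.2.castSucc = v.1.2, σ (.inl a)) *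
    ∏ a : Tri n with a.1.1.succ = Fin.last n ∧ v.1.2 ≤ a.1.2.castSucc, σ (.inr a)

/-- The phase function `ℱ̃`. -/
def phaseGivental (σ : Arrow n → ℂ) : ℂ := ∑ a, σ a

/-- The differential at `σ` of the restriction of `ℱ̃` to the fibre of `q̃` through `σ`, in the
vertex coordinates. -/
def fiberDifferential (σ : Arrow n → ℂ) : (Below n → ℂ) →L[ℂ] ℂ :=
  fderiv ℂ (fun z => phaseGivental (arrowsOf (qTilde σ) z)) (vertexCoord σ)

/-- `𝒵^crit`: the critical points of `ℱ̃` along the fibres of `q̃`. -/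
def Zcrit (n : ℕ) : Set (Arrow n → ℂ) := {σ ∈ Zquiver n | fiberDifferential σ = 0}

/-- The ideal of the critical locus in the coordinate ring of `𝒵`, generated by the partial
derivatives of `ℱ̃` in the vertex coordinates. -/
def critIdeal (n : ℕ) : Ideal (regularRing (arrowCoord (n := n)) (Zquiver n)) :=
  Ideal.span {f | ∃ v : Below n, ∀ σ : Zquiver n,
    (f : Zquiver n → ℂ) σ = fiberDifferential (σ : Arrow n → ℂ) (Pi.single v 1)}

/-! ### The comparison map -/

/-- The labels `(j,k)` of the vertical arrows, for `k = 1, …, n` and then `j = n, …, k`. -/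
def cOrder (n : ℕ) : List (Tri n) :=
  (List.finRange n).flatMap fun k =>
    (List.finRange n).reverse.filterMap fun j => if h : k ≤ j then some ⟨(j, k), h⟩ else none

/-- The labels `(k,j)` (for `d_{k+1,j+1}`) of the horizontal arrows, for `k = n, …, 1` and then
`j = 1, …, k`. -/
def dOrder (n : ℕ) : List (Tri n) :=
  (List.finRange n).reverse.flatMap fun k =>
    (List.finRange n).filterMap fun j => if h : j ≤ k then some ⟨(k, j), h⟩ else none

/-- The reduced expression `𝐢₀ = (n, …, 1, n, …, 2, …, n)` of `w₀`. -/
def word₀ (n : ℕ) : List (Fin n) := (cOrder n).map fun a => a.1.1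

/-- The representative `ẇ₀` of the longest element. -/
def w₀Dot (n : ℕ) : SLv n := ((word₀ n).map sDot).prod

/-- `x_𝐜(σ) = ∏_k ∏_{j=n}^{k} x_j(σ_{c_{jk}})`. -/
def xc (σ : Arrow n → ℂ) : SLv n :=
  ((cOrder n).map fun a => xRoot a.1.1 (σ (.inl a))).prod

/-- `x_𝐝(σ) = ∏_{k=n}^{1} ∏_{j=1}^{k} x_{n-j+1}(σ_{d_{k+1,j+1}})`. -/
def xd (σ : Arrow n → ℂ) : SLv n :=
  ((dOrder n).map fun a => xRoot a.1.2.rev (σ (.inr a))).prod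

/-- The class in `G^∨` of an invertible diagonal matrix (and `1` if an entry vanishes). -/
def diagElt (d : Fin (n + 1) → ℂ) : Gv n :=
  if h : (Matrix.diagonal d).det ≠ 0 then
    Matrix.ProjGenLinGroup.mk (Matrix.GeneralLinearGroup.mkOfDetNeZero (Matrix.diagonal d) h)
  else 1

/-- `τ(σ)`, the diagonal matrix with entries `q̃_i ⋯ q̃_n`. -/
def tau (σ : Arrow n → ℂ) : Gv n :=
  diagElt fun i => ∏ k : Fin n with i ≤ k.castSucc, qTilde σ k

/-- `β(σ) = x_𝐜(σ) τ(σ) ẇ₀⁻¹ x_𝐝(-σ)⁻¹`. -/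
def beta (σ : Arrow n → ℂ) : Gv n :=
  cover (xc σ) * tau σ * (cover (w₀Dot n))⁻¹ * (cover (xd (-σ)))⁻¹

/-! ### The Lie theoretic mirror family `Z_B` and its phase function -/

/-- `Z_B = {(t,b) ∈ T^∨ × B_-^∨ | b ∈ U_+^∨ t ẇ₀⁻¹ U_+^∨}`. -/
def ZB (n : ℕ) : Set (Gv n × Gv n) :=
  {p | p.1 ∈ Tv n ∧ p.2 ∈ Bminus n ∧
    ∃ u₁ ∈ Uplus n, ∃ u₂ ∈ Uplus n, p.2 = u₁ * p.1 * (cover (w₀Dot n))⁻¹ * u₂}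

/-- Right translation of functions on `SL_{n+1}`: the action of `SL_{n+1}` on functions. -/
def translate (g : SLv n) (f : SLv n → ℂ) : SLv n → ℂ := fun x => f (x * g)

/-- The character `ρ` evaluated on the diagonal part of a matrix: `∏_i x_{ii}^{n+1-i}` (one-based
indices), i.e. the sum of the fundamental weights. -/
def rhoChar (x : SLv n) : ℂ := ∏ i : Fin (n + 1), (x i i) ^ (i.rev : ℕ)

/-- The irreducible representation `V(ρ)` of `SL_{n+1}` in its Borel-Weil form: the regular
functions on `SL_{n+1}` with `f(bx) = ρ(b) f(x)` for all lower triangular `b`, under right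
translation. -/
def Vrho (n : ℕ) : Submodule ℂ (SLv n → ℂ) where
  carrier := {f |
    (∃ P : MvPolynomial (Fin (n + 1) × Fin (n + 1)) ℂ,
      ∀ x : SLv n, f x = MvPolynomial.eval (fun p => x p.1 p.2) P) ∧
    ∀ b : SLv n, (∀ i j, i < j → b i j = 0) → ∀ x, f (b * x) = rhoChar b * f x}
  zero_mem' := ⟨⟨0, by simp⟩, by simp⟩
  add_mem' := by
    rintro f g ⟨⟨P, hP⟩, hf⟩ ⟨⟨Q, hQ⟩, hg⟩
    refine ⟨⟨P + Q, fun x => by simp [hP, hQ]⟩, fun b hb x => ?_⟩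
    simp only [Pi.add_apply, hf b hb, hg b hb]
    ring
  smul_mem' := by
    rintro c f ⟨⟨P, hP⟩, hf⟩
    refine ⟨⟨MvPolynomial.C c * P, fun x => by simp [hP]⟩, fun b hb x => ?_⟩
    simp only [Pi.smul_apply, smul_eq_mul, hf b hb]
    ring

/-- The highest weight vector `v⁺_ρ`: the product of the leading principal minors of sizes
`1, …, n`. -/
def vPlus (n : ℕ) : SLv n → ℂ := fun x =>
  ∏ k : Fin n, ((x : Mat n).submatrix
    (Fin.castLE (Nat.succ_le_succ k.2.le) : Fin ((k : ℕ) + 1) → Fin (n + 1))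
    (Fin.castLE (Nat.succ_le_succ k.2.le) : Fin ((k : ℕ) + 1) → Fin (n + 1))).det

/-- The lowest weight vector `v⁻_ρ`, so that `v⁺_ρ = ẇ₀ · v⁻_ρ`. -/
def vMinus (n : ℕ) : SLv n → ℂ := translate (w₀Dot n)⁻¹ (vPlus n)

/-- The span of the weight spaces of `V(ρ)` of weight different from the weight `-ρ` of `v⁻_ρ`. -/
def otherWeights (n : ℕ) : Submodule ℂ (SLv n → ℂ) :=
  Submodule.span ℂ {f | f ∈ Vrho n ∧ ∃ χ : SLv n → ℂ,
    (∃ t : SLv n, (t : Mat n).IsDiag ∧ χ t ≠ (rhoChar t)⁻¹) ∧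
    ∀ t : SLv n, (t : Mat n).IsDiag → translate t f = χ t • f}

/-- The coefficient `⟨v, v⁻_ρ⟩`: `v = ⟨v, v⁻_ρ⟩ v⁻_ρ + other weight space summands`. -/
def coeffMinus (v : SLv n → ℂ) : ℂ :=
  Classical.epsilon fun c : ℂ => v - c • vMinus n ∈ otherWeights n

/-- The action of `f^∨ = ∑ f_i^∨`, the sum of the derivatives of the actions of the `y_i(s)`. -/
def lieF (v : SLv n → ℂ) : SLv n → ℂ :=
  fun x => ∑ i : Fin n, deriv (fun s : ℂ => translate (yRoot i s) v x) 0

/-- The phase function `ℱ_B` on `Z_B`. -/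
def phaseB (p : Gv n × Gv n) : ℂ :=
  let b : SLv n := Function.surjInv cover_surjective p.2
  (coeffMinus (lieF (translate b (vPlus n))) + coeffMinus (translate b (lieF (vPlus n)))) /
    coeffMinus (translate b (vPlus n))

/-! ### The flag variety, Richardson varieties, Deodhar strata and the Peterson variety -/

/-- The flag variety `G^∨/B_-^∨`. -/
abbrev Flag (n : ℕ) : Type := Gv n ⧸ Bminus n

/-- The big cell `B_+^∨B_-^∨/B_-^∨`, parametrized by `U_+^∨` and so by an affine space. -/
def bigCell (u : UIdx n → ℂ) : Flag n := QuotientGroup.mk (cover (unip u))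

/-- The affine coordinates on the big cell (junk outside of it). -/
def bigCellCoord : Flag n → UIdx n → ℂ := Function.invFun bigCell

/-- `ℛ^∨_{1,w₀} = (B_+^∨ B_-^∨ ∩ B_-^∨ ẇ₀ B_-^∨)/B_-^∨`. -/
def Rich (n : ℕ) : Set (Flag n) :=
  QuotientGroup.mk ''
    {g : Gv n | (∃ b ∈ Bplus n, ∃ b' ∈ Bminus n, g = b * b') ∧
      ∃ b ∈ Bminus n, ∃ b' ∈ Bminus n, g = b * cover (w₀Dot n) * b'}

/-- The point `x_{i_1}(t_1) ⋯ x_{i_m}(t_m) B_-^∨` for the list of the pairs `(i_l, t_l)`. -/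
def stratumPoint (L : List (Fin n × ℂ)) : Flag n :=
  QuotientGroup.mk (cover (L.map fun p => xRoot p.1 p.2).prod)

/-- The open Deodhar stratum in `ℛ^∨_{1,w₀}` given by a reduced expression `w` of `w₀`. -/
def openStratum (w : List (Fin n)) : Set (Flag n) :=
  {p | ∃ L : List (Fin n × ℂ), L.map Prod.fst = w ∧ (∀ a ∈ L, a.2 ≠ 0) ∧ p = stratumPoint L}

/-- The functional `F = ∑ (e_i^∨)^*`. -/
def Ffun (X : Mat n) : ℂ := ∑ i : Fin n, X i.castSucc i.succ

/-- `X ∈ 𝔲_-^∨`, i.e. `X` is strictly lower triangular. -/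
def InUminus (X : Mat n) : Prop := ∀ i j, i ≤ j → X i j = 0

/-- The Peterson variety `Y = {g B_-^∨ | g⁻¹·F vanishes on [𝔲_-^∨, 𝔲_-^∨]}`. -/
def Peterson (n : ℕ) : Set (Flag n) :=
  {p | ∀ g : Gv n, (QuotientGroup.mk g : Flag n) = p →
    ∀ X X' : Mat n, InUminus X → InUminus X' → Ffun (Ad g ⁅X, X'⁆) = 0}

/-- The stratum `Y_B`, the intersection of `Y` with the big cell. -/
def PetersonB (n : ℕ) : Set (Flag n) := Peterson n ∩ Set.range bigCell

/-- The ideal of `Y_B ∩ S` in the coordinate ring of a subvariety `S` of the big cell, generated by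
the functions `u B_-^∨ ↦ (u⁻¹·F)(X)` with `u ∈ U_+^∨` and `X ∈ [𝔲_-^∨, 𝔲_-^∨]`. -/
def petersonIdeal (S : Set (Flag n)) : Ideal (regularRing (bigCellCoord (n := n)) S) :=
  Ideal.span {f | ∃ X X' : Mat n, InUminus X ∧ InUminus X' ∧ ∀ p : S,
    (f : S → ℂ) p = Ffun (Ad (cover (unip (bigCellCoord (p : Flag n)))) ⁅X, X'⁆)}

/-- `γ : σ ↦ x_𝐜(σ) B_-^∨/B_-^∨`. -/
def gammaMap (σ : Arrow n → ℂ) : Flag n := QuotientGroup.mk (cover (xc σ))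

/-! ### Differential forms of degree `n_B = n(n+1)/2` -/

/-- `n_B`, the dimension of the flag variety. -/
abbrev nB (n : ℕ) : ℕ := n * (n + 1) / 2

/-- Differential forms of degree `n_B` on (open subsets of) the big cell, in its coordinates. -/
abbrev TopForm (n : ℕ) : Type := (UIdx n → ℂ) → (UIdx n → ℂ) [⋀^Fin (nB n)]→L[ℂ] ℂ

/-- The pull-back of a form on the big cell under a map `φ` to the flag variety. -/
def pullback {ι : Type} [Fintype ι] (φ : (ι → ℂ) → Flag n) (ω : TopForm n) (z : ι → ℂ) :
    (ι → ℂ) [⋀^Fin (nB n)]→L[ℂ] ℂ :=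
  (ω (bigCellCoord (φ z))).compContinuousLinearMap
    (fderiv ℂ (fun z' => bigCellCoord (φ z')) z)

/-- The value of the form `dt_{e 1}/t_{e 1} ∧ dt_{e 2}/t_{e 2} ∧ ⋯` at the point `t` on tangent
vectors `v_1, v_2, …`. -/
def dlogWedge {ι : Type} (e : Fin (nB n) → ι) (t : ι → ℂ) (v : Fin (nB n) → ι → ℂ) : ℂ :=
  (Matrix.of fun k l => v k (e l) / t (e l)).det

/-- `(i_1, …, i_{n_B})` is a reduced expression of the longest element `w₀` of the Weyl group
`S_{n+1}`. -/
def IsReducedWord (i : Fin (nB n) → Fin n) : Prop :=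
  (List.ofFn fun l => Equiv.swap (i l).castSucc (i l).succ).prod = Fin.revPerm

/-- The standard coordinates `(t_1, …, t_{n_B})` on the open Deodhar stratum of `i`. -/
def stratumParam (i : Fin (nB n) → Fin n) (t : Fin (nB n) → ℂ) : Flag n :=
  stratumPoint (List.ofFn fun l => (i l, t l))

/-- `ω` is the holomorphic `n_B`-form on `ℛ^∨_{1,w₀}` which on every open Deodhar stratum is
`ε_𝐢 ⋀ dt_l/t_l` in the standard coordinates, with `ε_𝐢 = ±1`, and `ε = 1` for the reduced
expression `i₁`. -/
def IsMirrorForm (i₁ : Fin (nB n) → Fin n) (ω : TopForm n) : Prop :=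
  DifferentiableOn ℂ ω (bigCell ⁻¹' Rich n) ∧
  ∃ ε : (Fin (nB n) → Fin n) → ℂ, ε i₁ = 1 ∧ ∀ i, IsReducedWord i → (ε i = 1 ∨ ε i = -1) ∧
    ∀ t : Fin (nB n) → ℂ, (∀ l, t l ≠ 0) → ∀ v : Fin (nB n) → Fin (nB n) → ℂ,
      pullback (stratumParam i) ω t v = ε i * dlogWedge id t v

end GiventalMirror

end

open GiventalMirror

noncomputable section

namespace GiventalMirror

/-! ### Regular functions on quasi-affine varieties and Laurent polynomials on tori. -/

section Regular

open MvPolynomial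

variable {X Y κ μ : Type*}

/-! The box relations say that the product of arrow variables along a path depends only on its
endpoints. Hence `𝒵` is a torus on which the vertical arrows `c` and the values of `q̃` are free
nonzero coordinates (`pointOf_mem`, `pointOf_inl`, `pointOf_eq`). In these coordinates `x_𝐜` is a
product `u = C_0 ⋯ C_{n-1}` of unipotent bidiagonal matrices (`coe_xc`), where `C_k e_{m+1} =
e_{m+1} + c_{mk} e_m` for `k ≤ m`.

Lower triangularity of `β`. The factors of `x_𝐝` are multiplied back onto `β` one at a time. At each
step a column is changed by its neighbour, and the vertex variables are precisely the coefficients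
for which the unwanted term cancels (`interMat_mul`). One end of this chain is `x_𝐜 τ ẇ₀⁻¹`; at the
other end the columns are multiples of `C_0 ⋯ C_{k-1} e_n`, which visibly form a lower triangular
matrix (`betaMat_mul_xd`, `betaMat_lower`).

Open embeddings. The minors of `u` with initial rows and consecutive columns are monomials in `c`
(`cornerMinor_partialMat`). So `c` is recovered from ratios of them, and a unitriangular matrix is
of the form `x_𝐜(σ)` exactly when they do not vanish (`IsUni.exists_xc`). For `γ_Q` these minors are
functions on the big cell. For `(τ, β)` they are ratios of minors of `b = u t ẇ₀⁻¹ v`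
(`chamberMinor_div_baseMinor`), and `v` is then forced because `U_+ ∩ B_- = 1`.

Phase function. In the model of `V(ρ)` by functions on `SL_{n+1}`, the coefficient at `v⁻_ρ` is
evaluation at `ẇ₀` (`coeffMinus_of_mem`). The three coefficients in `ℱ_B` become products of leading
minors and their derivatives, and a triangular factorization gives `F(u) + F(v)` (`leadProd_phase`).
Since `F` is additive on unipotent matrices, this is the sum of all arrow variables.

Critical points. With `f` the principal nilpotent, the condition defining `Y` says that the Lax
matrix `u⁻¹ f u` has no entries beyond the first superdiagonal. The vectors `ψ^{(m)}_k` satisfy a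
recursion under a tridiagonal Toda matrix whose error terms are linear in the critical equations
(`toda_psi`), and this yields `T - u⁻¹ f u = (error) u` (`todaMat_sub_laxMat`). Thus the critical
equations are equivalent to tridiagonality together with `q̃_i = -(u⁻¹ f u)_{i,i+1}`. The identity
holds over every commutative ring and in terms of ideals, so it gives both the statement on points
(`bijOn_gammaMap`) and the equality of ideals (`critIdeal_eq`). Since functions on `𝒵` are Laurent
polynomials in `q̃` over the functions on the stratum, the scheme statement amounts to eliminating
`q̃`. This is legitimate because the product of its critical values is a unit modulo the Peterson
ideal (`exists_unit_sub_mem`).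

The form. In logarithmic coordinates the passage from vertex variables to vertical arrows is an
integral matrix of the form nilpotent minus identity, so its determinant is `±1` and does not
involve `Q` (`isUnit_incidence`). -/

theorem coord_mem_regularRing (x : X → κ → ℂ) (S : Set X) (k : κ) :
    (fun p : S => x p k) ∈ regularRing x S :=
  fun _ => ⟨MvPolynomial.X k, 1, by simp, fun q _ => by simp⟩

theorem inv_mem_regularRing {x : X → κ → ℂ} {S : Set X} {f : S → ℂ} (hf : f ∈ regularRing x S)
    (h0 : ∀ p, f p ≠ 0) : (fun p => (f p)⁻¹) ∈ regularRing x S := by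
  intro p
  obtain ⟨P, Q, hQ, h⟩ := hf p
  have hP : MvPolynomial.eval (x p) P ≠ 0 := by
    intro hP
    exact h0 p (by rw [h p hQ, hP, zero_div])
  refine ⟨Q * Q, P * Q, by simp [hP, hQ], fun q hq => ?_⟩
  simp only [map_mul, ne_eq, mul_eq_zero, not_or] at hq ⊢
  rw [h q hq.2, inv_div, mul_div_mul_right _ _ hq.2]

theorem div_mem_regularRing {x : X → κ → ℂ} {S : Set X} {f g : S → ℂ} (hf : f ∈ regularRing x S)
    (hg : g ∈ regularRing x S) (h0 : ∀ p, g p ≠ 0) : (fun p => f p / g p) ∈ regularRing x S := by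
  simp only [div_eq_mul_inv]
  exact mul_mem hf (inv_mem_regularRing hg h0)

theorem mul_mem_regularRing {x : X → κ → ℂ} {S : Set X} {f g : S → ℂ} (hf : f ∈ regularRing x S)
    (hg : g ∈ regularRing x S) : (fun p => f p * g p) ∈ regularRing x S :=
  mul_mem hf hg

theorem const_mem_regularRing (x : X → κ → ℂ) (S : Set X) (c : ℂ) :
    (fun _ => c) ∈ regularRing x S :=
  algebraMap_mem (regularRing x S) c

theorem prod_mem_regularRing {ι : Type*} {x : X → κ → ℂ} {S : Set X} {f : ι → S → ℂ}
    {s : Finset ι} (hf : ∀ i ∈ s, f i ∈ regularRing x S) :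
    (fun p => ∏ i ∈ s, f i p) ∈ regularRing x S := by
  have := prod_mem hf
  convert this using 1
  ext p
  simp

theorem sum_mem_regularRing {ι : Type*} {x : X → κ → ℂ} {S : Set X} {f : ι → S → ℂ}
    {s : Finset ι} (hf : ∀ i ∈ s, f i ∈ regularRing x S) :
    (fun p => ∑ i ∈ s, f i p) ∈ regularRing x S := by
  have := sum_mem hf
  convert this using 1
  ext p
  simp

/-- The determinant of a matrix of regular functions is regular. -/
theorem det_mem_regularRing {ι : Type*} [Fintype ι] [DecidableEq ι] {x : X → κ → ℂ} {S : Set X}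
    {M : S → Matrix ι ι ℂ} (hM : ∀ i j, (fun p => M p i j) ∈ regularRing x S) :
    (fun p => (M p).det) ∈ regularRing x S := by
  simp only [Matrix.det_apply']
  exact sum_mem_regularRing fun σ _ => mul_mem_regularRing (const_mem_regularRing _ _ _)
    (prod_mem_regularRing fun i _ => hM _ _)

theorem matrix_mul_mem_regularRing {ι : Type*} [Fintype ι] {x : X → κ → ℂ} {S : Set X}
    {M N : S → Matrix ι ι ℂ} (hM : ∀ i j, (fun p => M p i j) ∈ regularRing x S)
    (hN : ∀ i j, (fun p => N p i j) ∈ regularRing x S) (i j : ι) :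
    (fun p => (M p * N p) i j) ∈ regularRing x S := by
  simp only [Matrix.mul_apply]
  exact sum_mem_regularRing fun k _ => mul_mem_regularRing (hM _ _) (hN _ _)

theorem matrix_adjugate_mem_regularRing {ι : Type*} [Fintype ι] [DecidableEq ι] {x : X → κ → ℂ}
    {S : Set X} {M : S → Matrix ι ι ℂ} (hM : ∀ i j, (fun p => M p i j) ∈ regularRing x S)
    (i j : ι) : (fun p => (M p).adjugate i j) ∈ regularRing x S := by
  simp only [Matrix.adjugate_apply]
  refine det_mem_regularRing fun k l => ?_
  by_cases hk : k = j
  · subst hk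
    simpa using const_mem_regularRing _ _ _
  · simpa [Matrix.updateRow_apply, hk] using hM k l

/-- Evaluation of a regular function at a point. -/
def evalAt (x : X → κ → ℂ) (S : Set X) (p : S) : regularRing x S →+* ℂ :=
  (Pi.evalRingHom (fun _ : S => ℂ) p).comp (regularRing x S).subtype

@[simp] theorem evalAt_apply (x : X → κ → ℂ) (S : Set X) (p : S) (f : regularRing x S) :
    evalAt x S p f = (f : S → ℂ) p := rfl

/-- The composite of a polynomial with regular functions is regular. -/
theorem eval_mem_regularRing {x : X → κ → ℂ} {S : Set X} {f : μ → S → ℂ}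
    (hf : ∀ l, f l ∈ regularRing x S) (P : MvPolynomial μ ℂ) :
    (fun p => MvPolynomial.eval (fun l => f l p) P) ∈ regularRing x S := by
  induction P using MvPolynomial.induction_on with
  | C a => simpa using const_mem_regularRing _ _ _
  | add p q hp hq =>
    simp only [map_add]
    exact add_mem hp hq
  | mul_X p i hp => simpa using mul_mem_regularRing hp (hf i)

/-- The composite of a regular function with a morphism is regular. -/
theorem comp_mem_regularRing {x : X → κ → ℂ} {S : Set X} {y : Y → μ → ℂ} {R : Set Y}
    {φ : S → R} (hφ : ∀ l, (fun p => y (φ p) l) ∈ regularRing x S) {f : R → ℂ}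
    (hf : f ∈ regularRing y R) : (fun p => f (φ p)) ∈ regularRing x S := by
  intro p
  obtain ⟨P, Q, hQ, h⟩ := hf (φ p)
  obtain ⟨P₁, Q₁, hQ₁, h₁⟩ := eval_mem_regularRing hφ P p
  obtain ⟨P₂, Q₂, hQ₂, h₂⟩ := eval_mem_regularRing hφ Q p
  have hP₂ : MvPolynomial.eval (x p) P₂ ≠ 0 := by
    intro h0
    have := h₂ p hQ₂
    rw [h0, zero_div] at this
    exact hQ this
  refine ⟨P₁ * Q₂ * Q₂, P₂ * Q₁ * Q₂, by simp [hP₂, hQ₁, hQ₂], fun q hq => ?_⟩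
  simp only [map_mul, ne_eq, mul_eq_zero, not_or] at hq ⊢
  obtain ⟨⟨hq2, hq1⟩, hq3⟩ := hq
  have e1 : MvPolynomial.eval (fun l => y (φ q) l) P = _ := h₁ q hq1
  have e2 : MvPolynomial.eval (fun l => y (φ q) l) Q = _ := h₂ q hq3
  have hne : MvPolynomial.eval (fun l => y (φ q) l) Q ≠ 0 := by
    rw [e2]
    exact div_ne_zero hq2 hq3
  rw [h (φ q) hne]
  change MvPolynomial.eval (fun l => y (φ q) l) P / MvPolynomial.eval (fun l => y (φ q) l) Q = _
  rw [e1, e2]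
  field_simp

/-- The nonvanishing locus of a regular function is open. -/
theorem isZariskiOpenIn_ne_zero {x : X → κ → ℂ} {S : Set X} {g : S → ℂ}
    (hg : g ∈ regularRing x S) : IsZariskiOpenIn x S {p | ∃ h : p ∈ S, g ⟨p, h⟩ ≠ 0} := by
  refine ⟨fun p hp => hp.1, ?_⟩
  rintro p ⟨hp, hgp⟩
  obtain ⟨P, Q, hQ, h⟩ := hg ⟨p, hp⟩
  have hP : MvPolynomial.eval (x p) P ≠ 0 := by
    intro hP
    exact hgp (by rw [h ⟨p, hp⟩ hQ]; simp [hP])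
  refine ⟨P * Q, by simpa using ⟨hP, hQ⟩, fun q hq hPQ => ⟨hq, ?_⟩⟩
  simp only [map_mul, ne_eq, mul_eq_zero, not_or] at hPQ
  rw [h ⟨q, hq⟩ hPQ.2]
  exact div_ne_zero hPQ.1 hPQ.2

/-- The points of the torus `(ℂ^*)^κ`. -/
def torus (κ : Type*) : Set (κ → ℂ) := {z | ∀ k, z k ≠ 0}

/-- A polynomial vanishing on the torus is zero. -/
theorem eq_zero_of_eval_torus {P : MvPolynomial κ ℂ}
    (h : ∀ z ∈ torus κ, MvPolynomial.eval z P = 0) : P = 0 := by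
  refine MvPolynomial.funext_set (fun _ => {0}ᶜ) (fun _ => (Set.finite_singleton 0).infinite_compl)
    fun z hz => ?_
  rw [map_zero]
  exact h z fun k => by simpa using hz k

/-- Regular functions on the torus are Laurent polynomials. -/
theorem exists_laurent_of_regular [Fintype κ] {f : torus κ → ℂ}
    (hf : f ∈ regularRing (fun z : κ → ℂ => z) (torus κ)) :
    ∃ (P : MvPolynomial κ ℂ) (N : ℕ), ∀ z : torus κ,
      (∏ k, (z : κ → ℂ) k) ^ N * f z = MvPolynomial.eval (z : κ → ℂ) P := by
  classical
  -- Any point of the torus would do: one local fraction, once reduced, represents the function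
  -- everywhere.
  obtain ⟨P, Q, hQ, h⟩ := hf ⟨fun _ => 1, fun _ => one_ne_zero⟩
  have hQ0 : Q ≠ 0 := by
    rintro rfl
    simp at hQ
  obtain ⟨P', Q', G, hrel, rfl, rfl⟩ := UniqueFactorizationMonoid.exists_reduced_factors' P Q hQ0
  have hQ'0 : Q' ≠ 0 := fun h0 => hQ0 (by simp [h0])
  have hG0 : G ≠ 0 := fun h0 => hQ0 (by simp [h0])
  -- A local fraction `P₁ / Q₁` at `p` equals `P' / Q'` as a rational function, by density of the
  -- torus. Coprimality gives `Q' ∣ Q₁`, so `Q'` does not vanish at `p`.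
  have key : ∀ p : torus κ, MvPolynomial.eval (p : κ → ℂ) Q' ≠ 0 ∧
      f p = MvPolynomial.eval (p : κ → ℂ) P' / MvPolynomial.eval (p : κ → ℂ) Q' := by
    intro p
    obtain ⟨P₁, Q₁, hQ₁, h₁⟩ := hf p
    have hz : P' * Q₁ = P₁ * Q' := by
      have hQ₁0 : Q₁ ≠ 0 := by
        rintro rfl
        simp at hQ₁
      have : (G * Q' * Q₁) * (P' * Q₁ - P₁ * Q') = 0 := by
        refine eq_zero_of_eval_torus fun z hz => ?_
        by_cases h0 : MvPolynomial.eval z (G * Q' * Q₁) = 0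
        · rw [map_mul, h0, zero_mul]
        · have h0' := h0
          simp only [map_mul, mul_eq_zero, not_or] at h0
          have a := h ⟨z, hz⟩ (by simpa using ⟨h0.1.1, h0.1.2⟩)
          have b := h₁ ⟨z, hz⟩ h0.2
          rw [a] at b
          simp only [map_mul] at b
          rw [mul_div_mul_left _ _ h0.1.1, div_eq_div_iff h0.1.2 h0.2] at b
          simp [b]
      rcases mul_eq_zero.1 this with h | h
      · exact absurd h (mul_ne_zero (mul_ne_zero hG0 hQ'0) hQ₁0)
      · exact sub_eq_zero.1 h
    have hdvd : Q' ∣ Q₁ := by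
      have : Q' ∣ P' * Q₁ := hz ▸ dvd_mul_left _ _
      exact hrel.symm.dvd_of_dvd_mul_left this
    have hQp : MvPolynomial.eval (p : κ → ℂ) Q' ≠ 0 := by
      obtain ⟨H, rfl⟩ := hdvd
      intro h0
      exact hQ₁ (by simp [h0])
    refine ⟨hQp, ?_⟩
    rw [h₁ p hQ₁, div_eq_div_iff hQ₁ hQp, ← map_mul, ← map_mul, hz]
  -- Nullstellensatz: all zeros of `Q'` lie on the coordinate hyperplanes, so `Q'` divides a power
  -- of the product of the coordinates.
  have hrad : (∏ k, MvPolynomial.X k : MvPolynomial κ ℂ) ∈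
      (Ideal.span {Q'} : Ideal (MvPolynomial κ ℂ)).radical := by
    rw [← MvPolynomial.vanishingIdeal_zeroLocus_eq_radical (K := ℂ)]
    rw [MvPolynomial.mem_vanishingIdeal_iff]
    intro z hz
    rw [MvPolynomial.mem_zeroLocus_iff] at hz
    have hz' := hz Q' (Ideal.subset_span rfl)
    by_contra hne
    refine (key ⟨z, fun k hk => hne ?_⟩).1 (by simpa [MvPolynomial.aeval_eq_eval] using hz')
    rw [map_prod]
    exact Finset.prod_eq_zero (Finset.mem_univ k) (by simpa using hk)
  obtain ⟨N, hN⟩ := hrad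
  obtain ⟨H, hH⟩ := Ideal.mem_span_singleton'.1 hN
  refine ⟨P' * H, N, fun z => ?_⟩
  rw [(key z).2, map_mul]
  have := congrArg (MvPolynomial.eval (z : κ → ℂ)) hH
  simp only [map_mul, map_pow, map_prod, MvPolynomial.eval_X] at this
  rw [← this]
  field_simp [(key z).1]

end Regular

section Toda

variable {K : Type*} [CommRing K]

/-! ### Products of bidiagonal matrices and the Toda lattice -/

/-- The unipotent bidiagonal matrix `1 + ∑_{i ≥ k} c_{ik} E_{i,i+1}`. -/
def stepMat (n : ℕ) (c : ℕ → ℕ → K) (k : ℕ) : Matrix (Fin (n + 1)) (Fin (n + 1)) K :=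
  Matrix.of fun i j =>
    (if i = j then 1 else 0) + if (i : ℕ) + 1 = j ∧ k ≤ i then c i k else 0

/-- The product of the first `k` bidiagonal matrices. -/
def partialMat (n : ℕ) (c : ℕ → ℕ → K) : ℕ → Matrix (Fin (n + 1)) (Fin (n + 1)) K
  | 0 => 1
  | k + 1 => partialMat n c k * stepMat n c k

/-- The standard basis vectors, indexed by natural numbers. -/
def stdVec (K : Type*) [CommRing K] (n m : ℕ) : Fin (n + 1) → K := fun i => if (i : ℕ) = m then 1 else 0

theorem stdVec_eq_single {n m : ℕ} (h : m < n + 1) :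
    stdVec K n m = Pi.single (⟨m, h⟩ : Fin (n + 1)) 1 := by
  ext i
  simp [stdVec, Pi.single_apply, Fin.ext_iff]

theorem mulVec_stdVec {n m : ℕ} (h : m < n + 1) (M : Matrix (Fin (n + 1)) (Fin (n + 1)) K) :
    M.mulVec (stdVec K n m) = fun i => M i ⟨m, h⟩ := by
  rw [stdVec_eq_single h, Matrix.mulVec_single_one]
  rfl

theorem stepMat_mulVec_succ {n m : ℕ} (h : m < n) (c : ℕ → ℕ → K) (k : ℕ) :
    (stepMat n c k).mulVec (stdVec K n (m + 1)) =
      stdVec K n (m + 1) + (if k ≤ m then c m k else 0) • stdVec K n m := by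
  rw [mulVec_stdVec (by omega)]
  ext i
  simp only [stepMat, Matrix.of_apply, Fin.ext_iff, stdVec, Pi.add_apply, Pi.smul_apply,
    smul_eq_mul, mul_ite, mul_one, mul_zero]
  congr 1
  by_cases hi : (i : ℕ) = m
  · simp only [hi, true_and, if_true]
  · rw [if_neg hi, if_neg fun h => hi (by omega)]

theorem stepMat_mulVec_of_le {n m k : ℕ} (h : m ≤ n) (hk : m ≤ k) (c : ℕ → ℕ → K) :
    (stepMat n c k).mulVec (stdVec K n m) = stdVec K n m := by
  cases m with
  | zero =>
    rw [mulVec_stdVec (by omega)]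
    ext i
    have : ¬ ((i : ℕ) + 1 = 0 ∧ k ≤ i) := by omega
    simp only [stepMat, Matrix.of_apply, stdVec, Fin.ext_iff, if_neg this, add_zero]
  | succ m =>
    rw [stepMat_mulVec_succ (by omega), if_neg (by omega), zero_smul, add_zero]

theorem partialMat_mulVec_of_le {n m k : ℕ} (h : m ≤ n) (hk : m ≤ k) (c : ℕ → ℕ → K) :
    (partialMat n c k).mulVec (stdVec K n m) = (partialMat n c m).mulVec (stdVec K n m) := by
  induction k, hk using Nat.le_induction with
  | base => rfl
  | succ k hk ih =>
    rw [partialMat, ← Matrix.mulVec_mulVec, stepMat_mulVec_of_le h hk, ih]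

/-- The vectors `ψ^{(m)}_k = (C_k ⋯ C_{m-1})⁻¹ e_m`. -/
def psi (c : ℕ → ℕ → K) : ℕ → ℕ → ℕ → K
  | 0, _ => Pi.single 0 1
  | m + 1, k => Pi.single (m + 1) 1 - ∑ l ∈ Finset.Ico k (m + 1), c m l • psi c m l

theorem psi_succ (c : ℕ → ℕ → K) (m k : ℕ) : psi c (m + 1) k =
    Pi.single (m + 1) 1 - ∑ l ∈ Finset.Ico k (m + 1), c m l • psi c m l := rfl

theorem psi_self (c : ℕ → ℕ → K) (m : ℕ) : psi c m m = Pi.single m 1 := by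
  cases m <;> simp [psi]

/-- This is `C_k⁻¹ e_{m+1} = e_{m+1} - c_{mk} C_k⁻¹ e_m` with the inverses of the later factors
applied; `C_m` fixes every `e_i` with `i ≤ m`. -/
theorem psi_succ_sub (c : ℕ → ℕ → K) {m k : ℕ} (h : k ≤ m) :
    psi c (m + 1) (k + 1) - psi c (m + 1) k = c m k • psi c m k := by
  rw [psi_succ, psi_succ, Finset.sum_eq_sum_Ico_succ_bot (a := k) (by omega)]
  abel

theorem psi_support (c : ℕ → ℕ → K) {m k i : ℕ} (h : m < i) : psi c m k i = 0 := by
  induction m generalizing k i with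
  | zero => simp [psi, h.ne']
  | succ m ih =>
    have : ∀ l, psi c m l i = 0 := fun l => ih (by omega)
    simp [psi, h.ne', this]

theorem psi_lower (c : ℕ → ℕ → K) {m k i : ℕ} (hk : k ≤ m) (h : i < k) : psi c m k i = 0 := by
  induction m generalizing k i with
  | zero => omega
  | succ m ih =>
    rw [psi_succ]
    simp only [Pi.sub_apply, Finset.sum_apply, Pi.smul_apply]
    rw [Pi.single_eq_of_ne (by omega), Finset.sum_eq_zero, sub_zero]
    intro l hl
    rw [Finset.mem_Ico] at hl
    rw [ih (by omega) (by omega), smul_zero]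

theorem psi_diag (c : ℕ → ℕ → K) {m i : ℕ} (h : i ≤ m) :
    psi c (m + 1) i i = - (c m i * psi c m i i) := by
  rw [psi_succ, Finset.sum_eq_sum_Ico_succ_bot (by omega)]
  simp only [Pi.sub_apply, Finset.sum_apply, Pi.smul_apply, Pi.add_apply, smul_eq_mul]
  rw [Pi.single_eq_of_ne (by omega), Finset.sum_eq_zero, add_zero, zero_sub]
  intro l hl
  rw [Finset.mem_Ico] at hl
  rw [psi_lower c (by omega) (by omega), mul_zero]

/-- Iterating `psi_diag` shows that the entry is, up to sign, the product of the `c r i` with `i ≤ r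
< m`. -/
theorem isUnit_psi_diag {c : ℕ → ℕ → K} {m i : ℕ} (h : i ≤ m)
    (hc : ∀ r, i ≤ r → r < m → IsUnit (c r i)) : IsUnit (psi c m i i) := by
  induction m, h using Nat.le_induction with
  | base => simp [psi_self]
  | succ m hm ih =>
    rw [psi_diag c hm]
    exact ((hc m hm (by omega)).mul (ih fun r h1 h2 => hc r h1 (by omega))).neg

/-- `u ψ^{(m)}_k = C_0 ⋯ C_{k-1} e_m`. -/
theorem partialMat_mulVec_psi (n : ℕ) (c : ℕ → ℕ → K) {m k : ℕ} (hm : m ≤ n) (hk : k ≤ m) :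
    (partialMat n c n).mulVec (fun i => psi c m k i) =
      (partialMat n c k).mulVec (stdVec K n m) := by
  induction m generalizing k with
  | zero =>
    obtain rfl : k = 0 := by omega
    have : (fun i : Fin (n + 1) => psi c 0 0 i) = stdVec K n 0 := by
      ext i
      simp [psi, stdVec, Pi.single_apply]
    rw [this, partialMat_mulVec_of_le (Nat.zero_le _) (Nat.zero_le _)]
  | succ m ih =>
    have h1 : (fun i : Fin (n + 1) => psi c (m + 1) k i) = stdVec K n (m + 1) -
        ∑ l ∈ Finset.Ico k (m + 1), c m l • fun i : Fin (n + 1) => psi c m l i := by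
      ext i
      simp [psi, stdVec, Pi.single_apply, Finset.sum_apply]
    rw [h1, Matrix.mulVec_sub, Matrix.mulVec_sum, partialMat_mulVec_of_le hm hm]
    -- Each summand is the change caused by appending `C_l` to the partial product acting on
    -- `e_{m+1}`, so the sum telescopes.
    have h2 : ∀ l ∈ Finset.Ico k (m + 1),
        (partialMat n c n).mulVec (c m l • fun i : Fin (n + 1) => psi c m l i) =
        (partialMat n c (l + 1)).mulVec (stdVec K n (m + 1)) -
          (partialMat n c l).mulVec (stdVec K n (m + 1)) := by
      intro l hl
      rw [Finset.mem_Ico] at hl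
      rw [Matrix.mulVec_smul, ih (by omega) (by omega), partialMat, ← Matrix.mulVec_mulVec,
        stepMat_mulVec_succ (by omega), if_pos (by omega), Matrix.mulVec_add, Matrix.mulVec_smul]
      abel
    rw [Finset.sum_congr rfl h2, Finset.sum_Ico_sub (fun l =>
      (partialMat n c l).mulVec (stdVec K n (m + 1))) hk]
    abel

/-- The matrix with columns `ψ^{(m)}_0`, the inverse of the product of all bidiagonal matrices. -/
def psiMat (n : ℕ) (c : ℕ → ℕ → K) : Matrix (Fin (n + 1)) (Fin (n + 1)) K :=
  Matrix.of fun i m => psi c m 0 i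

theorem partialMat_mul_psiMat (n : ℕ) (c : ℕ → ℕ → K) : partialMat n c n * psiMat n c = 1 := by
  ext i m
  have := congrFun (partialMat_mulVec_psi n c (m := m) (k := 0) (by omega) (by omega)) i
  rw [partialMat, Matrix.one_mulVec] at this
  rw [Matrix.one_apply]
  simp only [stdVec] at this
  rw [Matrix.mul_apply]
  simp only [Fin.ext_iff, ← this]
  rfl

theorem psiMat_mul_partialMat (n : ℕ) (c : ℕ → ℕ → K) : psiMat n c * partialMat n c n = 1 :=
  mul_eq_one_comm.1 (partialMat_mul_psiMat n c)

/-- The shift of a sequence, the lower part of the Toda operator. -/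
def shiftSeq : (ℕ → K) →ₗ[K] (ℕ → K) where
  toFun x i := if i = 0 then 0 else x (i - 1)
  map_add' x y := by ext i; by_cases h : i = 0 <;> simp [h]
  map_smul' a x := by ext i; by_cases h : i = 0 <;> simp [h]

/-- The diagonal entries of the Toda operator. -/
def todaDiag (c : ℕ → ℕ → K) (i : ℕ) : K :=
  (∑ l ∈ Finset.range i, c (i - 1) l) - ∑ l ∈ Finset.range (i + 1), c i l

/-- The tridiagonal Toda operator. -/
def toda (c D : ℕ → ℕ → K) : (ℕ → K) →ₗ[K] (ℕ → K) where
  toFun x i := shiftSeq x i + todaDiag c i * x i - c i i * D (i + 1) (i + 1) * x (i + 1)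
  map_add' x y := by ext i; simp only [map_add, Pi.add_apply]; ring
  map_smul' a x := by
    ext i
    simp only [map_smul, Pi.smul_apply, RingHom.id_apply, smul_eq_mul]
    ring

/-- The logarithmic derivatives of the phase function with respect to the vertex `(m + 1, l)`. -/
def vertexEq (c D : ℕ → ℕ → K) (m l : ℕ) : K :=
  c (m + 1) l + D (m + 1) (l + 1) - c m l - D (m + 1) l

/-- The error term in the recursion for `ψ` under the Toda operator. -/
def todaErr (c D : ℕ → ℕ → K) : ℕ → ℕ → ℕ → K
  | 0, _ => 0
  | m + 1, k => (∑ l ∈ Finset.Ico k (m + 1), vertexEq c D m l • psi c (m + 1) l) -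
      (∑ l ∈ Finset.range (m + 1), vertexEq c D m l) • Pi.single (m + 1) 1 -
      ∑ l ∈ Finset.Ico k (m + 1), c m l • todaErr c D m l

theorem toda_single_zero (c D : ℕ → ℕ → K) :
    toda c D (Pi.single 0 1) = Pi.single 1 1 + todaDiag c 0 • Pi.single 0 1 := by
  ext i
  rcases i with _ | _ | i <;> simp [toda, shiftSeq]

theorem toda_single_succ (c D : ℕ → ℕ → K) (m : ℕ) :
    toda c D (Pi.single (m + 1) 1) = Pi.single (m + 2) 1 + todaDiag c (m + 1) • Pi.single (m + 1) 1
      - (c m m * D (m + 1) (m + 1)) • Pi.single m 1 := by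
  ext i
  simp only [toda, shiftSeq, Pi.single_apply, LinearMap.coe_mk, AddHom.coe_mk, Pi.add_apply,
    Pi.sub_apply, Pi.smul_apply, smul_eq_mul, mul_ite, mul_one, mul_zero]
  by_cases h1 : i = m + 2
  · subst h1; simp
  by_cases h2 : i = m + 1
  · subst h2; simp
  by_cases h3 : i = m
  · subst h3; simp
  · have : ¬ i - 1 = m + 1 := by omega
    simp [h1, h2, h3, this]

/-- The operator raises the upper index of `ψ` up to a neighbour term weighted by the horizontal
variable and an error made of critical equations. For `k = 0` the neighbour term disappears because
`D m 0 = 0`, which also makes the truncated `k - 1` harmless. That case says that the operator acts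
on the columns of `u⁻¹` as a shift. -/
theorem toda_psi {c D : ℕ → ℕ → K} (hD : ∀ m, D m 0 = 0)
    {n : ℕ} (hbox : ∀ m l, l ≤ m → m + 1 < n →
      D (m + 2) (l + 1) * c (m + 1) l = D (m + 1) (l + 1) * c (m + 1) (l + 1))
    {m k : ℕ} (hm : m ≤ n) (hk : k ≤ m) :
    toda c D (psi c m k) =
      psi c (m + 1) k + D m k • psi c m (k - 1) + todaErr c D m k := by
  induction m generalizing k with
  | zero =>
    obtain rfl : k = 0 := by omega
    rw [psi_succ]
    simp only [psi, todaErr, hD, toda_single_zero, todaDiag]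
    simp [sub_eq_add_neg]
  | succ m ih =>
    set g : ℕ → ℕ → K := fun l => D (m + 1) l • psi c (m + 1) (l - 1) with hg
    -- The inductive formula is rewritten so that everything except the expected recursion terms and
    -- the errors is a telescoping difference of `g`.
    have h1 : ∀ l ∈ Finset.Ico k (m + 1), c m l • toda c D (psi c m l) =
        c (m + 1) l • psi c (m + 1) l - vertexEq c D m l • psi c (m + 1) l + (g (l + 1) - g l) +
          c m l • todaErr c D m l := by
      intro l hl
      rw [Finset.mem_Ico] at hl
      rw [ih (by omega) (by omega)]
      -- The box relation moves the coefficient `c` to the column `l - 1`, where `psi_succ_sub`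
      -- turns the product into a difference.
      have h2 : c m l • D m l • psi c m (l - 1) =
          D (m + 1) l • (psi c (m + 1) l - psi c (m + 1) (l - 1)) := by
        rcases l with _ | l
        · simp [hD]
        · obtain ⟨m, rfl⟩ : ∃ m', m = m' + 1 := ⟨m - 1, by omega⟩
          simp only [Nat.add_sub_cancel]
          rw [psi_succ_sub c (by omega), smul_smul, smul_smul, hbox m l (by omega) (by omega),
            mul_comm]
      rw [smul_add, smul_add, h2]
      simp only [hg, Nat.add_sub_cancel, smul_sub, vertexEq, sub_smul, add_smul]
      abel
    -- The leading basis vector contributes the diagonal entry of the Toda matrix. That entry is a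
    -- difference of row sums of `c`, and the critical equations convert it into the required
    -- coefficients.
    have h3 : toda c D (Pi.single (m + 1) 1) - D (m + 1) (m + 1) • psi c (m + 1) m =
        Pi.single (m + 2) 1 - c (m + 1) (m + 1) • psi c (m + 1) (m + 1) -
          (∑ l ∈ Finset.range (m + 1), vertexEq c D m l) • Pi.single (m + 1) 1 := by
      have h4 := psi_succ_sub c (le_refl m)
      rw [psi_self, psi_self] at h4
      rw [← sub_sub_cancel (psi c (m + 1) (m + 1)) (psi c (m + 1) m), psi_self, h4,
        toda_single_succ]
      have h5 : ∑ l ∈ Finset.range (m + 1), vertexEq c D m l =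
          ∑ l ∈ Finset.range (m + 1), c (m + 1) l - ∑ l ∈ Finset.range (m + 1), c m l +
            D (m + 1) (m + 1) := by
        have := Finset.sum_range_sub (fun l => D (m + 1) l) (m + 1)
        simp only [hD, sub_zero] at this
        rw [← this, ← Finset.sum_sub_distrib, ← Finset.sum_add_distrib]
        exact Finset.sum_congr rfl fun l _ => by simp only [vertexEq]; ring
      rw [h5, todaDiag, Finset.sum_range_succ _ (m + 1), Nat.add_sub_cancel]
      ext i
      simp only [Pi.add_apply, Pi.sub_apply, Pi.smul_apply, smul_eq_mul]
      ring
    rw [psi_succ c m k, map_sub, map_sum]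
    simp only [map_smul]
    rw [Finset.sum_congr rfl h1, Finset.sum_add_distrib, Finset.sum_add_distrib,
      Finset.sum_sub_distrib, Finset.sum_Ico_sub g hk, psi_succ c (m + 1) k,
      Finset.sum_Ico_succ_top hk, todaErr]
    have h6 : toda c D (Pi.single (m + 1) 1) = D (m + 1) (m + 1) • psi c (m + 1) m +
        (Pi.single (m + 2) 1 - c (m + 1) (m + 1) • psi c (m + 1) (m + 1) -
          (∑ l ∈ Finset.range (m + 1), vertexEq c D m l) • Pi.single (m + 1) 1) := by
      rw [← h3]; abel
    rw [h6]
    simp only [hg, Nat.add_sub_cancel]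
    abel

end Toda

/-! ### Comparison of the Lax matrix with the Toda matrix modulo an ideal. -/

section TodaIdeal

variable {K : Type*} [CommRing K]

theorem todaErr_support (c D : ℕ → ℕ → K) {m k i : ℕ} (h : m < i) : todaErr c D m k i = 0 := by
  induction m generalizing k i with
  | zero => simp [todaErr]
  | succ m ih =>
    have h1 : ∀ l, todaErr c D m l i = 0 := fun l => ih (by omega)
    have h2 : ∀ l, psi c (m + 1) l i = 0 := fun l => psi_support c h
    simp [todaErr, h.ne', h1, h2]

/-- On the diagonal every `ψ^{(m)}_l` has entry `1`, so for `k = 0` the two sums of critical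
equations cancel there. The matrix of errors is therefore strictly upper triangular. -/
theorem todaErr_zero_support (c D : ℕ → ℕ → K) {m i : ℕ} (h : m ≤ i) :
    todaErr c D m 0 i = 0 := by
  rcases h.lt_or_eq with h | rfl
  · exact todaErr_support c D h
  rcases m with _ | m
  · simp [todaErr]
  have h1 : ∀ l, todaErr c D m l (m + 1) = 0 := fun l => todaErr_support c D (by omega)
  have h2 : ∀ l, psi c (m + 1) l (m + 1) = 1 := fun l => by
    have : ∀ l, psi c m l (m + 1) = 0 := fun l => psi_support c (by omega)
    simp [psi, this]
  simp [todaErr, h1, h2, Finset.sum_apply]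

theorem todaErr_mem {c D : ℕ → ℕ → K} {J : Ideal K} {m : ℕ}
    (h : ∀ r l, r < m → l ≤ r → vertexEq c D r l ∈ J) (k i : ℕ) : todaErr c D m k i ∈ J := by
  induction m generalizing k with
  | zero => simp [todaErr]
  | succ m ih =>
    simp only [todaErr, Pi.sub_apply, Finset.sum_apply, Pi.smul_apply, smul_eq_mul]
    refine sub_mem (sub_mem (sum_mem fun l hl => ?_) ?_) (sum_mem fun l _ => ?_)
    · rw [Finset.mem_Ico] at hl
      exact J.mul_mem_right _ (h m l (by omega) (by omega))
    · refine J.mul_mem_right _ (sum_mem fun l hl => ?_)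
      rw [Finset.mem_range] at hl
      exact h m l (by omega) (by omega)
    · exact J.mul_mem_left _ (ih (fun r l hr hl => h r l (by omega) hl) l)

/-- If the error terms of all columns lie in an ideal, so do the critical point equations. -/
theorem vertexEq_mem {c D : ℕ → ℕ → K} {J : Ideal K} {n : ℕ}
    (hc : ∀ i j, j ≤ i → i < n → IsUnit (c i j))
    (h : ∀ m i, m ≤ n → i ≤ n → todaErr c D m 0 i ∈ J) {m l : ℕ} (hm : m < n) (hl : l ≤ m) :
    vertexEq c D m l ∈ J := by
  induction m using Nat.strong_induction_on generalizing l with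
  | _ m ihm =>
    induction l using Nat.strong_induction_on with
    | _ l ihl =>
      have h1 := h (m + 1) l (by omega) (by omega)
      have h2 : ∀ k, todaErr c D m k l ∈ J := fun k =>
        todaErr_mem (fun r s hr hs => ihm r hr (by omega) hs) k l
      simp only [todaErr, Pi.sub_apply, Finset.sum_apply, Pi.smul_apply, smul_eq_mul] at h1
      rw [Pi.single_eq_of_ne (by omega), mul_zero, sub_zero] at h1
      have h3 := add_mem h1 (sum_mem (fun k (_ : k ∈ Finset.Ico 0 (m + 1)) =>
        J.mul_mem_left (c m k) (h2 k)))
      rw [sub_add_cancel, ← Finset.add_sum_erase _ _ (a := l) (by simp; omega)] at h3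
      -- Row `l` of the column `m + 1` is triangular in the equations: those with `x < l` are known
      -- inductively, and those with `x > l` have a vanishing coefficient. The coefficient of the
      -- remaining one is a unit.
      have h4 : ∑ x ∈ (Finset.Ico 0 (m + 1)).erase l,
          vertexEq c D m x * psi c (m + 1) x l ∈ J := by
        refine sum_mem fun x hx => ?_
        rw [Finset.mem_erase, Finset.mem_Ico] at hx
        rcases lt_or_gt_of_ne hx.1 with h | h
        · exact J.mul_mem_right _ (ihl x h (by omega))
        · rw [psi_lower c (by omega) h, mul_zero]
          exact J.zero_mem
      have h5 := (Submodule.add_mem_iff_left J h4).1 h3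
      have hu : IsUnit (psi c (m + 1) l l) :=
        isUnit_psi_diag (by omega) fun r h1 h2 => hc r l h1 (by omega)
      exact (Ideal.mul_unit_mem_iff_mem J hu).1 h5

/-- The principal nilpotent lower triangular matrix `f = ∑ E_{i+1,i}`. -/
def lowNil (K : Type*) [CommRing K] (n : ℕ) : Matrix (Fin (n + 1)) (Fin (n + 1)) K :=
  Matrix.of fun i j => if (i : ℕ) = j + 1 then 1 else 0

/-- The Lax matrix `u⁻¹ f u`. -/
def laxMat (n : ℕ) (c : ℕ → ℕ → K) : Matrix (Fin (n + 1)) (Fin (n + 1)) K :=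
  psiMat n c * lowNil K n * partialMat n c n

/-- The matrix of the Toda operator. -/
def todaMat (n : ℕ) (c D : ℕ → ℕ → K) : Matrix (Fin (n + 1)) (Fin (n + 1)) K :=
  Matrix.of fun i j => toda c D (Pi.single (j : ℕ) 1) i

theorem todaMat_apply (n : ℕ) (c D : ℕ → ℕ → K) (i j : Fin (n + 1)) :
    todaMat n c D i j = (if (i : ℕ) = j + 1 then 1 else 0) + (if i = j then todaDiag c i else 0) -
      if (j : ℕ) = i + 1 then c i i * D (i + 1) (i + 1) else 0 := by
  obtain ⟨i, hi⟩ := i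
  obtain ⟨j, hj⟩ := j
  simp only [todaMat, Matrix.of_apply, Fin.mk.injEq]
  rcases j with _ | j
  · rw [toda_single_zero]
    simp only [Pi.add_apply, Pi.single_apply, Pi.smul_apply, smul_eq_mul, mul_ite, mul_one,
      mul_zero]
    by_cases h : i = 0 <;> simp [h]
  · rw [toda_single_succ]
    simp only [Pi.add_apply, Pi.sub_apply, Pi.single_apply, Pi.smul_apply, smul_eq_mul, mul_ite,
      mul_one, mul_zero]
    by_cases h : i = j + 1
    · subst h; simp
    by_cases h' : i = j
    · subst h'
      have h2 : ¬ i = i + 1 + 1 := by omega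
      simp [h2]
    · have h1 : ¬ j = i := fun h1 => h' h1.symm
      simp [h, h', h1]

theorem psi_eq_sum (n : ℕ) (c : ℕ → ℕ → K) {m k : ℕ} (hm : m ≤ n) :
    psi c m k = ∑ j : Fin (n + 1), psi c m k j • Pi.single (j : ℕ) 1 := by
  ext i
  simp only [Finset.sum_apply, Pi.smul_apply, Pi.single_apply, smul_eq_mul, mul_ite, mul_one,
    mul_zero]
  by_cases hi : i < n + 1
  · rw [Finset.sum_eq_single ⟨i, hi⟩]
    · simp
    · rintro ⟨j, hj⟩ _ hne
      rw [if_neg]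
      rintro rfl
      exact hne rfl
    · simp
  · rw [psi_support c (by omega), Finset.sum_eq_zero]
    rintro ⟨j, hj⟩ _
    rw [if_neg]
    rintro rfl
    exact hi hj

/-- Read columnwise, `toda_psi` at `k = 0` is `T u⁻¹ = u⁻¹ f + error`, because `u⁻¹ f` shifts the
columns of `u⁻¹` by one. -/
theorem todaMat_sub_laxMat {c D : ℕ → ℕ → K} {n : ℕ} (hD : ∀ m, D m 0 = 0)
    (hc : ∀ l, c n l = 0)
    (hbox : ∀ m l, l ≤ m → m + 1 < n →
      D (m + 2) (l + 1) * c (m + 1) l = D (m + 1) (l + 1) * c (m + 1) (l + 1)) :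
    (todaMat n c D - laxMat n c) * psiMat n c =
      Matrix.of fun i m : Fin (n + 1) => todaErr c D m 0 i := by
  have h1 : todaMat n c D * psiMat n c = (psiMat n c * lowNil K n) +
      Matrix.of fun i m : Fin (n + 1) => todaErr c D m 0 i := by
    ext i m
    have h2 := congrFun (toda_psi hD hbox (m := m) (k := 0) (by omega) (by omega)) i
    rw [psi_eq_sum n c (m := m) (by omega), map_sum, Finset.sum_apply] at h2
    simp only [map_smul, Pi.smul_apply, Pi.add_apply, smul_eq_mul, hD, zero_mul, add_zero] at h2
    rw [Matrix.add_apply, Matrix.of_apply, Matrix.mul_apply]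
    simp only [todaMat, psiMat, Matrix.of_apply]
    simp only [mul_comm _ (psi c m 0 _), h2]
    congr 1
    rw [Matrix.mul_apply]
    simp only [lowNil, Matrix.of_apply, mul_ite, mul_one, mul_zero]
    by_cases hm : (m : ℕ) + 1 < n + 1
    · rw [Finset.sum_eq_single ⟨m + 1, hm⟩]
      · simp
      · rintro j _ hne
        rw [if_neg]
        intro h
        exact hne (Fin.ext h)
      · simp
    -- The last column needs the convention that row `n` of `c` is zero: then `ψ^{(n+1)}_0 =
    -- e_{n+1}` has no entries in the range, matching the zero last column of `u⁻¹ f`.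
    · have hmn : (m : ℕ) = n := by omega
      rw [Finset.sum_eq_zero, hmn, psi_succ]
      · simp only [hc, zero_smul, Finset.sum_const_zero, sub_zero]
        rw [Pi.single_eq_of_ne (by omega)]
      · rintro j _
        rw [if_neg (by omega)]
  rw [Matrix.sub_mul, h1, laxMat, Matrix.mul_assoc _ (partialMat n c n),
    partialMat_mul_psiMat, Matrix.mul_one, add_sub_cancel_left]

theorem matrix_mul_mem_ideal {ι : Type*} [Fintype ι] {J : Ideal K} {M N : Matrix ι ι K}
    (h : ∀ i j, M i j ∈ J) (i j : ι) : (M * N) i j ∈ J := by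
  rw [Matrix.mul_apply]
  exact sum_mem fun k _ => J.mul_mem_right _ (h i k)

/-- Modulo the critical point equations, the Lax matrix is the tridiagonal Toda matrix. -/
theorem laxMat_sub_mem {c D : ℕ → ℕ → K} {n : ℕ} (hD : ∀ m, D m 0 = 0)
    (hc : ∀ l, c n l = 0)
    (hbox : ∀ m l, l ≤ m → m + 1 < n →
      D (m + 2) (l + 1) * c (m + 1) l = D (m + 1) (l + 1) * c (m + 1) (l + 1))
    {J : Ideal K} (h : ∀ r l, r < n → l ≤ r → vertexEq c D r l ∈ J) (i j : Fin (n + 1)) :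
    laxMat n c i j - todaMat n c D i j ∈ J := by
  have h1 := congrArg (· * partialMat n c n) (todaMat_sub_laxMat hD hc hbox)
  simp only [Matrix.mul_assoc, psiMat_mul_partialMat, Matrix.mul_one] at h1
  rw [← neg_sub, ← Matrix.sub_apply, h1]
  refine neg_mem (matrix_mul_mem_ideal (fun i m => ?_) i j)
  exact todaErr_mem (fun r l hr hl => h r l (by omega) hl) _ _

/-- The critical point equations lie in the ideal that forces the upper part of the Lax matrix to be
that of the Toda matrix. -/
theorem vertexEq_mem_of_laxMat {c D : ℕ → ℕ → K} {n : ℕ} (hD : ∀ m, D m 0 = 0)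
    (hc : ∀ l, c n l = 0)
    (hbox : ∀ m l, l ≤ m → m + 1 < n →
      D (m + 2) (l + 1) * c (m + 1) l = D (m + 1) (l + 1) * c (m + 1) (l + 1))
    (hunit : ∀ i j, j ≤ i → i < n → IsUnit (c i j)) {J : Ideal K}
    (h1 : ∀ i j : Fin (n + 1), (i : ℕ) + 2 ≤ j → laxMat n c i j ∈ J)
    (h2 : ∀ i : Fin n, laxMat n c i.castSucc i.succ + c i i * D (i + 1) (i + 1) ∈ J)
    {m l : ℕ} (hm : m < n) (hl : l ≤ m) : vertexEq c D m l ∈ J := by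
  have hR := todaMat_sub_laxMat hD hc hbox
  have hR' := congrArg (· * partialMat n c n) hR
  simp only [Matrix.mul_assoc, psiMat_mul_partialMat, Matrix.mul_one] at hR'
  have hupper : ∀ k (i j : Fin (n + 1)), j ≤ i → partialMat n c k i j = if i = j then 1 else 0 := by
    intro k
    induction k with
    | zero => intro i j _; simp [partialMat, Matrix.one_apply]
    | succ k ih =>
      intro i j hij
      rw [partialMat, Matrix.mul_apply, Finset.sum_eq_single i]
      · rw [ih i i le_rfl, if_pos rfl, one_mul]
        have : ¬ ((i : ℕ) + 1 = j ∧ k ≤ i) := by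
          have : (j : ℕ) ≤ i := hij
          omega
        simp [stepMat, this]
      · intro l _ hl
        rcases lt_or_gt_of_ne hl with h | h
        · rw [ih i l h.le, if_neg h.ne', zero_mul]
        · have h3 : ¬ ((l : ℕ) + 1 = j ∧ k ≤ l) := by
            have : (j : ℕ) ≤ i := hij
            have : (i : ℕ) < l := h
            omega
          have h4 : l ≠ j := (hij.trans_lt h).ne'
          simp [stepMat, h3, h4]
      · simp
  -- On and below the diagonal the two matrices agree identically, since the errors are strictly
  -- upper triangular and `u` is unitriangular. Only the entries above the diagonal impose
  -- conditions.
  have hle : ∀ i j : Fin (n + 1), j ≤ i → todaMat n c D i j - laxMat n c i j = 0 := by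
    intro i j hij
    rw [← Matrix.sub_apply, hR', Matrix.mul_apply]
    refine Finset.sum_eq_zero fun m _ => ?_
    rcases lt_or_ge i m with h | h
    · rw [hupper n m j (hij.trans h.le), if_neg (hij.trans_lt h).ne', mul_zero]
    · rw [Matrix.of_apply, todaErr_zero_support c D (by exact_mod_cast h), zero_mul]
  have hmem : ∀ i j, (todaMat n c D - laxMat n c) i j ∈ J := by
    intro i j
    rw [Matrix.sub_apply]
    rcases le_or_gt j i with h | h
    · rw [hle i j h]
      exact J.zero_mem
    · have hij : (i : ℕ) < j := h
      rw [todaMat_apply, if_neg (by omega), if_neg h.ne, zero_add]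
      by_cases h' : (j : ℕ) = i + 1
      · rw [if_pos h', zero_sub, ← neg_add']
        have h3 := h2 ⟨i, by omega⟩
        have h4 : (⟨i, by omega⟩ : Fin n).succ = j := Fin.ext h'.symm
        rw [h4] at h3
        rw [add_comm]
        exact neg_mem h3
      · rw [if_neg h', sub_zero, zero_sub]
        exact neg_mem (h1 i j (by omega))
  refine vertexEq_mem hunit (fun m i hm hi => ?_) hm hl
  have := matrix_mul_mem_ideal (N := psiMat n c) hmem ⟨i, by omega⟩ ⟨m, by omega⟩
  rwa [hR] at this

/-- Each factor moves the column index up by at most one, so reaching column `k` from `0` in `k`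
factors forces a move at every factor, with weight `c i i` at the `i`-th. -/
theorem partialMat_zero_apply {n : ℕ} (c : ℕ → ℕ → K) {k : ℕ} (hk : k ≤ n) :
    partialMat n c k 0 ⟨k, by omega⟩ = ∏ i ∈ Finset.range k, c i i ∧
      ∀ j : Fin (n + 1), k < j → partialMat n c k 0 j = 0 := by
  induction k with
  | zero =>
    refine ⟨?_, fun j hj => ?_⟩
    · rw [partialMat, Finset.range_zero, Finset.prod_empty]
      exact Matrix.one_apply_eq (0 : Fin (n + 1))
    have : (0 : Fin (n + 1)) ≠ j := fun h => by simp [← h] at hj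
    simp [partialMat, this]
  | succ k ih =>
    obtain ⟨ih1, ih2⟩ := ih (by omega)
    constructor
    · rw [partialMat, Matrix.mul_apply, Finset.sum_eq_single ⟨k, by omega⟩, ih1,
        Finset.prod_range_succ]
      · simp [stepMat]
      · intro j _ hj
        by_cases hjk : k < j
        · rw [ih2 j hjk, zero_mul]
        · have : (j : ℕ) ≠ k := fun h => hj (Fin.ext h)
          have h2 : ¬ (j : ℕ) = k + 1 := by omega
          simp [stepMat, h2, Fin.ext_iff]
          intro h3 h4
          omega
      · simp
    · intro j hj
      rw [partialMat, Matrix.mul_apply]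
      refine Finset.sum_eq_zero fun l _ => ?_
      by_cases hl : k < l
      · rw [ih2 l hl, zero_mul]
      · have h1 : ¬ ((l : ℕ) + 1 = j ∧ k ≤ l) := by omega
        have h2 : l ≠ j := fun h => by subst h; omega
        simp only [stepMat, Matrix.of_apply, if_neg h1, if_neg h2, add_zero, mul_zero]

theorem lowNil_pow (n m : ℕ) : lowNil K n ^ m =
    Matrix.of fun i j : Fin (n + 1) => if (i : ℕ) = j + m then (1 : K) else 0 := by
  induction m with
  | zero => ext i j; simp [Matrix.one_apply, Fin.ext_iff]
  | succ m ih =>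
    ext i j
    rw [pow_succ, ih, Matrix.mul_apply]
    simp only [lowNil, Matrix.of_apply, mul_ite, mul_one, mul_zero]
    by_cases hj : (j : ℕ) + 1 < n + 1
    · rw [Finset.sum_eq_single ⟨j + 1, hj⟩]
      · have : (j : ℕ) + 1 + m = j + (m + 1) := by ring
        simp [this]
      · intro l _ hl
        rw [if_neg]
        intro h
        exact hl (Fin.ext h)
      · simp
    · rw [Finset.sum_eq_zero, if_neg (by omega)]
      intro l _
      rw [if_neg (by omega)]

/-- The product of the entries above the diagonal of the Lax matrix is a unit modulo the ideal that
makes it tridiagonal. -/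
theorem prod_laxMat_sub_mem {n : ℕ} (c : ℕ → ℕ → K) {J : Ideal K}
    (h1 : ∀ i j : Fin (n + 1), (i : ℕ) + 2 ≤ j → laxMat n c i j ∈ J) :
    (∏ i : Fin n, laxMat n c i.castSucc i.succ) -
      psi c n 0 0 * ∏ i ∈ Finset.range n, c i i ∈ J := by
  set A := laxMat n c with hA
  -- Modulo `J` the matrix raises an index by at most one, so the only path of length `m` from `0`
  -- to `m` runs along the superdiagonal.
  have key : ∀ m, (∀ hm : m ≤ n, (A ^ m) 0 ⟨m, by omega⟩ -
      ∏ i : Fin m, A ⟨i, by omega⟩ ⟨i + 1, by omega⟩ ∈ J) ∧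
      ∀ j : Fin (n + 1), m < j → (A ^ m) 0 j ∈ J := by
    intro m
    induction m with
    | zero =>
      refine ⟨by simp, fun j hj => ?_⟩
      have : (0 : Fin (n + 1)) ≠ j := fun h => by simp [← h] at hj
      simp [this]
    | succ m ih =>
      constructor
      · intro hm
        rw [pow_succ, Matrix.mul_apply, ← Finset.add_sum_erase _ _
          (Finset.mem_univ (⟨m, by omega⟩ : Fin (n + 1))), Fin.prod_univ_castSucc]
        have h2 : ∑ x ∈ Finset.univ.erase (⟨m, by omega⟩ : Fin (n + 1)),
            (A ^ m) 0 x * A x ⟨m + 1, by omega⟩ ∈ J := by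
          refine sum_mem fun x hx => ?_
          rw [Finset.mem_erase] at hx
          have hx' : (x : ℕ) ≠ m := fun h => hx.1 (Fin.ext h)
          by_cases h : m < x
          · exact J.mul_mem_right _ (ih.2 x h)
          · exact J.mul_mem_left _ (h1 _ _ (by simp; omega))
        have h3 := J.mul_mem_right (A ⟨m, by omega⟩ ⟨m + 1, by omega⟩) (ih.1 (by omega))
        rw [sub_mul] at h3
        have := add_mem h3 h2
        convert this using 1
        simp only [Fin.val_castSucc, Fin.val_last]
        ring
      · intro j hj
        rw [pow_succ, Matrix.mul_apply]
        refine sum_mem fun x _ => ?_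
        by_cases h : m < x
        · exact J.mul_mem_right _ (ih.2 x h)
        · exact J.mul_mem_left _ (h1 _ _ (by omega))
  have hpow : ∀ m, A ^ m = psiMat n c * lowNil K n ^ m * partialMat n c n := by
    intro m
    induction m with
    | zero => simp [psiMat_mul_partialMat]
    | succ m ih =>
      rw [pow_succ, ih, hA, laxMat, pow_succ]
      simp only [Matrix.mul_assoc]
      rw [← Matrix.mul_assoc (partialMat n c n) (psiMat n c), partialMat_mul_psiMat,
        Matrix.one_mul]
  have h4 := (key n).1 le_rfl
  -- The power `f ^ n` is the matrix unit in the lower left corner, so the entry of `u⁻¹ f ^ n u` is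
  -- the product of the upper right corners of `u⁻¹` and `u`.
  have h5 : (A ^ n) 0 ⟨n, by omega⟩ = psi c n 0 0 * ∏ i ∈ Finset.range n, c i i := by
    rw [hpow, Matrix.mul_apply, Finset.sum_eq_single 0, (partialMat_zero_apply c le_rfl).1.symm]
    · congr 1
      rw [Matrix.mul_apply, Finset.sum_eq_single (Fin.last n)]
      · simp [lowNil_pow, psiMat]
      · intro j _ hj
        have : (j : ℕ) ≠ n := fun h => hj (Fin.ext h)
        simp [lowNil_pow, this]
      · simp
    · intro j _ hj
      have : 0 < (j : ℕ) := Fin.pos_of_ne_zero hj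
      have h6 : (psiMat n c * lowNil K n ^ n) 0 j = 0 := by
        rw [Matrix.mul_apply]
        refine Finset.sum_eq_zero fun l _ => ?_
        rw [lowNil_pow, Matrix.of_apply, if_neg (by omega), mul_zero]
      rw [h6, zero_mul]
    · simp
  rw [h5, ← neg_mem_iff, neg_sub] at h4
  exact h4

end TodaIdeal

section Products

/-! ### The products over the words `cOrder` and `dOrder` as iterated products -/

theorem prod_map_filterMap {α β M : Type*} [Monoid M] (l : List α) (p : α → Prop)
    [DecidablePred p] (g : ∀ a, p a → β) (f : β → M) :
    ((l.filterMap fun a => if h : p a then some (g a h) else none).map f).prod =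
      (l.map fun a => if h : p a then f (g a h) else 1).prod := by
  induction l with
  | nil => rfl
  | cons a l ih =>
    by_cases h : p a
    · simp [h, ih]
    · simp [h, ih]

theorem prod_map_flatMap {α β M : Type*} [Monoid M] (l : List α) (g : α → List β) (f : β → M) :
    ((l.flatMap g).map f).prod = (l.map fun a => ((g a).map f).prod).prod := by
  induction l with
  | nil => rfl
  | cons a l ih => simp [List.flatMap_cons, ih]

theorem map_finRange_eq {M : Type*} (n : ℕ) (f : ℕ → M) :
    (List.finRange n).map (fun j : Fin n => f (j : ℕ)) = (List.range n).map f := by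
  rw [← List.map_coe_finRange_eq_range, List.map_map]
  rfl

theorem map_finRange_reverse_eq {M : Type*} (n : ℕ) (f : ℕ → M) :
    (List.finRange n).reverse.map (fun j : Fin n => f (j : ℕ)) = (List.range n).reverse.map f := by
  rw [List.map_reverse, map_finRange_eq, List.map_reverse]

theorem prod_cOrder {n : ℕ} {M : Type*} [Monoid M] (f : ℕ → ℕ → M) :
    ((cOrder n).map fun a => f a.1.1 a.1.2).prod =
      ((List.range n).map fun k =>
        ((List.range n).reverse.map fun j => if k ≤ j then f j k else 1).prod).prod := by
  rw [cOrder, prod_map_flatMap, ← map_finRange_eq]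
  refine congrArg List.prod (List.map_congr_left fun k _ => ?_)
  rw [prod_map_filterMap, ← map_finRange_reverse_eq]
  rfl

theorem prod_dOrder {n : ℕ} {M : Type*} [Monoid M] (f : ℕ → ℕ → M) :
    ((dOrder n).map fun a => f a.1.1 a.1.2).prod =
      ((List.range n).reverse.map fun k =>
        ((List.range n).map fun j => if j ≤ k then f k j else 1).prod).prod := by
  rw [dOrder, prod_map_flatMap, ← map_finRange_reverse_eq]
  refine congrArg List.prod (List.map_congr_left fun k _ => ?_)
  rw [prod_map_filterMap, ← map_finRange_eq]
  rfl

end Products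

/-! ### Matrix form of `x_𝐜`, `x_𝐝` and `β`. -/

section Matrices

variable {n : ℕ}

/-- The inclusion of `SL_{n+1}` into matrices. -/
def slVal (n : ℕ) : SLv n →* Mat n where
  toFun g := g
  map_one' := rfl
  map_mul' _ _ := rfl

@[simp] theorem slVal_apply (g : SLv n) : slVal n g = (g : Mat n) := rfl

/-- A function on the triangle as a function of two natural numbers. -/
def extTri {K : Type*} [Zero K] (c : Tri n → K) (i j : ℕ) : K :=
  if h : j ≤ i ∧ i < n then c ⟨(⟨i, h.2⟩, ⟨j, h.1.trans_lt h.2⟩), h.1⟩ else 0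

theorem extTri_apply {K : Type*} [Zero K] (c : Tri n → K) (a : Tri n) :
    extTri c a.1.1 a.1.2 = c a := by
  have : (a.1.2 : ℕ) ≤ a.1.1 := a.2
  simp [extTri, this]

/-- The matrix `1 + t E_{i,i+1}`. -/
def xMat (n i : ℕ) (t : ℂ) : Mat n :=
  Matrix.of fun a b => (if a = b then 1 else 0) + if (a : ℕ) = i ∧ (b : ℕ) = i + 1 then t else 0

/-- The matrix `1 + t E_{i+1,i}`. -/
def yMat (n i : ℕ) (t : ℂ) : Mat n :=
  Matrix.of fun a b => (if a = b then 1 else 0) + if (a : ℕ) = i + 1 ∧ (b : ℕ) = i then t else 0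

theorem coe_xRoot (i : Fin n) (t : ℂ) : (xRoot i t : Mat n) = xMat n i t := by
  ext a b
  rw [xRoot, Matrix.SpecialLinearGroup.transvection_coe]
  simp only [xMat, Matrix.add_apply, Matrix.one_apply, Matrix.single_apply, Matrix.of_apply,
    Fin.ext_iff, Fin.val_castSucc, Fin.val_succ]
  simp only [eq_comm]

theorem coe_yRoot (i : Fin n) (t : ℂ) : (yRoot i t : Mat n) = yMat n i t := by
  ext a b
  rw [yRoot, Matrix.SpecialLinearGroup.transvection_coe]
  simp only [yMat, Matrix.add_apply, Matrix.one_apply, Matrix.single_apply, Matrix.of_apply,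
    Fin.ext_iff, Fin.val_castSucc, Fin.val_succ]
  simp only [eq_comm]

theorem xMat_mulVec {i m : ℕ} (hm : m ≤ n) (t : ℂ) :
    (xMat n i t).mulVec (stdVec ℂ n m) =
      stdVec ℂ n m + (if m = i + 1 then t else 0) • stdVec ℂ n i := by
  rw [mulVec_stdVec (by omega)]
  ext a
  by_cases h : (a : ℕ) = i <;> by_cases h' : m = i + 1 <;>
    simp [xMat, stdVec, Fin.ext_iff, h, h']

theorem yMat_mulVec {i m : ℕ} (hm : m ≤ n) (t : ℂ) :
    (yMat n i t).mulVec (stdVec ℂ n m) =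
      stdVec ℂ n m + (if m = i then t else 0) • stdVec ℂ n (i + 1) := by
  rw [mulVec_stdVec (by omega)]
  ext a
  by_cases h : (a : ℕ) = i + 1 <;> by_cases h' : m = i <;>
    simp [yMat, stdVec, Fin.ext_iff, h, h']

/-- The bidiagonal matrix `1 + ∑ a_i E_{i,i+1}`. -/
def bidiag (n : ℕ) (a : ℕ → ℂ) : Mat n :=
  Matrix.of fun i j => (if i = j then 1 else 0) + if (i : ℕ) + 1 = j then a i else 0

theorem stepMat_eq_bidiag (c : ℕ → ℕ → ℂ) (k : ℕ) :
    stepMat n c k = bidiag n fun i => if k ≤ i then c i k else 0 := by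
  ext i j
  simp only [stepMat, bidiag, Matrix.of_apply]
  by_cases h : k ≤ i <;> simp [h]

/-- Row `i + 1` of the bidiagonal matrix is still a row of the identity, so multiplication by
`E_{i,i+1}` produces no cross terms. -/
theorem xMat_mul_bidiag {i : ℕ} (a : ℕ → ℂ) (ha : ∀ j, i ≤ j → a j = 0) (t : ℂ) :
    xMat n i t * bidiag n a = bidiag n (Function.update a i t) := by
  have h1 : xMat n i t = 1 + (xMat n i t - 1) := by abel
  have h2 : (xMat n i t - 1) * bidiag n a = xMat n i t - 1 := by
    ext p q
    rw [Matrix.mul_apply]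
    simp only [Matrix.sub_apply, xMat, Matrix.of_apply, Matrix.one_apply, add_sub_cancel_left]
    rw [Finset.sum_eq_single q]
    · by_cases h : (p : ℕ) = i ∧ (q : ℕ) = i + 1
      · simp [bidiag]
      · simp [h]
    · intro l _ hl
      by_cases h : (p : ℕ) = i ∧ (l : ℕ) = i + 1
      · rw [if_pos h, bidiag, Matrix.of_apply, if_neg hl, ha l (by omega)]
        simp
      · rw [if_neg h, zero_mul]
    · simp
  rw [h1, add_mul, one_mul, h2]
  ext p q
  simp only [bidiag, xMat, Matrix.add_apply, Matrix.sub_apply, Matrix.of_apply, Matrix.one_apply,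
    add_sub_cancel_left, Function.update_apply]
  by_cases hp : (p : ℕ) = i
  · simp only [hp, ha i le_rfl]
    by_cases hq : (q : ℕ) = i + 1
    · simp [hq]
    · simp [hq, Ne.symm hq]
  · simp [hp]

theorem bidiag_zero : bidiag n (fun _ => 0) = 1 := by
  ext i j
  simp [bidiag, Matrix.one_apply]

theorem prod_xMat_desc (a : ℕ → ℂ) (m : ℕ) :
    ((List.range m).reverse.map fun j => xMat n j (a j)).prod =
      bidiag n fun j => if j < m then a j else 0 := by
  induction m with
  | zero => simp [bidiag_zero]
  | succ m ih =>
    rw [List.range_succ, List.reverse_append, List.reverse_singleton, List.singleton_append,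
      List.map_cons, List.prod_cons, ih, xMat_mul_bidiag _ (fun j hj => if_neg (by omega))]
    congr 1
    ext j
    rw [Function.update_apply]
    by_cases h : j = m
    · simp [h]
    · rw [if_neg h]
      by_cases h' : j < m
      · rw [if_pos h', if_pos (by omega)]
      · rw [if_neg h', if_neg (by omega)]

theorem bidiag_congr {a b : ℕ → ℂ} (h : ∀ i < n, a i = b i) : bidiag n a = bidiag n b := by
  ext i j
  simp only [bidiag, Matrix.of_apply]
  by_cases hij : (i : ℕ) + 1 = j
  · rw [h i (by omega)]
  · simp [hij]

theorem xMat_zero (i : ℕ) : xMat n i 0 = 1 := by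
  ext a b
  simp [xMat, Matrix.one_apply]

theorem partialMat_eq_prod (c : ℕ → ℕ → ℂ) (k : ℕ) :
    ((List.range k).map (stepMat n c)).prod = partialMat n c k := by
  induction k with
  | zero => rfl
  | succ k ih =>
    rw [List.range_succ, List.map_append, List.prod_append, ih]
    simp [partialMat]

/-- For fixed `k` the root indices descend, so the factors merge into the single bidiagonal matrix
`C_k`. -/
theorem coe_xc (σ : Arrow n → ℂ) :
    (xc σ : Mat n) = partialMat n (extTri fun a => σ (.inl a)) n := by
  set c := extTri fun a => σ (.inl a) with hc
  rw [← slVal_apply, xc, map_list_prod, List.map_map]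
  have h1 : (cOrder n).map (slVal n ∘ fun a => xRoot a.1.1 (σ (.inl a))) =
      (cOrder n).map fun a => xMat n a.1.1 (c a.1.1 a.1.2) := by
    refine List.map_congr_left fun a _ => ?_
    simp only [Function.comp_apply, slVal_apply, coe_xRoot, hc]
    rw [extTri_apply (fun a => σ (.inl a))]
  rw [h1, prod_cOrder (fun j k => xMat n j (c j k)), ← partialMat_eq_prod]
  congr 2
  ext1 k
  have h2 : (fun j => if k ≤ j then xMat n j (c j k) else 1) =
      fun j => xMat n j (if k ≤ j then c j k else 0) := by
    ext1 j
    by_cases h : k ≤ j <;> simp [h, xMat_zero]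
  rw [h2, prod_xMat_desc, stepMat_eq_bidiag]
  exact bidiag_congr fun i hi => by simp [hi]

/-- The product of the first `r` factors (from the right) of `x_𝐝`. -/
def dPartial (n : ℕ) (d : ℕ → ℕ → ℂ) : ℕ → Mat n
  | 0 => 1
  | k + 1 => (bidiag n fun i => if n - 1 - i ≤ k then d k (n - 1 - i) else 0) * dPartial n d k

/-- The arrow `(k, j)` carries the reversed root index `n - 1 - j`; ascending `j` is thus again a
descending product, which collapses to one bidiagonal matrix. -/
theorem coe_xd (σ : Arrow n → ℂ) :
    (xd σ : Mat n) = dPartial n (extTri fun a => σ (.inr a)) n := by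
  set d := extTri fun a => σ (.inr a) with hd
  rw [← slVal_apply, xd, map_list_prod, List.map_map]
  have h1 : (dOrder n).map (slVal n ∘ fun a => xRoot a.1.2.rev (σ (.inr a))) =
      (dOrder n).map fun a => xMat n (n - 1 - a.1.2) (d a.1.1 a.1.2) := by
    refine List.map_congr_left fun a _ => ?_
    simp only [Function.comp_apply, slVal_apply, coe_xRoot, hd]
    rw [extTri_apply (fun a => σ (.inr a)), Fin.val_rev]
    congr 1
    omega
  rw [h1, prod_dOrder (fun k j => xMat n (n - 1 - j) (d k j))]
  have h3 : ∀ k, ((List.range n).map fun j => if j ≤ k then xMat n (n - 1 - j) (d k j) else 1).prod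
      = bidiag n fun i => if n - 1 - i ≤ k then d k (n - 1 - i) else 0 := by
    intro k
    have h2 : (List.range n).map (fun j => if j ≤ k then xMat n (n - 1 - j) (d k j) else 1) =
        (List.range n).reverse.map fun i => xMat n i
          (if n - 1 - i ≤ k then d k (n - 1 - i) else 0) := by
      rw [← map_finRange_eq, ← map_finRange_reverse_eq, List.finRange_reverse, List.map_map]
      refine List.map_congr_left fun j _ => ?_
      have h4 : n - (j + 1 : ℕ) = n - 1 - j := by omega
      have h5 : n - 1 - (n - 1 - (j : ℕ)) = j := by omega
      simp only [Function.comp_apply, Fin.val_rev, h4, h5]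
      by_cases h : (j : ℕ) ≤ k <;> simp [h, xMat_zero]
    rw [h2, prod_xMat_desc]
    exact bidiag_congr fun i hi => by simp [hi]
  simp only [h3]
  have h4 : ∀ r, ((List.range r).reverse.map fun k =>
      bidiag n fun i => if n - 1 - i ≤ k then d k (n - 1 - i) else 0).prod = dPartial n d r := by
    intro r
    induction r with
    | zero => rfl
    | succ r ih =>
      rw [List.range_succ, List.reverse_append, List.reverse_singleton, List.singleton_append,
        List.map_cons, List.prod_cons, ih, dPartial]
  exact h4 n

theorem mul_bidiag_apply_zero (M : Mat n) (a : ℕ → ℂ) (i : Fin (n + 1)) :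
    (M * bidiag n a) i 0 = M i 0 := by
  rw [Matrix.mul_apply, Finset.sum_eq_single 0]
  · simp [bidiag]
  · intro l _ hl
    simp [bidiag, hl]
  · simp

theorem mul_bidiag_apply_succ (M : Mat n) (a : ℕ → ℂ) (i : Fin (n + 1)) (l : Fin n) :
    (M * bidiag n a) i l.succ = M i l.succ + M i l.castSucc * a l := by
  rw [Matrix.mul_apply, ← Finset.add_sum_erase _ _ (Finset.mem_univ l.succ),
    Finset.sum_eq_single l.castSucc]
  · simp [bidiag, Fin.ext_iff]
  · intro b hb hl
    rw [Finset.mem_erase] at hb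
    have h1 : ¬ ((b : ℕ) = l) := fun h => hl (Fin.ext h)
    have h2 : ¬ ((b : ℕ) + 1 = l + 1) := by omega
    simp [bidiag, hb.1, h1]
  · intro h
    exfalso
    apply h
    rw [Finset.mem_erase]
    exact ⟨Fin.castSucc_lt_succ.ne, Finset.mem_univ _⟩

/-- The matrices interpolating between `x_𝐜 τ ẇ₀⁻¹` and `β`. -/
def interMat (n : ℕ) (c t : ℕ → ℕ → ℂ) (r : ℕ) : Mat n :=
  Matrix.of fun i l =>
    if n - l ≤ r then
      (-1) ^ (n - r) * t r (n - l) * (partialMat n c (n - l)).mulVec (stdVec ℂ n r) i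
    else (-1) ^ (l : ℕ) * t (n - l) (n - l) *
      (partialMat n c (n - l)).mulVec (stdVec ℂ n (n - l)) i

/-- In an affected column, `C_k e_{r+1} = e_{r+1} + c_{rk} e_r`. The relation for `d` makes the
`e_{r+1}` terms of two neighbouring columns cancel, and the relation for `c` turns the surviving
coefficient into `t r k` with one more sign. -/
theorem interMat_mul {c d t : ℕ → ℕ → ℂ} (hc : ∀ i j, j ≤ i → i < n → t i j = c i j * t (i + 1) j)
    (hd : ∀ i j, j ≤ i → i < n → t (i + 1) j = d i j * t (i + 1) (j + 1)) {r : ℕ} (hr : r < n) :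
    (interMat n c t (r + 1) * bidiag n fun i =>
      if n - 1 - i ≤ r then - d r (n - 1 - i) else 0) = interMat n c t r := by
  -- The two branches in the definition of `interMat` agree at the boundary `n - l = r + 1`, so the
  -- columns not yet reached do not change.
  have hsame : ∀ i (l : Fin (n + 1)), r < n - l →
      interMat n c t (r + 1) i l = interMat n c t r i l := by
    intro i l h
    simp only [interMat, Matrix.of_apply]
    rw [if_neg (by omega : ¬ n - (l : ℕ) ≤ r)]
    by_cases h' : n - (l : ℕ) = r + 1
    · rw [if_pos h'.le, h', show n - (r + 1) = l by omega]
    · rw [if_neg (by omega)]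
  ext i l
  refine Fin.cases ?_ (fun l => ?_) l
  · rw [mul_bidiag_apply_zero]
    exact hsame i 0 (by simpa using hr)
  · rw [mul_bidiag_apply_succ]
    by_cases h : n - 1 - (l : ℕ) ≤ r
    · rw [if_pos h]
      obtain ⟨k, hk⟩ : ∃ k, n - 1 - (l : ℕ) = k := ⟨_, rfl⟩
      have e1 : n - ((l.succ : Fin (n + 1)) : ℕ) = k := by rw [Fin.val_succ]; omega
      have e2 : n - ((l.castSucc : Fin (n + 1)) : ℕ) = k + 1 := by rw [Fin.val_castSucc]; omega
      simp only [interMat, Matrix.of_apply, e1, e2, hk]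
      rw [if_pos (by omega), if_pos (by omega), if_pos (by omega), partialMat,
        ← Matrix.mulVec_mulVec, stepMat_mulVec_succ hr, if_pos (by omega), Matrix.mulVec_add,
        Matrix.mulVec_smul, hc r k (by omega) hr, hd r k (by omega) hr]
      simp only [Pi.add_apply, Pi.smul_apply, smul_eq_mul]
      obtain ⟨s, hs⟩ : ∃ s, n - r = s + 1 := ⟨n - r - 1, by omega⟩
      rw [hs, show n - (r + 1) = s by omega, pow_succ]
      ring
    · rw [if_neg h, mul_zero, add_zero]
      exact hsame i _ (by rw [Fin.val_succ]; omega)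

theorem interMat_mul_dPartial {c d t : ℕ → ℕ → ℂ}
    (hc : ∀ i j, j ≤ i → i < n → t i j = c i j * t (i + 1) j)
    (hd : ∀ i j, j ≤ i → i < n → t (i + 1) j = d i j * t (i + 1) (j + 1)) {r : ℕ} (hr : r ≤ n) :
    interMat n c t r * dPartial n (fun i j => - d i j) r = interMat n c t 0 := by
  induction r with
  | zero => rw [dPartial, mul_one]
  | succ r ih => rw [dPartial, ← mul_assoc, interMat_mul hc hd (by omega), ih (by omega)]

/-- The signed antidiagonal matrix `ẇ₀⁻¹`. -/
def antiMat (n : ℕ) : Mat n :=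
  Matrix.of fun i j => if (i : ℕ) + j = n then (-1) ^ (j : ℕ) else 0

theorem interMat_zero (c t : ℕ → ℕ → ℂ) :
    interMat n c t 0 = partialMat n c n * Matrix.diagonal (fun i : Fin (n + 1) => t i i) *
      antiMat n := by
  ext i l
  rw [mul_assoc, Matrix.mul_apply, Finset.sum_eq_single (⟨n - l, by omega⟩ : Fin (n + 1))]
  · rw [Matrix.diagonal_mul, antiMat, Matrix.of_apply, if_pos (by simp; omega)]
    have h1 : partialMat n c n i ⟨n - l, by omega⟩ =
        (partialMat n c (n - l)).mulVec (stdVec ℂ n (n - l)) i := by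
      rw [← partialMat_mulVec_of_le (by omega) (by omega : n - (l : ℕ) ≤ n),
        mulVec_stdVec (by omega)]
    rw [h1]
    simp only [interMat, Matrix.of_apply]
    by_cases h : n - (l : ℕ) ≤ 0
    · rw [if_pos h, show n - (l : ℕ) = 0 by omega, show (l : ℕ) = n by omega]
      simp only [Nat.sub_zero]
      ring
    · rw [if_neg h]
      ring
  · intro b _ hb
    have : ¬ (b : ℕ) + l = n := fun h => hb (Fin.ext (by simp; omega))
    rw [Matrix.diagonal_mul, antiMat, Matrix.of_apply, if_neg this, mul_zero, mul_zero]
  · simp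

/-- The matrix of `β`. -/
def betaMat (n : ℕ) (c t : ℕ → ℕ → ℂ) : Mat n :=
  Matrix.of fun i l => t n (n - l) * (partialMat n c (n - l)).mulVec (stdVec ℂ n n) i

theorem interMat_top (c t : ℕ → ℕ → ℂ) : interMat n c t n = betaMat n c t := by
  ext i l
  simp [interMat, betaMat]

theorem betaMat_mul {c d t : ℕ → ℕ → ℂ}
    (hc : ∀ i j, j ≤ i → i < n → t i j = c i j * t (i + 1) j)
    (hd : ∀ i j, j ≤ i → i < n → t (i + 1) j = d i j * t (i + 1) (j + 1)) :
    betaMat n c t * dPartial n (fun i j => - d i j) n =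
      partialMat n c n * Matrix.diagonal (fun i : Fin (n + 1) => t i i) * antiMat n := by
  rw [← interMat_top, interMat_mul_dPartial hc hd le_rfl, interMat_zero]

/-- Each bidiagonal factor lowers the index of a basis vector by at most one. -/
theorem partialMat_mulVec_apply_eq_zero (c : ℕ → ℕ → ℂ) {k m : ℕ} (hm : m ≤ n)
    {i : Fin (n + 1)} (hi : (i : ℕ) + k < m) :
    (partialMat n c k).mulVec (stdVec ℂ n m) i = 0 := by
  induction k generalizing m with
  | zero =>
    rw [partialMat, Matrix.one_mulVec, stdVec, if_neg (by omega)]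
  | succ k ih =>
    obtain ⟨m, rfl⟩ : ∃ m', m = m' + 1 := ⟨m - 1, by omega⟩
    rw [partialMat, ← Matrix.mulVec_mulVec, stepMat_mulVec_succ (by omega), Matrix.mulVec_add,
      Matrix.mulVec_smul, Pi.add_apply, Pi.smul_apply, ih hm (by omega), ih (by omega) (by omega)]
    simp

/-- `β` is lower triangular. -/
theorem betaMat_lower (c t : ℕ → ℕ → ℂ) {i l : Fin (n + 1)} (h : i < l) :
    betaMat n c t i l = 0 := by
  have h' : (i : ℕ) < l := h
  rw [betaMat, Matrix.of_apply, partialMat_mulVec_apply_eq_zero c le_rfl (by omega), mul_zero]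

end Matrices

/-! ### The representative `ẇ₀` as a signed antidiagonal matrix. -/

section LongestElement

variable {n : ℕ}

/-- The matrix of `ṡ_j`. -/
def sMat (n j : ℕ) : Mat n := xMat n j 1 * yMat n j (-1) * xMat n j 1

theorem sMat_mulVec {j x : ℕ} (hj : j < n) (hx : x ≤ n) :
    (sMat n j).mulVec (stdVec ℂ n x) =
      if x = j then - stdVec ℂ n (j + 1) else if x = j + 1 then stdVec ℂ n j
        else stdVec ℂ n x := by
  rw [sMat, ← Matrix.mulVec_mulVec, ← Matrix.mulVec_mulVec, xMat_mulVec hx]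
  simp only [Matrix.mulVec_add, Matrix.mulVec_smul]
  rw [yMat_mulVec hx, yMat_mulVec hj.le]
  simp only [Matrix.mulVec_add, Matrix.mulVec_smul]
  rw [xMat_mulVec hx, xMat_mulVec hj.le, xMat_mulVec (m := j + 1) (by omega)]
  by_cases h1 : x = j
  · subst h1
    simp
  · by_cases h2 : x = j + 1
    · subst h2
      simp
    · simp [h1, h2]

/-- One block of the word acts as a cycle: `e_k` travels to `e_m` and picks up a sign at each of the
`m - k` steps, while the vectors it passes move down by one without a sign. -/
theorem prod_sMat_desc_mulVec (k : ℕ) {m x : ℕ} (hm : m ≤ n) (hx : x ≤ n) :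
    (((List.range m).reverse.map fun j => if k ≤ j then sMat n j else 1).prod).mulVec
      (stdVec ℂ n x) =
      if x < k ∨ m < x then stdVec ℂ n x else if x = k then (-1 : ℂ) ^ (m - k) • stdVec ℂ n m
        else stdVec ℂ n (x - 1) := by
  induction m generalizing x with
  | zero =>
    by_cases h : x < k ∨ 0 < x
    · simp [h]
    · obtain rfl : x = 0 := by omega
      obtain rfl : k = 0 := by omega
      simp
  | succ m ih =>
    rw [List.range_succ, List.reverse_append, List.reverse_singleton, List.singleton_append,
      List.map_cons, List.prod_cons, ← Matrix.mulVec_mulVec, ih (by omega) hx]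
    by_cases hk : k ≤ m
    · rw [if_pos hk]
      by_cases h1 : x < k
      · rw [if_pos (Or.inl h1), if_pos (Or.inl h1), sMat_mulVec (by omega) hx,
          if_neg (by omega), if_neg (by omega)]
      · by_cases h2 : m < x
        · rw [if_pos (Or.inr h2), sMat_mulVec (by omega) hx, if_neg (by omega)]
          by_cases h3 : x = m + 1
          · rw [if_pos h3, if_neg (by omega), if_neg (by omega), h3, Nat.add_sub_cancel]
          · rw [if_neg h3, if_pos (by omega)]
        · rw [if_neg (by omega : ¬ (x < k ∨ m < x)), if_neg (by omega : ¬ (x < k ∨ m + 1 < x))]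
          by_cases h3 : x = k
          · rw [if_pos h3, if_pos h3, Matrix.mulVec_smul, sMat_mulVec (by omega) (by omega),
              if_pos rfl, show m + 1 - k = m - k + 1 by omega, pow_succ]
            simp
          · rw [if_neg h3, if_neg h3, sMat_mulVec (by omega) (by omega), if_neg (by omega),
              if_neg (by omega)]
    · rw [if_neg hk, Matrix.one_mulVec]
      by_cases h1 : x < k ∨ m < x
      · rw [if_pos h1]
        by_cases h2 : x < k ∨ m + 1 < x
        · rw [if_pos h2]
        · rw [if_neg h2, if_pos (by omega), show m + 1 - k = 0 by omega,
            show x = m + 1 by omega, pow_zero, one_smul]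
      · omega

theorem prod_prod_sMat_mulVec {s len : ℕ} (hs : s + len = n) {x : ℕ} (hx : x ≤ n) :
    (((List.range' s len).map fun k =>
        ((List.range n).reverse.map fun j => if k ≤ j then sMat n j else 1).prod).prod).mulVec
      (stdVec ℂ n x) =
      if x < s then stdVec ℂ n x else (-1 : ℂ) ^ (n - x) • stdVec ℂ n (n + s - x) := by
  induction len generalizing s x with
  | zero =>
    by_cases h : x < s
    · simp [h]
    · rw [if_neg h, show x = n by omega, show s = n by omega]
      simp
  | succ len ih =>
    rw [List.range'_succ, List.map_cons, List.prod_cons, ← Matrix.mulVec_mulVec,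
      ih (by omega) hx]
    rcases lt_trichotomy x s with h | h | h
    · rw [if_pos (by omega), if_pos h, prod_sMat_desc_mulVec s le_rfl hx, if_pos (Or.inl h)]
    · rw [if_pos (by omega), if_neg (by omega), prod_sMat_desc_mulVec s le_rfl hx,
        if_neg (by omega), if_pos h, h, show n + s - s = n by omega]
    · rw [if_neg (by omega), if_neg (by omega), Matrix.mulVec_smul,
        prod_sMat_desc_mulVec s le_rfl (by omega), if_neg (by omega), if_neg (by omega),
        show n + (s + 1) - x - 1 = n + s - x by omega]

theorem coe_w₀Dot_mulVec {x : ℕ} (hx : x ≤ n) :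
    (w₀Dot n : Mat n).mulVec (stdVec ℂ n x) = (-1 : ℂ) ^ (n - x) • stdVec ℂ n (n - x) := by
  have h1 : (w₀Dot n : Mat n) = ((cOrder n).map fun a => sMat n a.1.1).prod := by
    rw [← slVal_apply, w₀Dot, word₀, map_list_prod, List.map_map, List.map_map]
    congr 1
    refine List.map_congr_left fun a _ => ?_
    simp [sDot, sMat, coe_xRoot, coe_yRoot]
  rw [h1, prod_cOrder fun j _ => sMat n j, List.range_eq_range',
    ← List.range_eq_range']
  have := prod_prod_sMat_mulVec (s := 0) (len := n) (by omega) hx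
  rw [← List.range_eq_range'] at this
  rw [this, if_neg (by omega)]
  rfl

theorem antiMat_mulVec {x : ℕ} (hx : x ≤ n) :
    (antiMat n).mulVec (stdVec ℂ n x) = (-1 : ℂ) ^ x • stdVec ℂ n (n - x) := by
  rw [mulVec_stdVec (by omega)]
  ext i
  simp only [antiMat, Matrix.of_apply, Pi.smul_apply, stdVec, smul_eq_mul, mul_ite, mul_one,
    mul_zero]
  by_cases h : (i : ℕ) + x = n
  · rw [if_pos h, if_pos (by omega)]
  · rw [if_neg h, if_neg (by omega)]

theorem ext_stdVec {M N : Mat n}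
    (h : ∀ x ≤ n, M.mulVec (stdVec ℂ n x) = N.mulVec (stdVec ℂ n x)) : M = N := by
  ext i j
  have := congrFun (h j (by omega)) i
  rwa [mulVec_stdVec j.2, mulVec_stdVec j.2] at this

theorem antiMat_mul_w₀Dot : antiMat n * (w₀Dot n : Mat n) = 1 := by
  refine ext_stdVec fun x hx => ?_
  rw [← Matrix.mulVec_mulVec, coe_w₀Dot_mulVec hx, Matrix.mulVec_smul, antiMat_mulVec (by omega),
    smul_smul, ← mul_pow, show n - (n - x) = x by omega]
  simp

theorem coe_w₀Dot_inv : ((w₀Dot n)⁻¹ : SLv n) = antiMat n := by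
  have h : ((w₀Dot n)⁻¹ : SLv n) * (w₀Dot n : Mat n) = 1 := by
    have : ((w₀Dot n)⁻¹ * w₀Dot n : SLv n) = 1 := inv_mul_cancel _
    have := congrArg (slVal n) this
    rwa [map_mul, map_one] at this
  have h2 := antiMat_mul_w₀Dot (n := n)
  have h3 : (w₀Dot n : Mat n) * antiMat n = 1 := mul_eq_one_comm.1 h2
  calc (((w₀Dot n)⁻¹ : SLv n) : Mat n) = ((w₀Dot n)⁻¹ : SLv n) * ((w₀Dot n : Mat n) * antiMat n) := by
        rw [h3, mul_one]
    _ = antiMat n := by rw [← mul_assoc, h, one_mul]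

theorem coe_w₀Dot_apply (i j : Fin (n + 1)) :
    (w₀Dot n : Mat n) i j = if (i : ℕ) + j = n then (-1) ^ (i : ℕ) else 0 := by
  have := congrFun (coe_w₀Dot_mulVec (n := n) (x := j) (by omega)) i
  rw [mulVec_stdVec j.2] at this
  rw [show (w₀Dot n : Mat n) i j = _ from this]
  simp only [Pi.smul_apply, stdVec, smul_eq_mul, mul_ite, mul_one, mul_zero]
  by_cases h : (i : ℕ) + j = n
  · rw [if_pos h, if_pos (by omega), show (n - j : ℕ) = i by omega]
  · rw [if_neg h, if_neg (by omega)]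

/-! ### The word `word₀` is a reduced expression of the longest permutation -/

/-- The simple transposition, indexed by natural numbers. -/
def swapNat (n j : ℕ) : Equiv.Perm (Fin (n + 1)) :=
  if h : j < n then Equiv.swap (⟨j, h⟩ : Fin n).castSucc (⟨j, h⟩ : Fin n).succ else 1

theorem swapNat_apply {j : ℕ} (hj : j < n) (x : Fin (n + 1)) :
    (swapNat n j x : ℕ) = if (x : ℕ) = j then j + 1 else if (x : ℕ) = j + 1 then j else x := by
  rw [swapNat, dif_pos hj, Equiv.swap_apply_def]
  simp only [Fin.ext_iff, Fin.val_castSucc, Fin.val_succ]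
  split_ifs <;> simp

theorem prod_swapNat_desc_apply (k : ℕ) {m : ℕ} (hm : m ≤ n) (x : Fin (n + 1)) :
    ((((List.range m).reverse.map fun j => if k ≤ j then swapNat n j else 1).prod) x : ℕ) =
      if (x : ℕ) < k ∨ m < x then (x : ℕ) else if (x : ℕ) = k then m else x - 1 := by
  induction m generalizing x with
  | zero =>
    by_cases h : (x : ℕ) < k ∨ 0 < (x : ℕ)
    · rw [if_pos h]
      rfl
    · rw [if_neg h, if_pos (by omega)]
      simp only [List.range_zero, List.reverse_nil, List.map_nil, List.prod_nil,
        Equiv.Perm.coe_one, id_eq]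
      omega
  | succ m ih =>
    rw [List.range_succ, List.reverse_append, List.reverse_singleton, List.singleton_append,
      List.map_cons, List.prod_cons, Equiv.Perm.mul_apply]
    by_cases hk : k ≤ m
    · rw [if_pos hk, swapNat_apply (by omega), ih (by omega)]
      split_ifs <;> omega
    · rw [if_neg hk, Equiv.Perm.one_apply, ih (by omega)]
      split_ifs <;> omega

theorem prod_prod_swapNat_apply {s len : ℕ} (hs : s + len = n) (x : Fin (n + 1)) :
    ((((List.range' s len).map fun k =>
        ((List.range n).reverse.map fun j => if k ≤ j then swapNat n j else 1).prod).prod) x : ℕ) =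
      if (x : ℕ) < s then (x : ℕ) else n + s - x := by
  induction len generalizing s x with
  | zero =>
    simp only [List.range'_zero, List.map_nil, List.prod_nil, Equiv.Perm.coe_one, id_eq]
    split_ifs <;> omega
  | succ len ih =>
    rw [List.range'_succ, List.map_cons, List.prod_cons, Equiv.Perm.mul_apply,
      prod_swapNat_desc_apply s le_rfl, ih (by omega)]
    split_ifs <;> omega

theorem prod_swap_word₀ :
    ((word₀ n).map fun i => Equiv.swap i.castSucc i.succ).prod = Fin.revPerm := by
  have h1 : (word₀ n).map (fun i => Equiv.swap i.castSucc i.succ) =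
      (cOrder n).map fun a => swapNat n a.1.1 := by
    rw [word₀, List.map_map]
    refine List.map_congr_left fun a _ => ?_
    simp [swapNat]
  rw [h1, prod_cOrder fun j _ => swapNat n j]
  ext x
  have := prod_prod_swapNat_apply (s := 0) (len := n) (by omega) x
  rw [← List.range_eq_range'] at this
  rw [this, if_neg (by omega), Fin.revPerm_apply, Fin.val_rev]
  omega

end LongestElement

/-! ### Vertex coordinates on `𝒵` and the critical equations. -/

section Quiver

variable {n : ℕ}

/-- The vertical arrow variables as a function of two natural numbers. -/
def vertArrow (σ : Arrow n → ℂ) : ℕ → ℕ → ℂ := extTri fun a => σ (.inl a)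

/-- The horizontal arrow variables as a function of two natural numbers. -/
def horArrow (σ : Arrow n → ℂ) : ℕ → ℕ → ℂ := extTri fun a => σ (.inr a)

theorem extTri_of_lt {K : Type*} [Zero K] (c : Tri n → K) {i j : ℕ} (h : j ≤ i) (hi : i < n) :
    extTri c i j = c ⟨(⟨i, hi⟩, ⟨j, h.trans_lt hi⟩), h⟩ := dif_pos ⟨h, hi⟩

theorem extTri_of_not {K : Type*} [Zero K] (c : Tri n → K) {i j : ℕ} (h : ¬ (j ≤ i ∧ i < n)) :
    extTri c i j = 0 := dif_neg h

theorem box_of_mem {σ : Arrow n → ℂ} (hσ : σ ∈ Zquiver n) {i j : ℕ} (h : j ≤ i) (hi : i + 1 < n) :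
    horArrow σ i j * vertArrow σ (i + 1) (j + 1) =
      vertArrow σ (i + 1) j * horArrow σ (i + 1) j := by
  rw [horArrow, vertArrow, extTri_of_lt _ h (by omega), extTri_of_lt _ (by omega) hi,
    extTri_of_lt _ (by omega) hi, extTri_of_lt _ (by omega) hi]
  exact hσ.2 _ _ _ _ (by simp [head, tail]) (by simp [head, tail]) (by simp [tail])
    (by simp [head])

theorem vertArrow_ne_zero {σ : Arrow n → ℂ} (hσ : σ ∈ Zquiver n) {i j : ℕ} (h : j ≤ i)
    (hi : i < n) : vertArrow σ i j ≠ 0 := by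
  rw [vertArrow, extTri_of_lt _ h hi]
  exact hσ.1 _

theorem horArrow_ne_zero {σ : Arrow n → ℂ} (hσ : σ ∈ Zquiver n) {i j : ℕ} (h : j ≤ i)
    (hi : i < n) : horArrow σ i j ≠ 0 := by
  rw [horArrow, extTri_of_lt _ h hi]
  exact hσ.1 _

/-- The vertex variables, as products along paths. -/
def vertexVar (σ : Arrow n → ℂ) (i j : ℕ) : ℂ :=
  (∏ l ∈ Finset.Ico i n, vertArrow σ l j) * ∏ s ∈ Finset.Ico j n, horArrow σ (n - 1) s

theorem vertexVar_vert (σ : Arrow n → ℂ) {i j : ℕ} (hi : i < n) :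
    vertexVar σ i j = vertArrow σ i j * vertexVar σ (i + 1) j := by
  rw [vertexVar, Finset.prod_eq_prod_Ico_succ_bot hi, mul_assoc, vertexVar]

/-- Path independence: on the bottom row the relation holds by definition, and each box relation
transports it one row up. -/
theorem vertexVar_hor {σ : Arrow n → ℂ} (hσ : σ ∈ Zquiver n) {i j : ℕ} (h : j ≤ i) (hi : i < n) :
    vertexVar σ (i + 1) j = horArrow σ i j * vertexVar σ (i + 1) (j + 1) := by
  obtain ⟨k, hk⟩ : ∃ k, i + 1 + k = n := ⟨n - (i + 1), by omega⟩
  induction k generalizing i with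
  | zero =>
    have : i = n - 1 := by omega
    rw [vertexVar, vertexVar, Finset.Ico_eq_empty_of_le (by omega), Finset.prod_empty,
      Finset.prod_eq_prod_Ico_succ_bot (by omega), this]
    simp
  | succ k ih =>
    rw [vertexVar_vert σ (by omega), vertexVar_vert σ (by omega : i + 1 < n),
      ih (by omega) (by omega) (by omega)]
    linear_combination -(vertexVar σ (i + 1 + 1) (j + 1)) * box_of_mem hσ h (by omega)

theorem vertexVar_last (σ : Arrow n → ℂ) : vertexVar σ n n = 1 := by simp [vertexVar]

theorem vertexVar_ne_zero {σ : Arrow n → ℂ} (hσ : σ ∈ Zquiver n) {i j : ℕ} (h : j ≤ i) :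
    vertexVar σ i j ≠ 0 := by
  refine mul_ne_zero (Finset.prod_ne_zero_iff.2 fun l hl => ?_)
    (Finset.prod_ne_zero_iff.2 fun l hl => ?_)
  · rw [Finset.mem_Ico] at hl
    exact vertArrow_ne_zero hσ (by omega) hl.2
  · rw [Finset.mem_Ico] at hl
    exact horArrow_ne_zero hσ (by omega) (by omega)

theorem qTilde_eq (σ : Arrow n → ℂ) (k : Fin n) :
    qTilde σ k = vertArrow σ k k * horArrow σ k k := by
  rw [qTilde, vertArrow, horArrow, extTri_of_lt _ le_rfl k.2, extTri_of_lt _ le_rfl k.2]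

theorem prod_filter_castSucc {M : Type*} [CommMonoid M] (f : ℕ → M) (i : Fin (n + 1)) :
    ∏ k : Fin n with i ≤ k.castSucc, f k = ∏ k ∈ Finset.Ico (i : ℕ) n, f k := by
  refine Finset.prod_bij (fun k _ => (k : ℕ)) (fun k hk => ?_) (fun a _ b _ h => Fin.ext h)
    (fun b hb => ?_) (fun k _ => rfl)
  · rw [Finset.mem_filter] at hk
    have : (i : ℕ) ≤ k := hk.2
    rw [Finset.mem_Ico]
    omega
  · rw [Finset.mem_Ico] at hb
    exact ⟨⟨b, hb.2⟩, by rw [Finset.mem_filter]; exact ⟨Finset.mem_univ _, hb.1⟩, rfl⟩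

/-- Evaluate along the staircase path, whose consecutive pairs of arrows have the products `q̃_k`.
-/
theorem vertexVar_diag {σ : Arrow n → ℂ} (hσ : σ ∈ Zquiver n) (i : Fin (n + 1)) :
    vertexVar σ i i = ∏ k : Fin n with i ≤ k.castSucc, qTilde σ k := by
  simp only [qTilde_eq]
  rw [prod_filter_castSucc fun k => vertArrow σ k k * horArrow σ k k]
  obtain ⟨i, hi⟩ := i
  obtain ⟨k, hk⟩ : ∃ k, i + k = n := ⟨n - i, by omega⟩
  induction k generalizing i with
  | zero =>
    obtain rfl : i = n := by omega
    simp [vertexVar_last]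
  | succ k ih =>
    rw [Finset.prod_eq_prod_Ico_succ_bot (by simp; omega)]
    have := ih (i + 1) (by omega) (by omega)
    simp only at this ⊢
    rw [← this, vertexVar_vert σ (by omega), vertexVar_hor hσ le_rfl (by omega), mul_assoc]

theorem vertexCoord_eq (hn : 1 ≤ n) (σ : Arrow n → ℂ) (v : Below n) :
    vertexCoord σ v = vertexVar σ v.1.1 v.1.2 := by
  obtain ⟨⟨i, j⟩, hv⟩ := v
  have hji : (j : ℕ) < i := hv
  rw [vertexCoord, vertexVar]
  congr 1
  · refine Finset.prod_bij (fun a _ => (a.1.1 : ℕ)) (fun a ha => ?_) (fun a ha b hb h => ?_)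
      (fun b hb => ?_) (fun a ha => ?_)
    · rw [Finset.mem_filter] at ha
      have : (i : ℕ) ≤ a.1.1 := ha.2.1
      rw [Finset.mem_Ico]
      exact ⟨this, a.1.1.2⟩
    · rw [Finset.mem_filter] at ha hb
      refine Subtype.ext (Prod.ext (Fin.ext h) ?_)
      exact Fin.castSucc_injective _ (ha.2.2.trans hb.2.2.symm)
    · rw [Finset.mem_Ico] at hb
      have hb1 : (i : ℕ) ≤ b := hb.1
      refine ⟨⟨(⟨b, hb.2⟩, ⟨j, by omega⟩), ?_⟩, ?_, rfl⟩
      · change (j : ℕ) ≤ b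
        omega
      · rw [Finset.mem_filter]
        exact ⟨Finset.mem_univ _, hb.1, rfl⟩
    · rw [Finset.mem_filter] at ha
      have h2 : (a.1.2 : ℕ) = j := congrArg Fin.val ha.2.2
      simp only [← h2]
      exact (extTri_apply (fun a => σ (.inl a)) a).symm
  · refine Finset.prod_bij (fun a _ => (a.1.2 : ℕ)) (fun a ha => ?_) (fun a ha b hb h => ?_)
      (fun b hb => ?_) (fun a ha => ?_)
    · rw [Finset.mem_filter] at ha
      have : (j : ℕ) ≤ a.1.2 := ha.2.2
      rw [Finset.mem_Ico]
      exact ⟨this, a.1.2.2⟩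
    · rw [Finset.mem_filter] at ha hb
      refine Subtype.ext (Prod.ext ?_ (Fin.ext h))
      exact Fin.succ_injective _ (ha.2.1.trans hb.2.1.symm)
    · rw [Finset.mem_Ico] at hb
      have hb1 : (j : ℕ) ≤ b := hb.1
      refine ⟨⟨(⟨n - 1, by omega⟩, ⟨b, hb.2⟩), ?_⟩, ?_, rfl⟩
      · change b ≤ n - 1
        omega
      · rw [Finset.mem_filter]
        refine ⟨Finset.mem_univ _, Fin.ext ?_, hb.1⟩
        simp
        omega
    · rw [Finset.mem_filter] at ha
      have h2 : (a.1.1 : ℕ) + 1 = n := congrArg Fin.val ha.2.1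
      have h3 : n - 1 = a.1.1 := by omega
      simp only [h3]
      exact (extTri_apply (fun a => σ (.inr a)) a).symm

theorem vertexExtend_eq (hn : 1 ≤ n) {σ : Arrow n → ℂ} (hσ : σ ∈ Zquiver n) (v : Vertex n) :
    vertexExtend (qTilde σ) (vertexCoord σ) v = vertexVar σ v.1.1 v.1.2 := by
  rw [vertexExtend]
  split_ifs with h
  · exact vertexCoord_eq hn σ ⟨v.1, h⟩
  · have : v.1.2 = v.1.1 := le_antisymm v.2 (not_lt.1 h)
    rw [this, vertexVar_diag hσ]

theorem arrowsOf_vertexCoord (hn : 1 ≤ n) {σ : Arrow n → ℂ} (hσ : σ ∈ Zquiver n) :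
    arrowsOf (qTilde σ) (vertexCoord σ) = σ := by
  ext a
  rw [arrowsOf, vertexExtend_eq hn hσ, vertexExtend_eq hn hσ]
  rcases a with a | a
  · have h := vertexVar_vert σ (i := a.1.1) (j := a.1.2) a.1.1.2
    have h0 : vertexVar σ (a.1.1 + 1) a.1.2 ≠ 0 := vertexVar_ne_zero hσ (le_trans a.2 (by simp))
    simp only [head, tail, Fin.val_castSucc, Fin.val_succ]
    rw [h, mul_div_cancel_right₀ _ h0]
    exact extTri_apply (fun a => σ (.inl a)) a
  · have h := vertexVar_hor hσ (i := a.1.1) (j := a.1.2) a.2 a.1.1.2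
    have h0 : vertexVar σ (a.1.1 + 1) (a.1.2 + 1) ≠ 0 :=
      vertexVar_ne_zero hσ (by simpa using a.2)
    simp only [head, tail, Fin.val_castSucc, Fin.val_succ]
    rw [h, mul_div_cancel_right₀ _ h0]
    exact extTri_apply (fun a => σ (.inr a)) a

theorem vertexExtend_ne_zero {Q : Fin n → ℂ} (hQ : ∀ i, Q i ≠ 0) {z : Below n → ℂ}
    (hz : ∀ v, z v ≠ 0) (v : Vertex n) : vertexExtend Q z v ≠ 0 := by
  rw [vertexExtend]
  split_ifs
  · exact hz _
  · exact Finset.prod_ne_zero_iff.2 fun k _ => hQ k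

theorem arrowsOf_mem {Q : Fin n → ℂ} (hQ : ∀ i, Q i ≠ 0) {z : Below n → ℂ}
    (hz : ∀ v, z v ≠ 0) : arrowsOf Q z ∈ Zfiber Q := by
  have hne := vertexExtend_ne_zero hQ hz
  refine ⟨⟨fun a => div_ne_zero (hne _) (hne _), fun c c' d d' h1 h2 h3 h4 => ?_⟩, ?_⟩
  · simp only [arrowsOf]
    rw [h1, h2, ← h3, h4, div_mul_div_cancel₀ (hne _), div_mul_div_cancel₀ (hne _)]
  · ext k
    simp only [qTilde, arrowsOf]
    rw [show tail (Sum.inl ⟨(k, k), le_rfl⟩) =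
      head (n := n) (Sum.inr ⟨(k, k), le_rfl⟩) from rfl, div_mul_div_cancel₀ (hne _)]
    have hfilter : (Finset.univ.filter fun l : Fin n => k.castSucc ≤ l.castSucc) =
        insert k (Finset.univ.filter fun l : Fin n => k.succ ≤ l.castSucc) := by
      ext l
      simp only [Finset.mem_filter, Finset.mem_univ, true_and, Finset.mem_insert, Fin.le_def,
        Fin.val_castSucc, Fin.val_succ, Fin.ext_iff]
      omega
    have hprod : ∏ l : Fin n with k.succ ≤ l.castSucc, Q l ≠ 0 :=
      Finset.prod_ne_zero_iff.2 fun k _ => hQ k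
    have e1 : vertexExtend Q z (head (Sum.inl ⟨(k, k), le_rfl⟩)) =
        ∏ l : Fin n with k.castSucc ≤ l.castSucc, Q l := dif_neg (lt_irrefl _)
    have e2 : vertexExtend Q z (tail (Sum.inr ⟨(k, k), le_rfl⟩)) =
        ∏ l : Fin n with k.succ ≤ l.castSucc, Q l := dif_neg (lt_irrefl _)
    rw [e1, e2, hfilter, Finset.prod_insert (by simp [Fin.le_def]), mul_div_cancel_right₀ _ hprod]

/-- The vertex variables of the point of `𝒵` with given vertical arrows and given `q̃`. -/
def vertexOf (c : Tri n → ℂ) (Q : Fin n → ℂ) (v : Below n) : ℂ :=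
  (∏ k : Fin n with v.1.2 ≤ k.castSucc, Q k) / ∏ l ∈ Finset.Ico (v.1.2 : ℕ) v.1.1, extTri c l v.1.2

theorem vertexExtend_vertexOf (c : Tri n → ℂ) (Q : Fin n → ℂ) (v : Vertex n) :
    vertexExtend Q (vertexOf c Q) v = (∏ k : Fin n with v.1.2 ≤ k.castSucc, Q k) /
      ∏ l ∈ Finset.Ico (v.1.2 : ℕ) v.1.1, extTri c l v.1.2 := by
  rw [vertexExtend]
  split_ifs with h
  · rfl
  · have : v.1.2 = v.1.1 := le_antisymm v.2 (not_lt.1 h)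
    simp [this]

theorem prod_extTri_ne_zero {c : Tri n → ℂ} (hc : ∀ a, c a ≠ 0) {i j : ℕ} (hi : i ≤ n) :
    ∏ l ∈ Finset.Ico j i, extTri c l j ≠ 0 := by
  refine Finset.prod_ne_zero_iff.2 fun l hl => ?_
  rw [Finset.mem_Ico] at hl
  rw [extTri_of_lt c hl.1 (by omega)]
  exact hc _

theorem vertexOf_ne_zero {c : Tri n → ℂ} (hc : ∀ a, c a ≠ 0) {Q : Fin n → ℂ}
    (hQ : ∀ i, Q i ≠ 0) (v : Below n) : vertexOf c Q v ≠ 0 :=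
  div_ne_zero (Finset.prod_ne_zero_iff.2 fun k _ => hQ k) (prod_extTri_ne_zero hc (by omega))

/-- The point of `𝒵` with given vertical arrows and given `q̃`. -/
def pointOf (c : Tri n → ℂ) (Q : Fin n → ℂ) : Arrow n → ℂ := arrowsOf Q (vertexOf c Q)

theorem pointOf_mem {c : Tri n → ℂ} (hc : ∀ a, c a ≠ 0) {Q : Fin n → ℂ}
    (hQ : ∀ i, Q i ≠ 0) : pointOf c Q ∈ Zfiber Q := arrowsOf_mem hQ (vertexOf_ne_zero hc hQ)

theorem pointOf_inl {c : Tri n → ℂ} (hc : ∀ a, c a ≠ 0) {Q : Fin n → ℂ}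
    (hQ : ∀ i, Q i ≠ 0) (a : Tri n) : pointOf c Q (.inl a) = c a := by
  have hle : (a.1.2 : ℕ) ≤ a.1.1 := a.2
  rw [pointOf, arrowsOf, vertexExtend_vertexOf, vertexExtend_vertexOf]
  simp only [head, tail, Fin.val_castSucc, Fin.val_succ]
  rw [Finset.prod_Ico_succ_top hle]
  have h1 : ∏ k : Fin n with a.1.2.castSucc ≤ k.castSucc, Q k ≠ 0 :=
    Finset.prod_ne_zero_iff.2 fun k _ => hQ k
  have h2 := prod_extTri_ne_zero hc (i := a.1.1) (j := a.1.2) (by omega)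
  rw [extTri_apply]
  have h3 := hc a
  field_simp
  exact div_self h1

/-- The diagonal vertex variables are given by `q̃`, and dividing by vertical arrows descends each
column from there. With `pointOf_mem` and `pointOf_inl` this identifies `𝒵` with a torus. -/
theorem pointOf_eq (hn : 1 ≤ n) {σ : Arrow n → ℂ} (hσ : σ ∈ Zquiver n) :
    pointOf (fun a => σ (.inl a)) (qTilde σ) = σ := by
  conv_rhs => rw [← arrowsOf_vertexCoord hn hσ]
  rw [pointOf]
  congr 1
  ext v
  have hv : (v.1.2 : ℕ) < v.1.1 := v.2
  rw [vertexCoord_eq hn, vertexOf, ← vertexVar_diag hσ, div_eq_iff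
    (prod_extTri_ne_zero (fun a => hσ.1 _) (by omega)), vertexVar, vertexVar, mul_right_comm,
    mul_comm (∏ l ∈ Finset.Ico (v.1.1 : ℕ) n, _)]
  congr 1
  exact (Finset.prod_Ico_consecutive _ hv.le (by omega)).symm

theorem qTilde_ne_zero {σ : Arrow n → ℂ} (hσ : σ ∈ Zquiver n) (k : Fin n) : qTilde σ k ≠ 0 :=
  mul_ne_zero (hσ.1 _) (hσ.1 _)

/-! ### The critical point equations -/

/-- The horizontal arrow leaving the vertex `(m, l)`. -/
def outArrow {K : Type*} [Zero K] (d : ℕ → ℕ → K) : ℕ → ℕ → K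
  | m + 1, l + 1 => d m l
  | _, _ => 0

theorem sum_tri_ite (f : Tri n → ℂ) (i j : ℕ) :
    (∑ a : Tri n, if (a.1.1 : ℕ) = i ∧ (a.1.2 : ℕ) = j then f a else 0) = extTri f i j := by
  by_cases h : j ≤ i ∧ i < n
  · rw [extTri_of_lt f h.1 h.2, Finset.sum_eq_single ⟨(⟨i, h.2⟩, ⟨j, h.1.trans_lt h.2⟩), h.1⟩]
    · simp
    · rintro ⟨⟨a, b⟩, hab⟩ _ hne
      rw [if_neg]
      rintro ⟨h1, h2⟩
      exact hne (Subtype.ext (Prod.ext (Fin.ext h1) (Fin.ext h2)))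
    · simp
  · rw [extTri_of_not f h, Finset.sum_eq_zero]
    rintro ⟨⟨a, b⟩, hab⟩ _
    rw [if_neg]
    rintro ⟨h1, h2⟩
    simp only at h1 h2
    have : (b : ℕ) ≤ a := hab
    omega

theorem hasFDerivAt_div {E : Type*} [NormedAddCommGroup E] [NormedSpace ℂ E] {f g : E → ℂ}
    {f' g' : E →L[ℂ] ℂ} {x : E} (hf : HasFDerivAt f f' x) (hg : HasFDerivAt g g' x)
    (h : g x ≠ 0) :
    HasFDerivAt (fun y => f y / g y) ((g x)⁻¹ • f' - (f x / g x ^ 2) • g') x := by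
  have h1 := hf.fun_mul ((hasDerivAt_inv h).comp_hasFDerivAt x hg)
  simp only [Function.comp_apply, ← div_eq_mul_inv] at h1
  refine h1.congr_fderiv ?_
  ext v
  simp only [sub_apply, add_apply, smul_apply, smul_eq_mul]
  field_simp
  ring

/-- The diagonal vertices are constant along a fibre of `q̃`, hence the zero derivative in that
case. -/
theorem hasFDerivAt_vertexExtend (Q : Fin n → ℂ) (z : Below n → ℂ) (w : Vertex n) :
    HasFDerivAt (fun z => vertexExtend Q z w)
      (if h : w.1.2 < w.1.1 then ContinuousLinearMap.proj (R := ℂ) (φ := fun _ : Below n => ℂ)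
        ⟨w.1, h⟩ else 0) z := by
  simp only [vertexExtend]
  split_ifs with h
  · exact hasFDerivAt_apply _ _
  · exact hasFDerivAt_const _ _

theorem vertexExtend_deriv_single (w : Vertex n) (v : Below n) :
    ((if h : w.1.2 < w.1.1 then ContinuousLinearMap.proj (R := ℂ) (φ := fun _ : Below n => ℂ)
        ⟨w.1, h⟩ else 0 : (Below n → ℂ) →L[ℂ] ℂ)) (Pi.single v 1) = if w.1 = v.1 then 1 else 0 := by
  split_ifs with h h' h'
  · rw [ContinuousLinearMap.proj_apply, Pi.single_apply, if_pos (Subtype.ext h')]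
  · rw [ContinuousLinearMap.proj_apply, Pi.single_apply, if_neg fun h2 => h' (by rw [← h2])]
  · exact absurd (h' ▸ v.2) h
  · rfl

/-- Each arrow is a Laurent monomial in the vertex variables, so its logarithmic derivative at `v`
is `+1` at the head and `-1` at the tail. -/
theorem fiberDifferential_single (hn : 1 ≤ n) {σ : Arrow n → ℂ} (hσ : σ ∈ Zquiver n)
    (v : Below n) : fiberDifferential σ (Pi.single v 1) =
      (∑ a, σ a * ((if (head a).1 = v.1 then 1 else 0) - if (tail a).1 = v.1 then 1 else 0)) /
        vertexCoord σ v := by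
  have hne : ∀ w, vertexExtend (qTilde σ) (vertexCoord σ) w ≠ 0 := fun w => by
    rw [vertexExtend_eq hn hσ]
    exact vertexVar_ne_zero hσ w.2
  have h := HasFDerivAt.fun_sum (u := Finset.univ) fun (a : Arrow n) _ =>
    hasFDerivAt_div (hasFDerivAt_vertexExtend (qTilde σ) (vertexCoord σ) (head a))
      (hasFDerivAt_vertexExtend (qTilde σ) (vertexCoord σ) (tail a)) (hne _)
  rw [fiberDifferential]
  change (fderiv ℂ (fun z => ∑ a, vertexExtend (qTilde σ) z (head a) /
    vertexExtend (qTilde σ) z (tail a)) (vertexCoord σ)) (Pi.single v 1) = _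
  rw [h.fderiv, sum_apply, Finset.sum_div]
  refine Finset.sum_congr rfl fun a _ => ?_
  simp only [smul_apply, sub_apply,
    vertexExtend_deriv_single, smul_eq_mul]
  have hval : ∀ w : Vertex n, w.1 = v.1 →
      vertexExtend (qTilde σ) (vertexCoord σ) w = vertexCoord σ v := by
    rintro ⟨w, hw⟩ rfl
    rw [vertexExtend, dif_pos v.2]
  have hσa : σ a = vertexExtend (qTilde σ) (vertexCoord σ) (head a) /
      vertexExtend (qTilde σ) (vertexCoord σ) (tail a) := by
    conv_lhs => rw [← arrowsOf_vertexCoord hn hσ]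
    rfl
  have h1 := hne (head a)
  have h2 := hne (tail a)
  rw [hσa]
  by_cases hh : (head a).1 = v.1 <;> by_cases ht : (tail a).1 = v.1
  · simp only [hh, ht, if_true, hval _ hh, hval _ ht] at *
    field_simp
  · simp only [hh, ht, if_true, if_false, hval _ hh] at *
    field_simp
    simp
  · simp only [hh, ht, if_true, if_false, hval _ ht] at *
    field_simp
    simp
  · simp [hh, ht]

/-- Incoming minus outgoing arrows at the vertex. Arrows absent at the boundary are covered by the
zero values of `extTri` and `outArrow`. -/
theorem fiberDifferential_single_eq (hn : 1 ≤ n) {σ : Arrow n → ℂ} (hσ : σ ∈ Zquiver n)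
    (v : Below n) : fiberDifferential σ (Pi.single v 1) =
      vertexEq (vertArrow σ) (outArrow (horArrow σ)) (v.1.1 - 1) v.1.2 / vertexCoord σ v := by
  rw [fiberDifferential_single hn hσ]
  congr 1
  obtain ⟨⟨i, j⟩, hv⟩ := v
  have hji : (j : ℕ) < i := hv
  obtain ⟨m, hm⟩ : ∃ m, (i : ℕ) = m + 1 := ⟨i - 1, by omega⟩
  simp only [hm, Nat.add_sub_cancel, vertexEq]
  rw [Fintype.sum_sum_type]
  simp only [mul_sub, Finset.sum_sub_distrib, mul_ite, mul_one, mul_zero]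
  simp only [head, tail, Prod.ext_iff, Fin.ext_iff, Fin.val_castSucc, Fin.val_succ, hm,
    Nat.add_right_cancel_iff]
  rw [sum_tri_ite (fun a => σ (.inl a)), sum_tri_ite (fun a => σ (.inl a)),
    sum_tri_ite (fun a => σ (.inr a))]
  -- In column `0` there is no outgoing horizontal arrow, which is the default value of `outArrow`.
  have h : (∑ a : Tri n, if (a.1.1 : ℕ) = m ∧ (a.1.2 : ℕ) + 1 = j then σ (.inr a) else 0) =
      outArrow (horArrow σ) (m + 1) j := by
    rcases hj : (j : ℕ) with _ | l
    · simp [outArrow]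
    · simp only [Nat.add_right_cancel_iff]
      rw [sum_tri_ite (fun a => σ (.inr a))]
      rfl
  rw [h, show outArrow (horArrow σ) (m + 1) (j + 1) = extTri (fun a => σ (.inr a)) m j from rfl]
  simp only [vertArrow]
  ring

end Quiver

section Minors

variable {n : ℕ}

/-! ### Minors of products of bidiagonal matrices -/

/-- The entries of a matrix as a function of two natural numbers. -/
def natEntry (M : Mat n) (i j : ℕ) : ℂ :=
  if h : i < n + 1 ∧ j < n + 1 then M ⟨i, h.1⟩ ⟨j, h.2⟩ else 0

theorem natEntry_of_lt (M : Mat n) {i j : ℕ} (hi : i < n + 1) (hj : j < n + 1) :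
    natEntry M i j = M ⟨i, hi⟩ ⟨j, hj⟩ := dif_pos ⟨hi, hj⟩

theorem natEntry_coe (M : Mat n) (i j : Fin (n + 1)) : natEntry M i j = M i j :=
  natEntry_of_lt M i.2 j.2

/-- The minor with rows `s, …, s + a - 1` and columns `s + b, …, s + b + a - 1`. -/
def shiftMinor (M : Mat n) (s a b : ℕ) : ℂ :=
  (Matrix.of fun i j : Fin a => natEntry M (s + i) (s + b + j)).det

theorem natEntry_stepMat_mul (c : ℕ → ℕ → ℂ) (k : ℕ) (M : Mat n) (i j : ℕ) :
    natEntry (stepMat n c k * M) i j =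
      natEntry M i j + (if k ≤ i then c i k else 0) * natEntry M (i + 1) j := by
  by_cases hj : j < n + 1
  · by_cases hi : i < n + 1
    · rw [natEntry_of_lt _ hi hj, natEntry_of_lt _ hi hj, Matrix.mul_apply]
      simp only [stepMat, Matrix.of_apply, add_mul, Finset.sum_add_distrib, ite_mul, one_mul,
        zero_mul, Finset.sum_ite_eq, Finset.mem_univ, if_true]
      congr 1
      by_cases hi' : i + 1 < n + 1
      · rw [natEntry_of_lt _ hi' hj, Finset.sum_eq_single ⟨i + 1, hi'⟩]
        · simp
        · intro l _ hl
          rw [if_neg]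
          rintro ⟨h, -⟩
          exact hl (Fin.ext h.symm)
        · simp
      · have h0 : natEntry M (i + 1) j = 0 := dif_neg fun h => hi' h.1
        rw [h0, Finset.sum_eq_zero]
        · simp
        · intro l _
          rw [if_neg]
          rintro ⟨h, -⟩
          omega
    · have h0 : ∀ N : Mat n, natEntry N i j = 0 := fun N => dif_neg fun h => hi h.1
      have h1 : natEntry M (i + 1) j = 0 := dif_neg fun h => hi (by omega)
      rw [h0, h0, h1]
      simp
  · have h0 : ∀ (N : Mat n) i, natEntry N i j = 0 := fun N i => dif_neg fun h => hj h.2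
    simp [h0]

/-- The product of the bidiagonal matrices with indices `s, …, s + l - 1`. -/
def tailMat (n : ℕ) (c : ℕ → ℕ → ℂ) : ℕ → ℕ → Mat n
  | 0, _ => 1
  | l + 1, s => stepMat n c s * tailMat n c l (s + 1)

theorem partialMat_mul_tailMat (c : ℕ → ℕ → ℂ) (l s : ℕ) :
    partialMat n c s * tailMat n c l s = partialMat n c (s + l) := by
  induction l generalizing s with
  | zero => simp [tailMat]
  | succ l ih =>
    rw [tailMat, ← mul_assoc, show partialMat n c s * stepMat n c s = partialMat n c (s + 1) from rfl,
      ih, show s + 1 + l = s + (l + 1) by ring]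

theorem natEntry_one (i j : ℕ) (hi : i < n + 1) :
    natEntry (1 : Mat n) i j = if i = j then 1 else 0 := by
  by_cases hj : j < n + 1
  · rw [natEntry_of_lt _ hi hj, Matrix.one_apply]
    simp
  · rw [if_neg (by omega)]
    exact dif_neg fun h => hj h.2

theorem natEntry_tailMat_lower (c : ℕ → ℕ → ℂ) (l s : ℕ) {i j : ℕ} (hi : i < n + 1) (h : j ≤ i) :
    natEntry (tailMat n c l s) i j = if i = j then 1 else 0 := by
  induction l generalizing s i with
  | zero => rw [tailMat, natEntry_one i j hi]
  | succ l ih =>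
    rw [tailMat, natEntry_stepMat_mul, ih _ hi h]
    by_cases hi' : i + 1 < n + 1
    · rw [ih _ hi' (by omega), if_neg (by omega : ¬ i + 1 = j), mul_zero, add_zero]
    · have h0 : natEntry (tailMat n c l (s + 1)) (i + 1) j = 0 := dif_neg fun h => hi' h.1
      rw [h0, mul_zero, add_zero]

theorem natEntry_tailMat_row (c : ℕ → ℕ → ℂ) (l s : ℕ) {i j : ℕ} (hi : i < n + 1) (h : i < s) :
    natEntry (tailMat n c l s) i j = if i = j then 1 else 0 := by
  induction l generalizing s with
  | zero => rw [tailMat, natEntry_one i j hi]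
  | succ l ih =>
    rw [tailMat, natEntry_stepMat_mul, ih _ (by omega), if_neg (by omega : ¬ s ≤ i), zero_mul,
      add_zero]

theorem shiftMinor_zero_of_lower {M : Mat n} (hM : ∀ i j, i < n + 1 → j ≤ i →
    natEntry M i j = if i = j then 1 else 0) {s a : ℕ} (h : s + a ≤ n + 1) :
    shiftMinor M s a 0 = 1 := by
  rw [shiftMinor, Matrix.det_of_isUpperTriangular]
  · refine Finset.prod_eq_one fun i _ => ?_
    rw [Matrix.of_apply, hM _ _ (by omega) (by omega), if_pos (by omega)]
  · intro i j hij
    have hij' : (j : ℕ) < i := hij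
    rw [Matrix.of_apply, hM _ _ (by omega) (by omega), if_neg (by omega)]

/-- Multiplying by `C_s` adds to each row a multiple of the next one. The top row of the remaining
product is a basis row, zero in the columns considered. So the submatrix is a lower bidiagonal
matrix with diagonal `c (s + i) s` times the submatrix one row further down. -/
theorem shiftMinor_tailMat_succ (c : ℕ → ℕ → ℂ) {l s a b : ℕ} (h : s < n + 1) :
    shiftMinor (tailMat n c (l + 1) s) s a (b + 1) =
      (∏ i ∈ Finset.range a, c (s + i) s) * shiftMinor (tailMat n c l (s + 1)) (s + 1) a b := by
  set L : Matrix (Fin a) (Fin a) ℂ := Matrix.of fun i j =>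
    if i = j then c (s + i) s else if (i : ℕ) = j + 1 then 1 else 0 with hL
  have hdet : L.det = ∏ i ∈ Finset.range a, c (s + i) s := by
    rw [Matrix.det_of_isLowerTriangular, ← Fin.prod_univ_eq_prod_range (fun i => c (s + i) s)]
    · simp [hL]
    · intro i j hij
      have hij' : (i : ℕ) < j := hij
      have h1 : i ≠ j := fun h => by subst h; omega
      simp only [hL, Matrix.of_apply]
      rw [if_neg h1, if_neg (by omega)]
  rw [shiftMinor, shiftMinor, ← hdet, ← Matrix.det_mul]
  congr 1
  ext i j
  rw [Matrix.of_apply, tailMat, natEntry_stepMat_mul, if_pos (by omega), Matrix.mul_apply]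
  rw [← Finset.add_sum_erase _ _ (Finset.mem_univ i)]
  have hi0 : L i i = c (s + i) s := by simp [hL]
  rw [hi0, Matrix.of_apply, show s + 1 + b + (j : ℕ) = s + (b + 1) + j by ring,
    show s + 1 + (i : ℕ) = s + i + 1 by ring, add_comm]
  congr 1
  obtain ⟨i, hi⟩ := i
  rcases i with _ | i
  · rw [Finset.sum_eq_zero]
    · rw [natEntry_tailMat_row c l (s + 1) (by simpa using h) (by simp), if_neg (by simp; omega)]
    · intro x hx
      rw [Finset.mem_erase] at hx
      simp only [hL, Matrix.of_apply]
      rw [if_neg hx.1.symm, if_neg (by simp), zero_mul]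
  · rw [Finset.sum_eq_single ⟨i, by omega⟩]
    · simp [hL, add_comm, add_left_comm]
    · intro x hx hxi
      rw [Finset.mem_erase] at hx
      simp only [hL, Matrix.of_apply]
      rw [if_neg hx.1.symm, if_neg, zero_mul]
      intro h2
      exact hxi (Fin.ext (by simpa using h2.symm))
    · intro h2
      exfalso
      apply h2
      simp

theorem shiftMinor_tailMat (c : ℕ → ℕ → ℂ) {l s a b : ℕ} (ha : 0 < a) (h : s + b + a ≤ n + 1)
    (hl : s + l = n) :
    shiftMinor (tailMat n c l s) s a b =
      ∏ r ∈ Finset.range b, ∏ i ∈ Finset.range a, c (s + r + i) (s + r) := by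
  induction b generalizing s l with
  | zero =>
    rw [shiftMinor_zero_of_lower (fun i j hi hj => natEntry_tailMat_lower c l s hi hj) (by omega)]
    simp
  | succ b ih =>
    obtain ⟨l, rfl⟩ : ∃ l', l = l' + 1 := ⟨l - 1, by omega⟩
    rw [shiftMinor_tailMat_succ c (by omega), ih (by omega) (by omega), Finset.prod_range_succ',
      mul_comm]
    congr 1
    refine Finset.prod_congr rfl fun r _ => ?_
    rw [show s + 1 + r = s + (r + 1) by ring]

/-- The minor with rows `0, …, a - 1` and columns `b, …, b + a - 1`. -/
def cornerMinor (M : Mat n) (a b : ℕ) : ℂ :=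
  (Matrix.of fun i j : Fin a => natEntry M i (b + j)).det

theorem cornerMinor_eq (M : Mat n) (a b : ℕ) : cornerMinor M a b = shiftMinor M 0 a b := by
  simp [cornerMinor, shiftMinor]

theorem cornerMinor_zero_left (M : Mat n) (b : ℕ) : cornerMinor M 0 b = 1 := by
  simp [cornerMinor]

theorem cornerMinor_partialMat (c : ℕ → ℕ → ℂ) {a b : ℕ} (h : a + b ≤ n + 1) :
    cornerMinor (partialMat n c n) a b =
      ∏ r ∈ Finset.range b, ∏ i ∈ Finset.range a, c (r + i) r := by
  rcases Nat.eq_zero_or_pos a with rfl | ha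
  · simp [cornerMinor_zero_left]
  have h1 := partialMat_mul_tailMat (n := n) c n 0
  rw [partialMat, one_mul, zero_add] at h1
  rw [cornerMinor_eq, ← h1, shiftMinor_tailMat c ha (by omega) (by omega)]
  simp

/-- The variables `c_{jk}` as ratios of minors. -/
theorem mul_cornerMinor_partialMat (c : ℕ → ℕ → ℂ) {a b : ℕ} (h : a + b < n) :
    c (b + a) b * (cornerMinor (partialMat n c n) a (b + 1) *
      cornerMinor (partialMat n c n) (a + 1) b) =
    cornerMinor (partialMat n c n) (a + 1) (b + 1) * cornerMinor (partialMat n c n) a b := by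
  rw [cornerMinor_partialMat c (by omega), cornerMinor_partialMat c (by omega),
    cornerMinor_partialMat c (by omega), cornerMinor_partialMat c (by omega)]
  simp only [Finset.prod_range_succ, Finset.prod_mul_distrib]
  ring

/-- Expand along the last row: only the corner term differs, and its cofactor is common to both. -/
theorem det_sub_det_of_corner {a : ℕ} {M N : Matrix (Fin (a + 1)) (Fin (a + 1)) ℂ}
    (h : ∀ i j, (i ≠ Fin.last a ∨ j ≠ Fin.last a) → M i j = N i j) :
    M.det - N.det = (M (Fin.last a) (Fin.last a) - N (Fin.last a) (Fin.last a)) *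
      (M.submatrix Fin.castSucc Fin.castSucc).det := by
  have hsub : ∀ j : Fin (a + 1), M.submatrix (Fin.last a).succAbove j.succAbove =
      N.submatrix (Fin.last a).succAbove j.succAbove := by
    intro j
    ext p q
    simp only [Matrix.submatrix_apply, Fin.succAbove_last]
    exact h _ _ (Or.inl (Fin.castSucc_lt_last p).ne)
  rw [Matrix.det_succ_row M (Fin.last a), Matrix.det_succ_row N (Fin.last a),
    ← Finset.sum_sub_distrib, Finset.sum_eq_single (Fin.last a)]
  · rw [← hsub, Fin.succAbove_last, Even.neg_one_pow ⟨_, rfl⟩]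
    ring
  · intro j _ hj
    rw [hsub, h _ _ (Or.inr hj), sub_self]
  · simp

/-- A matrix is upper unitriangular. -/
def IsUni (M : Mat n) : Prop := ∀ i j : Fin (n + 1), j ≤ i → M i j = if i = j then 1 else 0

theorem IsUni.natEntry {M : Mat n} (hM : IsUni M) {i j : ℕ} (hi : i < n + 1) (hj : j ≤ i) :
    natEntry M i j = if i = j then 1 else 0 := by
  rw [natEntry_of_lt M hi (by omega), hM _ _ (by simpa using hj)]
  simp

theorem IsUni.cornerMinor_zero {M : Mat n} (hM : IsUni M) {a : ℕ} (h : a ≤ n + 1) :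
    cornerMinor M a 0 = 1 := by
  rw [cornerMinor_eq]
  exact shiftMinor_zero_of_lower (fun i j hi hj => hM.natEntry hi hj) (by omega)

/-- An upper unitriangular matrix is determined by its corner minors, if these do not vanish. -/
theorem IsUni.eq_of_cornerMinor {M N : Mat n} (hM : IsUni M) (hN : IsUni N)
    (h : ∀ a b, a + b ≤ n + 1 → cornerMinor M a b = cornerMinor N a b)
    (h0 : ∀ a b, a + b ≤ n + 1 → cornerMinor M a b ≠ 0) : M = N := by
  suffices H : ∀ s i j, i + j = s → i < n + 1 → j < n + 1 → GiventalMirror.natEntry M i j =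
      GiventalMirror.natEntry N i j by
    ext i j
    have := H _ i j rfl i.2 j.2
    rwa [natEntry_coe, natEntry_coe] at this
  intro s
  induction s using Nat.strong_induction_on with
  | _ s ih =>
    intro i j hs hi hj
    rcases le_or_gt j i with hji | hij
    · rw [hM.natEntry hi hji, hN.natEntry hi hji]
    -- This minor has the entry `(i, j)` in its lower right corner. All its other entries have a
    -- smaller index sum, and the complementary minor is nonzero.
    · have h1 := h (i + 1) (j - i) (by omega)
      rw [← sub_eq_zero, cornerMinor, cornerMinor, det_sub_det_of_corner] at h1
      · have h2 : ((Matrix.of fun p q : Fin (i + 1) =>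
            GiventalMirror.natEntry M p (j - i + q)).submatrix Fin.castSucc Fin.castSucc).det =
            cornerMinor M i (j - i) := rfl
        rw [h2, mul_eq_zero, or_iff_left (h0 _ _ (by omega)), sub_eq_zero] at h1
        simpa [show j - i + i = j by omega] using h1
      · intro p q hpq
        simp only [Matrix.of_apply]
        have hp : (p : ℕ) < i + 1 := p.2
        have hq : (q : ℕ) < i + 1 := q.2
        have hpq' : (p : ℕ) ≠ i ∨ (q : ℕ) ≠ i := by
          rcases hpq with h | h
          · exact Or.inl fun h' => h (Fin.ext h')
          · exact Or.inr fun h' => h (Fin.ext h')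
        exact ih (p + (j - i + q)) (by omega) _ _ rfl (by omega) (by omega)

theorem isUni_partialMat (c : ℕ → ℕ → ℂ) : IsUni (partialMat n c n) := by
  intro i j hij
  have h1 := partialMat_mul_tailMat (n := n) c n 0
  rw [partialMat, one_mul, zero_add] at h1
  rw [← h1, ← natEntry_coe (tailMat n c n 0) i j, natEntry_tailMat_lower c n 0 i.2 hij]
  simp [Fin.ext_iff]

/-- Upper unitriangular matrices with nonvanishing corner minors are products of simple root
elements. -/
theorem IsUni.exists_tri {M : Mat n} (hM : IsUni M)
    (h0 : ∀ a b, a + b ≤ n + 1 → cornerMinor M a b ≠ 0) :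
    ∃ c : Tri n → ℂ, (∀ a, c a ≠ 0) ∧ partialMat n (extTri c) n = M := by
  set D := cornerMinor M with hD
  -- The ratio is dictated by `mul_cornerMinor_partialMat`; with this choice the monomials for the
  -- corner minors telescope back to `D`.
  set c : Tri n → ℂ := fun a => D (a.1.1 - a.1.2 + 1) (a.1.2 + 1) * D (a.1.1 - a.1.2) a.1.2 /
    (D (a.1.1 - a.1.2) (a.1.2 + 1) * D (a.1.1 - a.1.2 + 1) a.1.2) with hc
  refine ⟨c, fun a => ?_, ?_⟩
  · have : (a.1.2 : ℕ) ≤ a.1.1 := a.2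
    exact div_ne_zero (mul_ne_zero (h0 _ _ (by omega)) (h0 _ _ (by omega)))
      (mul_ne_zero (h0 _ _ (by omega)) (h0 _ _ (by omega)))
  · have hc' : ∀ r i, r + i < n → extTri c (r + i) r =
        D (i + 1) (r + 1) * D i r / (D i (r + 1) * D (i + 1) r) := by
      intro r i hri
      rw [extTri_of_lt c (by omega) hri]
      simp [hc]
    have h1 : ∀ a b, a + b < n + 1 → ∏ i ∈ Finset.range a, extTri c (b + i) b =
        D a (b + 1) / D a b := by
      intro a b
      induction a with
      | zero =>
        intro hb
        simp [hD, cornerMinor_zero_left]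
      | succ a ih =>
        intro hab
        have e1 := h0 a (b + 1) (by omega)
        have e2 := h0 a b (by omega)
        have e3 := h0 (a + 1) b (by omega)
        rw [Finset.prod_range_succ, ih (by omega), hc' b a (by omega)]
        field_simp
    have h2 : ∀ a b, a + b ≤ n + 1 → cornerMinor (partialMat n (extTri c) n) a b = D a b := by
      intro a b hab
      rw [cornerMinor_partialMat _ hab]
      induction b with
      | zero => simp [hD, hM.cornerMinor_zero (by omega : a ≤ n + 1)]
      | succ b ih =>
        have e := h0 a b (by omega)
        rw [Finset.prod_range_succ, ih (by omega), h1 a b (by omega)]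
        field_simp
    exact (isUni_partialMat _).eq_of_cornerMinor hM h2 fun a b hab => by
      rw [h2 a b hab]
      exact h0 a b hab

theorem cornerMinor_partialMat_ne_zero {c : Tri n → ℂ} (hc : ∀ a, c a ≠ 0) {a b : ℕ}
    (h : a + b ≤ n + 1) : cornerMinor (partialMat n (extTri c) n) a b ≠ 0 := by
  rw [cornerMinor_partialMat _ h]
  refine Finset.prod_ne_zero_iff.2 fun r hr => Finset.prod_ne_zero_iff.2 fun i hi => ?_
  rw [Finset.mem_range] at hr hi
  rw [extTri_of_lt c (by omega) (by omega)]
  exact hc _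

theorem eq_cornerMinor_ratio {c : Tri n → ℂ} (hc : ∀ a, c a ≠ 0) (a : Tri n) :
    c a = cornerMinor (partialMat n (extTri c) n) (a.1.1 - a.1.2 + 1) (a.1.2 + 1) *
      cornerMinor (partialMat n (extTri c) n) (a.1.1 - a.1.2) a.1.2 /
      (cornerMinor (partialMat n (extTri c) n) (a.1.1 - a.1.2) (a.1.2 + 1) *
      cornerMinor (partialMat n (extTri c) n) (a.1.1 - a.1.2 + 1) a.1.2) := by
  have hle : (a.1.2 : ℕ) ≤ a.1.1 := a.2
  have hlt : (a.1.1 : ℕ) < n := a.1.1.2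
  have h := mul_cornerMinor_partialMat (n := n) (extTri c) (a := a.1.1 - a.1.2) (b := a.1.2)
    (by omega)
  rw [show (a.1.2 : ℕ) + (a.1.1 - a.1.2) = a.1.1 by omega, extTri_apply] at h
  rw [eq_div_iff, h]
  exact mul_ne_zero (cornerMinor_partialMat_ne_zero hc (by omega))
    (cornerMinor_partialMat_ne_zero hc (by omega))

end Minors

section Projective

variable {n : ℕ}

/-! ### Matrices representing elements of `PGL_{n+1}` -/

theorem IsUni.mul {M N : Mat n} (hM : IsUni M) (hN : IsUni N) : IsUni (M * N) := by
  intro i j hij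
  rw [Matrix.mul_apply, Finset.sum_eq_single i]
  · rw [hM i i le_rfl, if_pos rfl, one_mul, hN i j hij]
  · intro k _ hk
    rcases lt_or_gt_of_ne hk with h | h
    · rw [hM i k h.le, if_neg h.ne', zero_mul]
    · rw [hN k j (hij.trans h.le), if_neg (hij.trans_lt h).ne', mul_zero]
  · simp

theorem IsUni.coe_inv {g : SLv n} (hg : IsUni (g : Mat n)) : IsUni ((g⁻¹ : SLv n) : Mat n) := by
  have h1 : (g : Mat n) * ((g⁻¹ : SLv n) : Mat n) = 1 := by
    have := congrArg (slVal n) (mul_inv_cancel g)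
    rwa [map_mul, map_one] at this
  have hup : ∀ i j : Fin (n + 1), j < i → ((g⁻¹ : SLv n) : Mat n) i j = 0 := by
    have : Invertible (g : Mat n) := ⟨_, mul_eq_one_comm.1 h1, h1⟩
    have hb : (g : Mat n).BlockTriangular id := fun i j hij => by
      have hij' : j < i := hij
      rw [hg i j hij'.le, if_neg hij'.ne']
    have h2 := Matrix.blockTriangular_inv_of_blockTriangular hb
    rw [Matrix.inv_eq_right_inv h1] at h2
    exact fun i j hij => h2 hij
  intro i j hij
  rcases hij.lt_or_eq with h | rfl
  · rw [hup i j h, if_neg h.ne']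
  · have h3 := congrFun (congrFun h1 j) j
    rw [Matrix.mul_apply, Finset.sum_eq_single j, hg j j le_rfl, if_pos rfl, one_mul,
      Matrix.one_apply_eq] at h3
    · rw [h3, if_pos rfl]
    · intro k _ hk
      rcases lt_or_gt_of_ne hk with h | h
      · rw [hg j k h.le, if_neg h.ne', zero_mul]
      · rw [hup k j h, mul_zero]
    · simp

theorem isUni_unip (u : UIdx n → ℂ) : IsUni (unip u : Mat n) := by
  intro i j hij
  change (if h : i < j then u ⟨(i, j), h⟩ else if i = j then 1 else 0) = _
  rw [dif_neg hij.not_gt]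

theorem unip_apply (u : UIdx n → ℂ) (p : UIdx n) : (unip u : Mat n) p.1.1 p.1.2 = u p := by
  change (if h : p.1.1 < p.1.2 then u ⟨(p.1.1, p.1.2), h⟩ else _) = _
  rw [dif_pos p.2]

theorem IsUni.eq_unip {g : SLv n} (hg : IsUni (g : Mat n)) :
    unip (fun p => (g : Mat n) p.1.1 p.1.2) = g := by
  refine Matrix.SpecialLinearGroup.ext _ _ fun i j => ?_
  rcases lt_or_ge i j with h | h
  · exact unip_apply (fun p => (g : Mat n) p.1.1 p.1.2) ⟨(i, j), h⟩
  · rw [isUni_unip _ i j h, hg i j h]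

theorem isUni_xc (σ : Arrow n → ℂ) : IsUni (xc σ : Mat n) := by
  rw [coe_xc]
  exact isUni_partialMat _

theorem isUni_one : IsUni (1 : Mat n) := fun _ _ _ => Matrix.one_apply

theorem isUni_bidiag (a : ℕ → ℂ) : IsUni (bidiag n a) := by
  intro i j hij
  have : ¬ (i : ℕ) + 1 = j := by
    have : (j : ℕ) ≤ i := hij
    omega
  simp [bidiag, this]

theorem isUni_dPartial (d : ℕ → ℕ → ℂ) (r : ℕ) : IsUni (dPartial n d r) := by
  induction r with
  | zero => exact isUni_one
  | succ r ih => exact (isUni_bidiag _).mul ih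

theorem isUni_xd (σ : Arrow n → ℂ) : IsUni (xd σ : Mat n) := by
  rw [coe_xd]
  exact isUni_dPartial _ _

theorem mk_eq_mk_iff_smul {g h : Matrix.GeneralLinearGroup (Fin (n + 1)) ℂ} :
    Matrix.ProjGenLinGroup.mk g = Matrix.ProjGenLinGroup.mk h ↔
      ∃ z : ℂˣ, (h : Mat n) = (z : ℂ) • (g : Mat n) := by
  rw [Matrix.ProjGenLinGroup.mk_eq_mk_iff]
  refine exists_congr fun z => ?_
  rw [Units.ext_iff, Units.val_mul, Matrix.GeneralLinearGroup.coe_scalar]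
  have : (g : Mat n) * Matrix.scalar (Fin (n + 1)) (z : ℂ) = (z : ℂ) • (g : Mat n) := by
    ext i j
    simp [mul_comm]
  rw [this, eq_comm]

theorem mk_mem_Bminus_iff {g : Matrix.GeneralLinearGroup (Fin (n + 1)) ℂ} :
    Matrix.ProjGenLinGroup.mk g ∈ Bminus n ↔ ∀ i j, i < j → (g : Mat n) i j = 0 := by
  constructor
  · rintro ⟨h, hh, hgh⟩ i j hij
    obtain ⟨z, hz⟩ := mk_eq_mk_iff_smul.1 hgh
    have h1 : (h : Mat n) i j = 0 := hh i j hij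
    rw [hz, Matrix.smul_apply, h1, smul_zero]
  · intro h
    exact ⟨g, h, rfl⟩

theorem cover_eq_mk (g : SLv n) :
    cover g = Matrix.ProjGenLinGroup.mk (Matrix.SpecialLinearGroup.toGL g) := rfl

theorem cover_mem_Bminus_iff {g : SLv n} :
    cover g ∈ Bminus n ↔ ∀ i j, i < j → (g : Mat n) i j = 0 := by
  rw [cover_eq_mk, mk_mem_Bminus_iff]
  rfl

theorem IsUni.eq_one_of_cover_mem {g : SLv n} (hg : IsUni (g : Mat n)) (h : cover g ∈ Bminus n) :
    g = 1 := by
  rw [cover_mem_Bminus_iff] at h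
  refine Matrix.SpecialLinearGroup.ext _ _ fun i j => ?_
  rw [Matrix.SpecialLinearGroup.coe_one, Matrix.one_apply]
  rcases lt_or_ge i j with hij | hij
  · rw [h i j hij, if_neg hij.ne]
  · exact hg i j hij

theorem IsUni.eq_of_mk_eq {g h : SLv n} (hg : IsUni (g : Mat n)) (hh : IsUni (h : Mat n))
    (H : (QuotientGroup.mk (cover g) : Flag n) = QuotientGroup.mk (cover h)) : g = h := by
  rw [QuotientGroup.eq, ← map_inv, ← map_mul] at H
  have := IsUni.eq_one_of_cover_mem (g := g⁻¹ * h)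
    (by rw [Matrix.SpecialLinearGroup.coe_mul]; exact hg.coe_inv.mul hh) H
  exact (inv_mul_eq_one.1 this)

theorem bigCell_injective : Function.Injective (bigCell (n := n)) := by
  intro u v huv
  have := (isUni_unip u).eq_of_mk_eq (isUni_unip v) huv
  ext p
  rw [← unip_apply u, this, unip_apply]

theorem bigCellCoord_bigCell (u : UIdx n → ℂ) : bigCellCoord (bigCell u) = u :=
  Function.leftInverse_invFun bigCell_injective u

theorem IsUni.mk_eq_bigCell {g : SLv n} (hg : IsUni (g : Mat n)) :
    (QuotientGroup.mk (cover g) : Flag n) = bigCell fun p => (g : Mat n) p.1.1 p.1.2 := by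
  rw [bigCell, hg.eq_unip]

theorem gammaMap_eq_bigCell (σ : Arrow n → ℂ) :
    gammaMap σ = bigCell fun p => (xc σ : Mat n) p.1.1 p.1.2 :=
  (isUni_xc σ).mk_eq_bigCell

theorem bigCellCoord_gammaMap (σ : Arrow n → ℂ) (p : UIdx n) :
    bigCellCoord (gammaMap σ) p = (xc σ : Mat n) p.1.1 p.1.2 := by
  rw [gammaMap_eq_bigCell, bigCellCoord_bigCell]

theorem unip_bigCellCoord_gammaMap (σ : Arrow n → ℂ) :
    unip (bigCellCoord (gammaMap σ)) = xc σ := by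
  rw [gammaMap_eq_bigCell, bigCellCoord_bigCell, (isUni_xc σ).eq_unip]

/-- The element of `GL_{n+1}` given by an invertible matrix. -/
def glOf (M : Mat n) (h : M.det ≠ 0) : Matrix.GeneralLinearGroup (Fin (n + 1)) ℂ :=
  Matrix.GeneralLinearGroup.mkOfDetNeZero M h

@[simp] theorem coe_glOf (M : Mat n) (h : M.det ≠ 0) : (glOf M h : Mat n) = M := rfl

theorem diagElt_eq {d : Fin (n + 1) → ℂ} (hd : ∀ i, d i ≠ 0) :
    ∃ h, diagElt d = Matrix.ProjGenLinGroup.mk (glOf (Matrix.diagonal d) h) := by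
  have h : (Matrix.diagonal d).det ≠ 0 := by
    rw [Matrix.det_diagonal]
    exact Finset.prod_ne_zero_iff.2 fun i _ => hd i
  refine ⟨h, ?_⟩
  rw [diagElt, dif_pos h]
  rfl

theorem range_bigCell : Set.range (bigCell (n := n)) =
    QuotientGroup.mk '' {g : Gv n | ∃ b ∈ Bplus n, ∃ b' ∈ Bminus n, g = b * b'} := by
  ext p
  constructor
  · rintro ⟨u, rfl⟩
    refine ⟨cover (unip u), ⟨_, ⟨Matrix.SpecialLinearGroup.toGL (unip u), ?_, rfl⟩, 1, one_mem _,
      (mul_one _).symm⟩, rfl⟩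
    intro i j hij
    have := isUni_unip u i j hij.le
    rw [if_neg hij.ne'] at this
    exact this
  · rintro ⟨_, ⟨_, ⟨g, hg, rfl⟩, b', hb', rfl⟩, rfl⟩
    have hgu : ∀ i j : Fin (n + 1), j < i → (g : Mat n) i j = 0 := hg
    have hdet : (g : Mat n).det ≠ 0 := (Matrix.isUnit_iff_isUnit_det _).1 g.isUnit |>.ne_zero
    rw [Matrix.det_of_isUpperTriangular (fun i j hij => hgu i j hij)] at hdet
    have hd : ∀ i, (g : Mat n) i i ≠ 0 := fun i => (Finset.prod_ne_zero_iff.1 hdet) i (by simp)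
    obtain ⟨hD, -⟩ := diagElt_eq hd
    -- Dividing each column by its diagonal entry splits off the torus part on the right, where it
    -- is absorbed by `B_-`.
    set u : UIdx n → ℂ := fun p => (g : Mat n) p.1.1 p.1.2 / (g : Mat n) p.1.2 p.1.2 with hu
    have hgU : g = Matrix.SpecialLinearGroup.toGL (unip u) * glOf _ hD := by
      refine Units.ext ?_
      ext i j
      change _ = ((unip u : Mat n) * Matrix.diagonal fun i => (g : Mat n) i i) i j
      rw [Matrix.mul_diagonal]
      rcases lt_or_ge i j with h | h
      · rw [unip_apply u ⟨(i, j), h⟩, hu]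
        field_simp [hd j]
      · rw [isUni_unip u i j h]
        rcases h.lt_or_eq with h | rfl
        · rw [hgu i j h, if_neg h.ne', zero_mul]
        · simp
    refine ⟨u, ?_⟩
    rw [bigCell, QuotientGroup.eq, hgU, map_mul, cover_eq_mk, ← mul_assoc, inv_mul_cancel_left]
    refine mul_mem (mk_mem_Bminus_iff.2 fun i j hij => ?_) hb'
    rw [coe_glOf, Matrix.diagonal_apply_ne _ hij.ne]

theorem Rich_subset : Rich n ⊆ Set.range bigCell := by
  rw [range_bigCell]
  rintro _ ⟨g, ⟨h, -⟩, rfl⟩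
  exact ⟨g, h, rfl⟩

theorem adCoord_mk (g : Matrix.GeneralLinearGroup (Fin (n + 1)) ℂ) (i l k m : Fin (n + 1)) :
    adCoord (Matrix.ProjGenLinGroup.mk g) ((i, l), (k, m)) =
      (g : Mat n) k i * ((g⁻¹ : Matrix.GeneralLinearGroup (Fin (n + 1)) ℂ) : Mat n) l m := by
  rw [adCoord, Ad, Matrix.ProjGenLinGroup.lift_mk]
  change ((g : Mat n) * Matrix.single i l 1 *
    ((g⁻¹ : Matrix.GeneralLinearGroup (Fin (n + 1)) ℂ) : Mat n) : Mat n) k m = _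
  rw [Matrix.mul_apply, Finset.sum_eq_single l]
  · congr 1
    simp
  · intro b _ hb
    rw [Matrix.mul_single_apply_of_ne _ _ _ _ _ hb, zero_mul]
  · simp

/-- A matrix representing an element of `B_-`, polynomial in the matrix coefficients of `Ad`. -/
def hatMat (x : (Fin (n + 1) × Fin (n + 1)) × (Fin (n + 1) × Fin (n + 1)) → ℂ) : Mat n :=
  Matrix.of fun k i => x ((i, Fin.last n), (k, Fin.last n))

/-- The entry `(k, n)` of `Ad(g) E_{i,n}` is `g_{ki} (g⁻¹)_{nn}`, and the last factor is nonzero for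
lower triangular `g`. So a representative of a class in `B_-` is a polynomial in the adjoint
coordinates, up to a scalar that drops out of ratios of minors of equal size. -/
theorem hatMat_mk {g : Matrix.GeneralLinearGroup (Fin (n + 1)) ℂ}
    (h : Matrix.ProjGenLinGroup.mk g ∈ Bminus n) :
    ∃ z : ℂ, z ≠ 0 ∧ hatMat (adCoord (Matrix.ProjGenLinGroup.mk g)) = z • (g : Mat n) := by
  rw [mk_mem_Bminus_iff] at h
  refine ⟨((g⁻¹ : Matrix.GeneralLinearGroup (Fin (n + 1)) ℂ) : Mat n) (Fin.last n) (Fin.last n),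
    ?_, ?_⟩
  · have h1 : ((g⁻¹ : Matrix.GeneralLinearGroup (Fin (n + 1)) ℂ) : Mat n) * (g : Mat n) = 1 := by
      rw [← Units.val_mul, inv_mul_cancel, Units.val_one]
    have h2 := congrFun (congrFun h1 (Fin.last n)) (Fin.last n)
    rw [Matrix.mul_apply, Finset.sum_eq_single (Fin.last n), Matrix.one_apply_eq] at h2
    · intro h0
      rw [h0, zero_mul] at h2
      exact zero_ne_one h2
    · intro b _ hb
      rw [h b _ (Fin.lt_last_iff_ne_last.2 hb), mul_zero]
    · simp
  · ext k i
    rw [hatMat, Matrix.of_apply, adCoord_mk, Matrix.smul_apply, smul_eq_mul, mul_comm]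

end Projective

/-! ### Recovering corner minors of `u` from `u t ẇ₀⁻¹ v`. -/

section Chamber

variable {n : ℕ}

/-- The class in `PGL_{n+1}` of an invertible matrix (and `1` if the matrix is singular). -/
def pmk (M : Mat n) : Gv n :=
  if h : M.det ≠ 0 then Matrix.ProjGenLinGroup.mk (glOf M h) else 1

theorem pmk_eq {M : Mat n} (h : M.det ≠ 0) :
    pmk M = Matrix.ProjGenLinGroup.mk (glOf M h) := dif_pos h

theorem pmk_diagonal (d : Fin (n + 1) → ℂ) : pmk (Matrix.diagonal d) = diagElt d := rfl

theorem pmk_coe (g : Matrix.GeneralLinearGroup (Fin (n + 1)) ℂ) :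
    pmk (g : Mat n) = Matrix.ProjGenLinGroup.mk g := by
  have h : (g : Mat n).det ≠ 0 := ((Matrix.isUnit_iff_isUnit_det _).1 g.isUnit).ne_zero
  rw [pmk_eq h]
  congr 1
  exact Units.ext rfl

theorem cover_eq_pmk (g : SLv n) : cover g = pmk (g : Mat n) := by
  rw [cover_eq_mk, ← pmk_coe]
  rfl

theorem pmk_mul {M N : Mat n} (hM : M.det ≠ 0) (hN : N.det ≠ 0) :
    pmk (M * N) = pmk M * pmk N := by
  rw [pmk_eq hM, pmk_eq hN, ← map_mul, ← pmk_coe]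
  rfl

theorem pmk_mem_Bminus_iff {M : Mat n} (hM : M.det ≠ 0) :
    pmk M ∈ Bminus n ↔ ∀ i j, i < j → M i j = 0 := by
  rw [pmk_eq hM, mk_mem_Bminus_iff]
  rfl

theorem det_coe_ne_zero (g : SLv n) : (g : Mat n).det ≠ 0 := by
  rw [g.det_coe]
  exact one_ne_zero

theorem adCoord_pmk {M : Mat n} (hM : M.det ≠ 0) (i l k m : Fin (n + 1)) :
    adCoord (pmk M) ((i, l), (k, m)) = M k i * M⁻¹ l m := by
  rw [pmk_eq hM, adCoord_mk, Matrix.coe_units_inv]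
  rfl

theorem hatMat_pmk {M : Mat n} (hM : M.det ≠ 0) (h : pmk M ∈ Bminus n) :
    ∃ z : ℂ, z ≠ 0 ∧ hatMat (adCoord (pmk M)) = z • M := by
  rw [pmk_eq hM] at h ⊢
  exact hatMat_mk h

theorem mem_Uplus_of_isUni {g : SLv n} (hg : IsUni (g : Mat n)) : cover g ∈ Uplus n :=
  ⟨_, congrArg cover hg.eq_unip⟩

theorem exists_of_mem_Uplus {u : Gv n} (hu : u ∈ Uplus n) :
    ∃ g : SLv n, IsUni (g : Mat n) ∧ cover g = u := by
  obtain ⟨v, rfl⟩ := hu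
  exact ⟨_, isUni_unip v, rfl⟩

/-- The minor with rows `0, …, a-1, a+b, …, a+b+r-1` and the first `a + r` columns. -/
def chamberMinor (M : Mat n) (a b r : ℕ) : ℂ :=
  (Matrix.of fun x y : Fin a ⊕ Fin r =>
    natEntry M (Sum.elim (fun i : Fin a => (i : ℕ)) (fun i : Fin r => a + b + i) x)
      (Sum.elim (fun i : Fin a => (i : ℕ)) (fun i : Fin r => a + i) y)).det

/-- The minor with rows `b, …, b+m-1` and the first `m` columns. -/
def baseMinor (M : Mat n) (b m : ℕ) : ℂ :=
  (Matrix.of fun x y : Fin m => natEntry M (b + x) y).det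

theorem natEntry_mul (M N : Mat n) {i j : ℕ} (hi : i < n + 1) (hj : j < n + 1) :
    natEntry (M * N) i j = ∑ k ∈ Finset.range (n + 1), natEntry M i k * natEntry N k j := by
  rw [natEntry_of_lt _ hi hj, Matrix.mul_apply, ← Fin.sum_univ_eq_sum_range]
  refine Finset.sum_congr rfl fun k _ => ?_
  rw [natEntry_of_lt _ hi k.2, natEntry_of_lt _ k.2 hj]

theorem baseMinor_eq (M : Mat n) (a b r : ℕ) :
    baseMinor M b (a + r) = (Matrix.of fun x y : Fin a ⊕ Fin r =>
      natEntry M (b + Sum.elim (fun i : Fin a => (i : ℕ)) (fun i : Fin r => a + i) x)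
        (Sum.elim (fun i : Fin a => (i : ℕ)) (fun i : Fin r => a + i) y)).det := by
  rw [baseMinor, ← Matrix.det_submatrix_equiv_self finSumFinEquiv]
  congr 1
  ext x y
  rcases x with x | x <;> rcases y with y | y <;> simp

/-- `S` vanishes strictly above the antidiagonal. -/
def AntiLower (S : Mat n) : Prop := ∀ k y, k + y < n → natEntry S k y = 0

/-- The column index is less than `a + r = n + 1 - b`, so `S` vanishes there in the rows above `b`.
The matrix product thus reduces to a product over `a + r` indices, and determinants become
multiplicative. -/
theorem natEntry_mul_anti {M S : Mat n} (hS : AntiLower S) {a b r : ℕ} (h : a + b + r = n + 1)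
    {i : ℕ} (hi : i < n + 1) (y : Fin a ⊕ Fin r) :
    natEntry (M * S) i (Sum.elim (fun i : Fin a => (i : ℕ)) (fun i : Fin r => a + i) y) =
      ∑ x : Fin a ⊕ Fin r, natEntry M i
        (b + Sum.elim (fun i : Fin a => (i : ℕ)) (fun i : Fin r => a + i) x) *
        natEntry S (b + Sum.elim (fun i : Fin a => (i : ℕ)) (fun i : Fin r => a + i) x)
          (Sum.elim (fun i : Fin a => (i : ℕ)) (fun i : Fin r => a + i) y) := by
  set y' := Sum.elim (fun i : Fin a => (i : ℕ)) (fun i : Fin r => a + i) y with hy'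
  have hy : y' < a + r := by
    rcases y with y | y
    · have := y.2
      simp only [hy', Sum.elim_inl]
      omega
    · have := y.2
      simp only [hy', Sum.elim_inr]
      omega
  rw [natEntry_mul _ _ hi (by omega)]
  have hsplit : n + 1 = b + (a + r) := by omega
  rw [hsplit, Finset.sum_range_add, Finset.sum_eq_zero, zero_add, Finset.sum_range_add,
    ← Fin.sum_univ_eq_sum_range (fun x => natEntry M i (b + x) * natEntry S (b + x) y') a,
    ← Fin.sum_univ_eq_sum_range
      (fun x => natEntry M i (b + (a + x)) * natEntry S (b + (a + x)) y') r, Fintype.sum_sum_type]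
  · rfl
  · intro k hk
    rw [Finset.mem_range] at hk
    rw [hS k y' (by omega), mul_zero]

theorem det_of_uni {m : ℕ} {E : Matrix (Fin m) (Fin m) ℂ}
    (h : ∀ i j, j ≤ i → E i j = if i = j then 1 else 0) : E.det = 1 := by
  rw [Matrix.det_of_isUpperTriangular]
  · exact Finset.prod_eq_one fun i _ => by rw [h i i le_rfl, if_pos rfl]
  · intro i j hij
    have hij' : j < i := hij
    rw [h i j hij'.le, if_neg hij'.ne']

/-- After the reduction of `natEntry_mul_anti`, the part coming from `U` is block upper triangular:
one block is the corner minor, and the other is unitriangular because its rows and columns are the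
last `r` ones. -/
theorem chamberMinor_mul {U S : Mat n} (hU : IsUni U) (hS : AntiLower S) {a b r : ℕ}
    (h : a + b + r = n + 1) :
    chamberMinor (U * S) a b r = cornerMinor U a b * baseMinor S b (a + r) := by
  rw [baseMinor_eq, chamberMinor]
  have hE : (Matrix.of fun x y : Fin a ⊕ Fin r => natEntry U
      (Sum.elim (fun i : Fin a => (i : ℕ)) (fun i : Fin r => a + b + i) x)
      (b + Sum.elim (fun i : Fin a => (i : ℕ)) (fun i : Fin r => a + i) y)).det =
      cornerMinor U a b := by
    rw [show (Matrix.of fun x y : Fin a ⊕ Fin r => natEntry U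
      (Sum.elim (fun i : Fin a => (i : ℕ)) (fun i : Fin r => a + b + i) x)
      (b + Sum.elim (fun i : Fin a => (i : ℕ)) (fun i : Fin r => a + i) y)) =
      Matrix.fromBlocks (Matrix.of fun i j : Fin a => natEntry U i (b + j))
        (Matrix.of fun (i : Fin a) (j : Fin r) => natEntry U i (b + (a + j))) 0
        (Matrix.of fun i j : Fin r => natEntry U (a + b + i) (b + (a + j))) from ?_,
      Matrix.det_fromBlocks_zero₂₁, det_of_uni (m := r), mul_one]
    · rfl
    · intro i j hij
      have h1 := i.2
      have hij' : (j : ℕ) ≤ i := hij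
      rw [Matrix.of_apply, hU.natEntry (by omega) (by omega)]
      simp only [Fin.ext_iff]
      congr 1
      rw [eq_iff_iff]
      omega
    · ext x y
      rcases x with x | x <;> rcases y with y | y
      · rfl
      · rfl
      · have h1 := x.2
        have h2 := y.2
        simp only [Matrix.of_apply, Sum.elim_inr, Sum.elim_inl, Matrix.fromBlocks_apply₂₁,
          Matrix.zero_apply]
        rw [hU.natEntry (by omega) (by omega), if_neg (by omega)]
      · rfl
  rw [← hE, ← Matrix.det_mul]
  congr 1
  ext x y
  rw [Matrix.mul_apply]
  simp only [Matrix.of_apply]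
  refine natEntry_mul_anti hS h ?_ y
  rcases x with x | x
  · have := x.2
    simp only [Sum.elim_inl]
    omega
  · have := x.2
    simp only [Sum.elim_inr]
    omega

/-- The case of an empty corner in `chamberMinor_mul`. It supplies the denominator that removes `S`
from the formula. -/
theorem baseMinor_mul {U S : Mat n} (hU : IsUni U) (hS : AntiLower S) {b m : ℕ}
    (h : b + m = n + 1) : baseMinor (U * S) b m = baseMinor S b m := by
  have h1 := chamberMinor_mul hU hS (a := 0) (b := b) (r := m) (by omega)
  rw [cornerMinor_zero_left, one_mul] at h1
  have h2 : ∀ M : Mat n, chamberMinor M 0 b m = baseMinor M b (0 + m) := by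
    intro M
    rw [baseMinor_eq, chamberMinor]
    congr 1
    ext x y
    rcases x with x | x
    · exact x.elim0
    · simp
  rw [h2, zero_add] at h1
  exact h1

theorem baseMinor_ne_zero {S : Mat n} (hS : AntiLower S)
    (hS0 : ∀ k y, k + y = n → natEntry S k y ≠ 0) {b m : ℕ} (h : b + m = n + 1) :
    baseMinor S b m ≠ 0 := by
  rw [baseMinor]
  set E := (Matrix.of fun x y : Fin m => natEntry S (b + x) y)
  -- Reversing the columns turns the antidiagonal shape into a lower triangular one.
  have h1 : (E.submatrix id Fin.revPerm).det ≠ 0 := by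
    rw [Matrix.det_of_isLowerTriangular]
    · refine Finset.prod_ne_zero_iff.2 fun i _ => hS0 _ _ ?_
      have := i.2
      simp [Fin.val_rev]
      omega
    · intro i j hij
      have hij' : (i : ℕ) < j := hij
      refine hS _ _ ?_
      have := j.2
      simp [Fin.val_rev]
      omega
  rw [Matrix.det_permute'] at h1
  exact right_ne_zero_of_mul h1

theorem natEntry_diagonal_anti (d : Fin (n + 1) → ℂ) (U : Mat n) (z : ℂ) {k y : ℕ} (hk : k < n + 1)
    (hy : y < n + 1) : natEntry (z • (Matrix.diagonal d * antiMat n * U)) k y =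
      z * (d ⟨k, hk⟩ * (-1) ^ (n - k) * natEntry U (n - k) y) := by
  rw [natEntry_of_lt _ hk hy, Matrix.smul_apply, smul_eq_mul, mul_assoc, Matrix.diagonal_mul,
    Matrix.mul_apply, Finset.sum_eq_single ⟨n - k, by omega⟩,
    natEntry_of_lt U (by omega : n - k < n + 1) hy]
  · rw [antiMat, Matrix.of_apply, if_pos (by simp; omega), mul_assoc]
  · intro b _ hb
    rw [antiMat, Matrix.of_apply, if_neg, zero_mul]
    intro h
    apply hb
    ext
    simp at h ⊢
    omega
  · simp

theorem antiLower_diagonal_anti (d : Fin (n + 1) → ℂ) {U : Mat n} (hU : IsUni U) (z : ℂ) :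
    AntiLower (z • (Matrix.diagonal d * antiMat n * U)) := by
  intro k y h
  rw [natEntry_diagonal_anti d U z (by omega) (by omega), hU.natEntry (by omega) (by omega),
    if_neg (by omega), mul_zero, mul_zero]

theorem natEntry_diagonal_anti_ne_zero {d : Fin (n + 1) → ℂ} (hd : ∀ i, d i ≠ 0) {U : Mat n}
    (hU : IsUni U) {z : ℂ} (hz : z ≠ 0) {k y : ℕ} (h : k + y = n) :
    natEntry (z • (Matrix.diagonal d * antiMat n * U)) k y ≠ 0 := by
  rw [natEntry_diagonal_anti d U z (by omega) (by omega), hU.natEntry (by omega) (by omega),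
    if_pos (by omega)]
  exact mul_ne_zero hz (mul_ne_zero (mul_ne_zero (hd _) (pow_ne_zero _ (by norm_num))) one_ne_zero)

/-- Corner minors of the first factor in `U D ẇ₀⁻¹ V` are ratios of minors of the product. -/
theorem chamberMinor_div_baseMinor {d : Fin (n + 1) → ℂ} (hd : ∀ i, d i ≠ 0) {U V : Mat n}
    (hU : IsUni U) (hV : IsUni V) {z : ℂ} (hz : z ≠ 0) {a b r : ℕ} (h : a + b + r = n + 1) :
    baseMinor (z • (U * Matrix.diagonal d * antiMat n * V)) b (a + r) ≠ 0 ∧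
    chamberMinor (z • (U * Matrix.diagonal d * antiMat n * V)) a b r /
      baseMinor (z • (U * Matrix.diagonal d * antiMat n * V)) b (a + r) = cornerMinor U a b := by
  have e : z • (U * Matrix.diagonal d * antiMat n * V) =
      U * (z • (Matrix.diagonal d * antiMat n * V)) := by
    rw [Matrix.mul_smul, mul_assoc, mul_assoc, mul_assoc]
  have hS := antiLower_diagonal_anti d hV z
  have h0 := baseMinor_ne_zero hS (fun k y h => natEntry_diagonal_anti_ne_zero hd hV hz h)
    (b := b) (m := a + r) (by omega)
  rw [e, baseMinor_mul hU hS (by omega), chamberMinor_mul hU hS h, mul_div_cancel_right₀ _ h0]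
  exact ⟨h0, rfl⟩

end Chamber

/-! ### The map `β`, normal forms in `Z_B`, and a criterion for open embeddings. -/

section Beta

variable {n : ℕ}

theorem isUni_inv_xd (σ : Arrow n → ℂ) : IsUni (((xd σ)⁻¹ : SLv n) : Mat n) :=
  (isUni_xd σ).coe_inv

/-- The diagonal entries of the matrix representing `τ(σ)`. -/
def tauVec (Q : Fin n → ℂ) (i : Fin (n + 1)) : ℂ := ∏ k : Fin n with i ≤ k.castSucc, Q k

theorem tauVec_ne_zero {Q : Fin n → ℂ} (hQ : ∀ i, Q i ≠ 0) (i : Fin (n + 1)) : tauVec Q i ≠ 0 :=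
  Finset.prod_ne_zero_iff.2 fun k _ => hQ k

theorem det_diagonal_ne_zero {d : Fin (n + 1) → ℂ} (hd : ∀ i, d i ≠ 0) :
    (Matrix.diagonal d).det ≠ 0 := by
  rw [Matrix.det_diagonal]
  exact Finset.prod_ne_zero_iff.2 fun i _ => hd i

theorem cover_inv_eq_pmk (g : SLv n) : (cover g)⁻¹ = pmk ((g⁻¹ : SLv n) : Mat n) := by
  rw [← map_inv, cover_eq_pmk]

theorem det_antiMat_ne_zero : (antiMat n).det ≠ 0 := by
  rw [← coe_w₀Dot_inv]
  exact det_coe_ne_zero _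

/-- The matrix `u D ẇ₀⁻¹ v` represents the corresponding product in `PGL_{n+1}`. -/
theorem pmk_bruhat {d : Fin (n + 1) → ℂ} (hd : ∀ i, d i ≠ 0) (u v : SLv n) :
    ((u : Mat n) * Matrix.diagonal d * antiMat n * (v : Mat n)).det ≠ 0 ∧
    cover u * diagElt d * (cover (w₀Dot n))⁻¹ * cover v =
      pmk ((u : Mat n) * Matrix.diagonal d * antiMat n * (v : Mat n)) := by
  have h1 := det_diagonal_ne_zero hd
  have h2 := det_antiMat_ne_zero (n := n)
  have h3 : ((u : Mat n) * Matrix.diagonal d).det ≠ 0 := by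
    rw [Matrix.det_mul]
    exact mul_ne_zero (det_coe_ne_zero u) h1
  have h4 : ((u : Mat n) * Matrix.diagonal d * antiMat n).det ≠ 0 := by
    rw [Matrix.det_mul]
    exact mul_ne_zero h3 h2
  refine ⟨?_, ?_⟩
  · rw [Matrix.det_mul]
    exact mul_ne_zero h4 (det_coe_ne_zero v)
  · rw [pmk_mul h4 (det_coe_ne_zero v), pmk_mul h3 h2, pmk_mul (det_coe_ne_zero u) h1,
      cover_eq_pmk u, cover_eq_pmk v, cover_inv_eq_pmk, coe_w₀Dot_inv, pmk_diagonal]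

theorem beta_eq (σ : Arrow n → ℂ) : beta σ = cover (xc σ) * diagElt (tauVec (qTilde σ)) *
    (cover (w₀Dot n))⁻¹ * cover ((xd (-σ))⁻¹) := by
  rw [beta, map_inv]
  rfl

theorem coe_xd_neg (σ : Arrow n → ℂ) :
    (xd (-σ) : Mat n) = dPartial n (fun i j => - horArrow σ i j) n := by
  rw [coe_xd]
  congr 1
  funext i j
  by_cases h : j ≤ i ∧ i < n
  · rw [extTri_of_lt _ h.1 h.2, horArrow, extTri_of_lt _ h.1 h.2]
    rfl
  · rw [extTri_of_not _ h, horArrow, extTri_of_not _ h, neg_zero]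

theorem betaMat_mul_xd {σ : Arrow n → ℂ} (hσ : σ ∈ Zquiver n) :
    betaMat n (vertArrow σ) (vertexVar σ) * (xd (-σ) : Mat n) =
      (xc σ : Mat n) * Matrix.diagonal (tauVec (qTilde σ)) * antiMat n := by
  have hc : ∀ i j, j ≤ i → i < n →
      vertexVar σ i j = vertArrow σ i j * vertexVar σ (i + 1) j :=
    fun i j _ hi => vertexVar_vert σ hi
  have hd : ∀ i j, j ≤ i → i < n →
      vertexVar σ (i + 1) j = horArrow σ i j * vertexVar σ (i + 1) (j + 1) :=
    fun i j h hi => vertexVar_hor hσ h hi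
  have hdiag : (fun i : Fin (n + 1) => vertexVar σ i i) = tauVec (qTilde σ) :=
    funext fun i => vertexVar_diag hσ i
  rw [coe_xd_neg, betaMat_mul hc hd, hdiag, coe_xc]
  rfl

theorem xc_mul_mul_xd_inv {σ : Arrow n → ℂ} (hσ : σ ∈ Zquiver n) :
    (xc σ : Mat n) * Matrix.diagonal (tauVec (qTilde σ)) * antiMat n *
      (((xd (-σ))⁻¹ : SLv n) : Mat n) = betaMat n (vertArrow σ) (vertexVar σ) := by
  rw [← betaMat_mul_xd hσ, mul_assoc, ← Matrix.SpecialLinearGroup.coe_mul, mul_inv_cancel,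
    Matrix.SpecialLinearGroup.coe_one, mul_one]

theorem beta_mem_Bminus {σ : Arrow n → ℂ} (hσ : σ ∈ Zquiver n) : beta σ ∈ Bminus n := by
  have h := pmk_bruhat (tauVec_ne_zero (qTilde_ne_zero hσ)) (xc σ) ((xd (-σ))⁻¹)
  rw [xc_mul_mul_xd_inv hσ] at h
  rw [beta_eq, h.2, pmk_mem_Bminus_iff h.1]
  intro i j hij
  exact betaMat_lower _ _ hij

theorem tau_beta_mem_ZB {σ : Arrow n → ℂ} (hσ : σ ∈ Zquiver n) : (tau σ, beta σ) ∈ ZB n := by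
  refine ⟨?_, beta_mem_Bminus hσ, _, mem_Uplus_of_isUni (isUni_xc σ), _,
    mem_Uplus_of_isUni (isUni_inv_xd (-σ)), ?_⟩
  · have h := det_diagonal_ne_zero (tauVec_ne_zero (qTilde_ne_zero hσ))
    refine ⟨glOf _ h, fun i j hij => ?_, (pmk_eq h).symm⟩
    rw [coe_glOf, Matrix.diagonal_apply_ne _ hij]
  · rw [map_inv]
    rfl

/-- Every element of the torus has a unique representative with last diagonal entry `1`. -/
theorem exists_diagElt_of_mem_Tv {t : Gv n} (ht : t ∈ Tv n) :
    ∃ Q : Fin n → ℂ, (∀ i, Q i ≠ 0) ∧ t = diagElt (tauVec Q) := by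
  obtain ⟨g, hg, rfl⟩ := ht
  have hgd : (g : Mat n) = Matrix.diagonal fun i => (g : Mat n) i i := by
    ext i j
    by_cases h : i = j
    · subst h
      simp
    · rw [Matrix.diagonal_apply_ne _ h]
      exact hg i j h
  have hd : ∀ i, (g : Mat n) i i ≠ 0 := by
    have hdet : (g : Mat n).det ≠ 0 := ((Matrix.isUnit_iff_isUnit_det _).1 g.isUnit).ne_zero
    rw [hgd, Matrix.det_diagonal] at hdet
    exact fun i => Finset.prod_ne_zero_iff.1 hdet i (Finset.mem_univ i)
  -- The products of consecutive ratios telescope, so `tauVec Q` is the diagonal of `g` rescaled to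
  -- have last entry `1`.
  set Q : Fin n → ℂ := fun i => (g : Mat n) i.castSucc i.castSucc / (g : Mat n) i.succ i.succ
  have hQ : ∀ i, Q i ≠ 0 := fun i => div_ne_zero (hd _) (hd _)
  have hQt : ∀ i, tauVec Q i = (g : Mat n) i i / (g : Mat n) (Fin.last n) (Fin.last n) := by
    intro i
    have hQn : ∀ k : Fin n, Q k = natEntry (g : Mat n) k k / natEntry (g : Mat n) (k + 1) (k + 1) :=
      fun k => by
        rw [natEntry_of_lt _ (by omega) (by omega), natEntry_of_lt _ (by omega) (by omega)]
        rfl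
    rw [tauVec, Finset.prod_congr rfl fun k _ => hQn k,
      prod_filter_castSucc fun k => natEntry (g : Mat n) k k / natEntry (g : Mat n) (k + 1) (k + 1)]
    have key : ∀ j : ℕ, (i : ℕ) ≤ j → j ≤ n → ∏ k ∈ Finset.Ico (i : ℕ) j,
        natEntry (g : Mat n) k k / natEntry (g : Mat n) (k + 1) (k + 1) =
        natEntry (g : Mat n) i i / natEntry (g : Mat n) j j := by
      intro j hij hj
      induction j, hij using Nat.le_induction with
      | base =>
        rw [Finset.Ico_self, Finset.prod_empty, div_self]
        rw [natEntry_coe]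
        exact hd i
      | succ j hij ih =>
        rw [Finset.prod_Ico_succ_top hij, ih (by omega), div_mul_div_cancel₀]
        rw [natEntry_of_lt _ (by omega) (by omega)]
        exact hd _
    rw [key n (by omega) le_rfl, natEntry_coe]
    congr 1
    exact natEntry_coe _ (Fin.last n) (Fin.last n)
  refine ⟨Q, hQ, ?_⟩
  obtain ⟨h, e⟩ := diagElt_eq (tauVec_ne_zero hQ)
  rw [e, mk_eq_mk_iff_smul]
  have hl := hd (Fin.last n)
  refine ⟨Units.mk0 _ (inv_ne_zero hl), ?_⟩
  ext i j
  rw [coe_glOf, Matrix.smul_apply, Matrix.diagonal_apply, hQt, Units.val_mk0, smul_eq_mul]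
  split_ifs with hij
  · rw [← hij, div_eq_inv_mul]
  · rw [show (g : Mat n) i j = 0 from hg i j hij, mul_zero]

theorem tauVec_div (Q : Fin n → ℂ) (hQ : ∀ i, Q i ≠ 0) (i : Fin n) :
    tauVec Q i.castSucc / tauVec Q i.succ = Q i := by
  have hfilter : (Finset.univ.filter fun l : Fin n => i.castSucc ≤ l.castSucc) =
      insert i (Finset.univ.filter fun l : Fin n => i.succ ≤ l.castSucc) := by
    ext l
    simp only [Finset.mem_filter, Finset.mem_univ, true_and, Finset.mem_insert, Fin.le_def,
      Fin.val_castSucc, Fin.val_succ, Fin.ext_iff]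
    omega
  have h0 := tauVec_ne_zero hQ i.succ
  rw [tauVec] at h0
  rw [tauVec, tauVec, hfilter, Finset.prod_insert (by simp [Fin.le_def]), mul_div_cancel_right₀ _ h0]

/-- The torus acts on `E_{i,i+1}` through a simple root, so `q̃_i` is itself an adjoint coordinate
of `τ`. -/
theorem adCoord_diagElt {Q : Fin n → ℂ} (hQ : ∀ i, Q i ≠ 0) (i : Fin n) :
    adCoord (diagElt (tauVec Q)) ((i.castSucc, i.succ), (i.castSucc, i.succ)) = Q i := by
  have h := det_diagonal_ne_zero (tauVec_ne_zero hQ)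
  have hinv : (Matrix.diagonal (tauVec Q))⁻¹ = Matrix.diagonal fun i => (tauVec Q i)⁻¹ := by
    refine Matrix.inv_eq_right_inv ?_
    rw [Matrix.diagonal_mul_diagonal, ← Matrix.diagonal_one]
    congr 1
    funext i
    exact mul_inv_cancel₀ (tauVec_ne_zero hQ i)
  rw [← pmk_diagonal, adCoord_pmk h, hinv, Matrix.diagonal_apply_eq, Matrix.diagonal_apply_eq,
    ← div_eq_mul_inv, tauVec_div Q hQ]

/-- The normal form of a point of `Z_B`. -/
theorem exists_of_mem_ZB {p : Gv n × Gv n} (hp : p ∈ ZB n) :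
    ∃ (Q : Fin n → ℂ) (u v : SLv n), (∀ i, Q i ≠ 0) ∧ IsUni (u : Mat n) ∧ IsUni (v : Mat n) ∧
      p.1 = diagElt (tauVec Q) ∧ p.2 = cover u * p.1 * (cover (w₀Dot n))⁻¹ * cover v := by
  obtain ⟨ht, -, u, hu, v, hv, h⟩ := hp
  obtain ⟨Q, hQ, e⟩ := exists_diagElt_of_mem_Tv ht
  obtain ⟨u', hu', rfl⟩ := exists_of_mem_Uplus hu
  obtain ⟨v', hv', rfl⟩ := exists_of_mem_Uplus hv
  exact ⟨Q, u', v', hQ, hu', hv', e, h⟩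

/-- The corner minors of `u` for a point `(t, u t ẇ₀⁻¹ v)` of `Z_B`, in terms of the coordinates. -/
theorem cornerMinor_of_ZB {Q : Fin n → ℂ} {u v : SLv n} (hQ : ∀ i, Q i ≠ 0)
    (hu : IsUni (u : Mat n)) (hv : IsUni (v : Mat n))
    (hb : cover u * diagElt (tauVec Q) * (cover (w₀Dot n))⁻¹ * cover v ∈ Bminus n)
    {a b r : ℕ} (h : a + b + r = n + 1) {M : Mat n}
    (hM : M = hatMat (adCoord (cover u * diagElt (tauVec Q) * (cover (w₀Dot n))⁻¹ * cover v))) :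
    baseMinor M b (a + r) ≠ 0 ∧
    chamberMinor M a b r / baseMinor M b (a + r) = cornerMinor (u : Mat n) a b := by
  obtain ⟨h0, h1⟩ := pmk_bruhat (tauVec_ne_zero hQ) u v
  rw [h1] at hb hM
  obtain ⟨z, hz, hhat⟩ := hatMat_pmk h0 hb
  rw [hM, hhat]
  exact chamberMinor_div_baseMinor (tauVec_ne_zero hQ) hu hv hz h

/-- The factorization coordinates of a unipotent matrix in terms of its corner minors. -/
def triOf (m : ℕ → ℕ → ℂ) (a : Tri n) : ℂ :=
  m (a.1.1 - a.1.2 + 1) (a.1.2 + 1) * m (a.1.1 - a.1.2) a.1.2 /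
    (m (a.1.1 - a.1.2) (a.1.2 + 1) * m (a.1.1 - a.1.2 + 1) a.1.2)

theorem triOf_cornerMinor {σ : Arrow n → ℂ} (hσ : σ ∈ Zquiver n) {m : ℕ → ℕ → ℂ}
    (hm : ∀ a b, a + b ≤ n + 1 → m a b = cornerMinor (xc σ : Mat n) a b) :
    triOf m = fun a : Tri n => σ (.inl a) := by
  funext a
  have h1 : (a.1.2 : ℕ) ≤ a.1.1 := a.2
  have h2 : (a.1.1 : ℕ) < n := a.1.1.2
  rw [triOf, hm _ _ (by omega), hm _ _ (by omega), hm _ _ (by omega), hm _ _ (by omega), coe_xc]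
  exact (eq_cornerMinor_ratio (fun a => hσ.1 (.inl a)) a).symm

theorem cornerMinor_xc_ne_zero {σ : Arrow n → ℂ} (hσ : σ ∈ Zquiver n) {a b : ℕ}
    (h : a + b ≤ n + 1) : cornerMinor (xc σ : Mat n) a b ≠ 0 := by
  rw [coe_xc]
  exact cornerMinor_partialMat_ne_zero (fun a => hσ.1 (.inl a)) h

/-- A unipotent matrix with nonzero corner minors is `x_𝐜(σ)` for a point `σ` of each `𝒵_Q`. -/
theorem IsUni.exists_xc {u : SLv n} (hu : IsUni (u : Mat n))
    (h0 : ∀ a b, a + b ≤ n + 1 → cornerMinor (u : Mat n) a b ≠ 0) {Q : Fin n → ℂ}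
    (hQ : ∀ i, Q i ≠ 0) : ∃ σ ∈ Zfiber Q, xc σ = u := by
  obtain ⟨c, hc, e⟩ := hu.exists_tri h0
  refine ⟨pointOf c Q, pointOf_mem hc hQ, ?_⟩
  have : (xc (pointOf c Q) : Mat n) = u := by
    rw [coe_xc, funext (pointOf_inl hc hQ)]
    exact e
  exact Matrix.SpecialLinearGroup.ext _ _ fun i j => congrFun (congrFun this i) j

variable {Y μ : Type*}

theorem pointOf_mem_regularRing {y : Y → μ → ℂ} {R : Set Y} {c : Tri n → R → ℂ}
    {Q : Fin n → R → ℂ} (hc : ∀ a, c a ∈ regularRing y R) (hc0 : ∀ a p, c a p ≠ 0)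
    (hQ : ∀ i, Q i ∈ regularRing y R) (hQ0 : ∀ i p, Q i p ≠ 0) (a : Arrow n) :
    (fun p => pointOf (fun a => c a p) (fun i => Q i p) a) ∈ regularRing y R := by
  have hv : ∀ v : Vertex n, (fun p => vertexExtend (fun i => Q i p)
      (vertexOf (fun a => c a p) fun i => Q i p) v) ∈ regularRing y R := by
    intro v
    simp only [vertexExtend_vertexOf]
    refine div_mem_regularRing (prod_mem_regularRing fun k _ => hQ k)
      (prod_mem_regularRing fun l hl => ?_) fun p => prod_extTri_ne_zero (fun a => hc0 a p) (by omega)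
    rw [Finset.mem_Ico] at hl
    simp only [extTri_of_lt _ hl.1 (show l < n by omega)]
    exact hc _
  exact div_mem_regularRing (hv _) (hv _) fun p =>
    vertexExtend_ne_zero (fun i => hQ0 i p)
      (vertexOf_ne_zero (fun a => hc0 a p) fun i => hQ0 i p) _

theorem restrict_mem_regularRing {y : Y → μ → ℂ} {R S : Set Y} (h : S ⊆ R) {f : R → ℂ}
    (hf : f ∈ regularRing y R) : (fun p : S => f ⟨p, h p.2⟩) ∈ regularRing y S :=
  comp_mem_regularRing (φ := fun p : S => (⟨p, h p.2⟩ : R))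
    (fun l => coord_mem_regularRing y S l) hf

/-- A morphism from a subvariety of `𝒵` is an open embedding if the corner minors of `x_𝐜(σ)` and
`q̃(σ)` can be recovered regularly from the image and the nonvanishing of the former characterizes
the image. -/
theorem isOpenEmbedding_of_minors {y : Y → μ → ℂ} {R : Set Y} {S : Set (Arrow n → ℂ)} (hn : 1 ≤ n)
    (hS : S ⊆ Zquiver n) {φ : (Arrow n → ℂ) → Y} (hφ : IsMorphism arrowCoord S y R φ)
    (m : ℕ → ℕ → R → ℂ) (hm : ∀ a b, a + b ≤ n + 1 → m a b ∈ regularRing y R)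
    (Q : Fin n → R → ℂ) (hQ : ∀ i, Q i ∈ regularRing y R) (hQ0 : ∀ i p, Q i p ≠ 0)
    (hmφ : ∀ σ (hσ : σ ∈ S), ∀ a b, a + b ≤ n + 1 →
      m a b ⟨φ σ, hφ.mapsTo hσ⟩ = cornerMinor (xc σ : Mat n) a b)
    (hQφ : ∀ σ (hσ : σ ∈ S), ∀ i, Q i ⟨φ σ, hφ.mapsTo hσ⟩ = qTilde σ i)
    (hsurj : ∀ p : R, (∀ a b, a + b ≤ n + 1 → m a b p ≠ 0) → (p : Y) ∈ φ '' S) :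
    IsOpenEmbedding arrowCoord S y R φ := by
  have hinv : ∀ σ (hσ : σ ∈ S), pointOf (triOf fun a b => m a b ⟨φ σ, hφ.mapsTo hσ⟩)
      (fun i => Q i ⟨φ σ, hφ.mapsTo hσ⟩) = σ := by
    intro σ hσ
    rw [triOf_cornerMinor (hS hσ) (hmφ σ hσ), funext (hQφ σ hσ), pointOf_eq hn (hS hσ)]
  have hRS : φ '' S ⊆ R := by
    rintro _ ⟨σ, hσ, rfl⟩
    exact hφ.mapsTo hσ
  have hm0 : ∀ p : (φ '' S : Set Y), ∀ a b, a + b ≤ n + 1 → m a b ⟨p, hRS p.2⟩ ≠ 0 := by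
    rintro ⟨_, σ, hσ, rfl⟩ a b h
    rw [hmφ σ hσ a b h]
    exact cornerMinor_xc_ne_zero (hS hσ) h
  refine ⟨hφ, fun σ hσ σ' hσ' h => ?_, ?_, fun k => ⟨fun p => pointOf
    (triOf fun a b => m a b ⟨p, hRS p.2⟩) (fun i => Q i ⟨p, hRS p.2⟩) k, ?_, ?_⟩⟩
  · rw [← hinv σ hσ, ← hinv σ' hσ']
    simp only [h]
  -- The image is the locus where a single function does not vanish, namely the product of all
  -- minors with `a + b ≤ n + 1`, indexed by `x = (n + 1 - b, b)` and `a ≤ n + 1 - b`.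
  · let g : R → ℂ := fun p => ∏ x ∈ Finset.HasAntidiagonal.antidiagonal (n + 1),
      ∏ a ∈ Finset.range (x.1 + 1), m a x.2 p
    have hg : g ∈ regularRing y R := prod_mem_regularRing fun x hx =>
      prod_mem_regularRing fun a ha => by
        rw [Finset.HasAntidiagonal.mem_antidiagonal] at hx
        rw [Finset.mem_range] at ha
        exact hm _ _ (by omega)
    convert isZariskiOpenIn_ne_zero hg using 1
    ext p
    constructor
    · intro hp
      refine ⟨hRS hp, Finset.prod_ne_zero_iff.2 fun x hx => Finset.prod_ne_zero_iff.2 fun a ha => ?_⟩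
      rw [Finset.HasAntidiagonal.mem_antidiagonal] at hx
      rw [Finset.mem_range] at ha
      exact hm0 ⟨p, hp⟩ _ _ (by omega)
    · rintro ⟨hp, hgp⟩
      refine hsurj ⟨p, hp⟩ fun a b hab => ?_
      have h1 := Finset.prod_ne_zero_iff.1 hgp (n + 1 - b, b)
        (by rw [Finset.HasAntidiagonal.mem_antidiagonal]; omega)
      exact Finset.prod_ne_zero_iff.1 h1 a (by rw [Finset.mem_range]; simp only; omega)
  · have hm' : ∀ a b, a + b ≤ n + 1 →
        (fun p : (φ '' S : Set Y) => m a b ⟨p, hRS p.2⟩) ∈ regularRing y (φ '' S) :=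
      fun a b h => restrict_mem_regularRing hRS (hm a b h)
    have hbd : ∀ a : Tri n, (a.1.2 : ℕ) ≤ a.1.1 ∧ (a.1.1 : ℕ) < n := fun a => ⟨a.2, a.1.1.2⟩
    refine pointOf_mem_regularRing (c := fun a (p : (φ '' S : Set Y)) =>
      triOf (fun a b => m a b ⟨p, hRS p.2⟩) a) (fun a => ?_) (fun a p => ?_)
      (fun i => restrict_mem_regularRing hRS (hQ i)) (fun i p => hQ0 i _) k
    · have := hbd a
      exact div_mem_regularRing
        (mul_mem_regularRing (hm' _ _ (by omega)) (hm' _ _ (by omega)))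
        (mul_mem_regularRing (hm' _ _ (by omega)) (hm' _ _ (by omega)))
        fun p => mul_ne_zero (hm0 p _ _ (by omega)) (hm0 p _ _ (by omega))
    · have := hbd a
      exact div_ne_zero (mul_ne_zero (hm0 p _ _ (by omega)) (hm0 p _ _ (by omega)))
        (mul_ne_zero (hm0 p _ _ (by omega)) (hm0 p _ _ (by omega)))
  · rintro ⟨σ, hσ⟩
    exact congrFun (hinv σ hσ) k

end Beta

/-! ### The open embeddings into `Z_B` and into the Richardson variety. -/

section Embeddings

variable {n : ℕ} {X κ : Type*}

theorem coe_list_prod_mem_regularRing {ι : Type*} {x : X → κ → ℂ} {S : Set X} (f : ι → Fin n)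
    {s : ι → S → ℂ} (hs : ∀ a, s a ∈ regularRing x S) (L : List ι) (i j : Fin (n + 1)) :
    (fun p => ((L.map fun a => xRoot (f a) (s a p)).prod : Mat n) i j) ∈ regularRing x S := by
  induction L generalizing i j with
  | nil => exact const_mem_regularRing _ _ _
  | cons a L ih =>
    simp only [List.map_cons, List.prod_cons, Matrix.SpecialLinearGroup.coe_mul]
    refine matrix_mul_mem_regularRing (fun i j => ?_) ih i j
    simp only [coe_xRoot, xMat, Matrix.of_apply]
    refine add_mem (const_mem_regularRing _ _ _) ?_
    split_ifs
    · exact hs a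
    · exact const_mem_regularRing _ _ _

theorem xc_mem_regularRing (S : Set (Arrow n → ℂ)) (i j : Fin (n + 1)) :
    (fun σ : S => (xc (σ : Arrow n → ℂ) : Mat n) i j) ∈ regularRing arrowCoord S :=
  coe_list_prod_mem_regularRing (fun a : Tri n => a.1.1)
    (s := fun a (σ : S) => (σ : Arrow n → ℂ) (.inl a))
    (fun _ => coord_mem_regularRing arrowCoord S _) (cOrder n) i j

theorem xd_neg_mem_regularRing (S : Set (Arrow n → ℂ)) (i j : Fin (n + 1)) :
    (fun σ : S => (xd (-(σ : Arrow n → ℂ)) : Mat n) i j) ∈ regularRing arrowCoord S :=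
  coe_list_prod_mem_regularRing (fun a : Tri n => a.1.2.rev)
    (s := fun a (σ : S) => -(σ : Arrow n → ℂ) (.inr a))
    (fun _ => neg_mem (coord_mem_regularRing arrowCoord S _)) (dOrder n) i j

theorem adCoord_pmk_mem_regularRing {x : X → κ → ℂ} {S : Set X} {M : S → Mat n}
    (hM : ∀ i j, (fun p => M p i j) ∈ regularRing x S) (h0 : ∀ p, (M p).det ≠ 0)
    (k : (Fin (n + 1) × Fin (n + 1)) × (Fin (n + 1) × Fin (n + 1))) :
    (fun p => adCoord (pmk (M p)) k) ∈ regularRing x S := by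
  obtain ⟨⟨i, l⟩, k, m⟩ := k
  simp only [adCoord_pmk (h0 _), Matrix.inv_def, Ring.inverse_eq_inv', Matrix.smul_apply,
    smul_eq_mul]
  exact mul_mem_regularRing (hM k i) (mul_mem_regularRing
    (inv_mem_regularRing (det_mem_regularRing hM) h0) (matrix_adjugate_mem_regularRing hM l m))

theorem tauVec_mem_regularRing {S : Set (Arrow n → ℂ)} (i : Fin (n + 1)) :
    (fun σ : S => tauVec (qTilde (σ : Arrow n → ℂ)) i) ∈ regularRing arrowCoord S :=
  prod_mem_regularRing fun _ _ => mul_mem_regularRing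
    (coord_mem_regularRing arrowCoord S _) (coord_mem_regularRing arrowCoord S _)

theorem diagonal_mem_regularRing {S : Set (Arrow n → ℂ)} (i j : Fin (n + 1)) :
    (fun σ : S => Matrix.diagonal (tauVec (qTilde (σ : Arrow n → ℂ))) i j) ∈
      regularRing arrowCoord S := by
  simp only [Matrix.diagonal_apply]
  split_ifs
  · exact tauVec_mem_regularRing i
  · exact const_mem_regularRing _ _ _

theorem isMorphism_tau_beta :
    IsMorphism arrowCoord (Zquiver n) pairCoord (ZB n) (fun σ => (tau σ, beta σ)) := by
  refine ⟨fun σ hσ => tau_beta_mem_ZB hσ, fun l => ?_⟩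
  change (fun σ : Zquiver n => pairCoord (tau (σ : Arrow n → ℂ), beta (σ : Arrow n → ℂ)) l) ∈
    regularRing arrowCoord (Zquiver n)
  rcases l with l | l
  · exact adCoord_pmk_mem_regularRing (M := fun σ : Zquiver n =>
      Matrix.diagonal (tauVec (qTilde (σ : Arrow n → ℂ)))) diagonal_mem_regularRing
      (fun σ => det_diagonal_ne_zero (tauVec_ne_zero (qTilde_ne_zero σ.2))) l
  · have h := fun σ : Zquiver n => pmk_bruhat (tauVec_ne_zero (qTilde_ne_zero σ.2))
      (xc (σ : Arrow n → ℂ)) ((xd (-(σ : Arrow n → ℂ)))⁻¹)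
    have e : ∀ σ : Zquiver n, pairCoord (tau (σ : Arrow n → ℂ), beta (σ : Arrow n → ℂ)) (.inr l) =
        adCoord (pmk ((xc (σ : Arrow n → ℂ) : Mat n) *
          Matrix.diagonal (tauVec (qTilde (σ : Arrow n → ℂ))) * antiMat n *
          (((xd (-(σ : Arrow n → ℂ)))⁻¹ : SLv n) : Mat n))) l := by
      intro σ
      rw [← (h σ).2, ← beta_eq]
      rfl
    simp only [e]
    have h1 : ∀ i j, (fun σ : Zquiver n => (((xd (-(σ : Arrow n → ℂ)))⁻¹ : SLv n) : Mat n) i j) ∈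
        regularRing arrowCoord (Zquiver n) := by
      simp only [Matrix.SpecialLinearGroup.coe_inv]
      exact matrix_adjugate_mem_regularRing (xd_neg_mem_regularRing _)
    have h2 := matrix_mul_mem_regularRing (xc_mem_regularRing (Zquiver n)) diagonal_mem_regularRing
    have h3 := matrix_mul_mem_regularRing (N := fun _ => antiMat n) h2
      fun i j => const_mem_regularRing _ _ _
    exact adCoord_pmk_mem_regularRing (matrix_mul_mem_regularRing h3 h1) (fun σ => (h σ).1) l

theorem natEntry_mem_regularRing {x : X → κ → ℂ} {S : Set X} {M : S → Mat n}
    (hM : ∀ i j, (fun p => M p i j) ∈ regularRing x S) (i j : ℕ) :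
    (fun p => natEntry (M p) i j) ∈ regularRing x S := by
  simp only [natEntry]
  split_ifs
  · exact hM _ _
  · exact const_mem_regularRing _ _ _

theorem cornerMinor_mem_regularRing {x : X → κ → ℂ} {S : Set X} {M : S → Mat n}
    (hM : ∀ i j, (fun p => M p i j) ∈ regularRing x S) (a b : ℕ) :
    (fun p => cornerMinor (M p) a b) ∈ regularRing x S :=
  det_mem_regularRing fun _ _ => natEntry_mem_regularRing hM _ _

theorem hatMat_mem_regularRing (S : Set (Gv n × Gv n)) (i j : Fin (n + 1)) :
    (fun p : S => hatMat (adCoord (p : Gv n × Gv n).2) i j) ∈ regularRing pairCoord S :=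
  coord_mem_regularRing pairCoord S (.inr _)

theorem isOpenEmbedding_tau_beta (hn : 1 ≤ n) :
    IsOpenEmbedding arrowCoord (Zquiver n) pairCoord (ZB n) (fun σ => (tau σ, beta σ)) := by
  have hbase : ∀ (p : ZB n) (a b r : ℕ), a + b + r = n + 1 →
      baseMinor (hatMat (adCoord (p : Gv n × Gv n).2)) b (a + r) ≠ 0 := by
    rintro ⟨⟨t, g⟩, hp⟩ a b r h
    obtain ⟨Q, u, v, hQ, hu, hv, ht, hg⟩ := exists_of_mem_ZB hp
    have hB := hp.2.1
    simp only at ht hg hB ⊢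
    rw [hg, ht] at hB
    exact (cornerMinor_of_ZB hQ hu hv hB h (by rw [hg, ht])).1
  refine isOpenEmbedding_of_minors hn subset_rfl isMorphism_tau_beta
    (fun a b p => chamberMinor (hatMat (adCoord (p : Gv n × Gv n).2)) a b (n + 1 - (a + b)) /
      baseMinor (hatMat (adCoord (p : Gv n × Gv n).2)) b (a + (n + 1 - (a + b))))
    (fun a b h => ?_)
    (fun i p => adCoord (p : Gv n × Gv n).1 ((i.castSucc, i.succ), (i.castSucc, i.succ)))
    (fun i => coord_mem_regularRing pairCoord (ZB n) (.inl _)) ?_ ?_ ?_ ?_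
  · exact div_mem_regularRing
      (det_mem_regularRing fun _ _ => natEntry_mem_regularRing (hatMat_mem_regularRing _) _ _)
      (det_mem_regularRing fun _ _ => natEntry_mem_regularRing (hatMat_mem_regularRing _) _ _)
      fun p => hbase p _ _ _ (by omega)
  · rintro i ⟨p, hp⟩
    obtain ⟨Q, u, v, hQ, hu, hv, ht, hg⟩ := exists_of_mem_ZB hp
    simp only
    rw [ht, adCoord_diagElt hQ]
    exact hQ i
  · intro σ hσ a b h
    have hB := beta_mem_Bminus hσ
    rw [beta_eq] at hB
    exact (cornerMinor_of_ZB (qTilde_ne_zero hσ) (isUni_xc σ) (isUni_inv_xd (-σ)) hB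
      (show a + b + (n + 1 - (a + b)) = n + 1 by omega)
      (congrArg (fun g => hatMat (adCoord g)) (beta_eq σ))).2
  · intro σ hσ i
    exact adCoord_diagElt (qTilde_ne_zero hσ) i
  · rintro ⟨⟨t, g⟩, hp⟩ h0
    obtain ⟨Q, u, v, hQ, hu, hv, ht, hg⟩ := exists_of_mem_ZB hp
    have hB := hp.2.1
    simp only at ht hg hB h0 ⊢
    subst ht
    have hB' := hB
    rw [hg] at hB'
    have h0' : ∀ a b, a + b ≤ n + 1 → cornerMinor (u : Mat n) a b ≠ 0 := fun a b h => by
      rw [← (cornerMinor_of_ZB hQ hu hv hB'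
        (show a + b + (n + 1 - (a + b)) = n + 1 by omega) rfl).2, ← hg]
      exact h0 a b h
    obtain ⟨σ, ⟨hσ, hσQ⟩, hσu⟩ := hu.exists_xc h0' hQ
    refine ⟨σ, hσ, Prod.ext ?_ ?_⟩
    · change diagElt (tauVec (qTilde σ)) = _
      rw [hσQ]
    -- Both `β(σ)` and `g` lie in `B_-` and have the same left part `u t ẇ₀⁻¹`. Their quotient lies
    -- in `U_+ ∩ B_-` and is therefore trivial, so the right unipotent factor is determined.
    · have h1 := mul_mem (inv_mem (beta_mem_Bminus hσ)) hB
      have h2 : (beta σ)⁻¹ * g = cover (xd (-σ) * v) := by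
        rw [beta_eq, hg, hσQ, hσu, map_mul, map_inv]
        group
      rw [h2] at h1
      have h3 := IsUni.eq_one_of_cover_mem
        (by rw [Matrix.SpecialLinearGroup.coe_mul]; exact (isUni_xd _).mul hv) h1
      rw [h3, map_one, inv_mul_eq_one] at h2
      exact h2

theorem antiMat_mul_mul_w₀Dot_apply (U : Mat n) (i j : Fin (n + 1)) :
    (antiMat n * U * (w₀Dot n : Mat n)) i j =
      (-1) ^ (n - i : ℕ) * (U i.rev j.rev * (-1) ^ (n - j : ℕ)) := by
  have hi := i.2
  have hj := j.2
  rw [mul_assoc, Matrix.mul_apply, Finset.sum_eq_single i.rev, Matrix.mul_apply,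
    Finset.sum_eq_single j.rev, antiMat, Matrix.of_apply, if_pos, coe_w₀Dot_apply, if_pos]
  · simp only [Fin.val_rev]
    rw [show n + 1 - ((i : ℕ) + 1) = n - i by omega, show n + 1 - ((j : ℕ) + 1) = n - j by omega]
  · simp only [Fin.val_rev]
    omega
  · simp only [Fin.val_rev]
    omega
  · intro b _ hb
    rw [coe_w₀Dot_apply, if_neg, mul_zero]
    intro h
    apply hb
    ext
    simp only [Fin.val_rev]
    omega
  · simp
  · intro b _ hb
    rw [antiMat, Matrix.of_apply, if_neg, zero_mul]
    intro h
    apply hb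
    ext
    simp only [Fin.val_rev]
    omega
  · simp

theorem w₀Dot_conj_mem_Bminus {u : SLv n} (hu : IsUni (u : Mat n)) :
    cover ((w₀Dot n)⁻¹ * u * w₀Dot n) ∈ Bminus n := by
  rw [cover_mem_Bminus_iff]
  intro i j hij
  rw [Matrix.SpecialLinearGroup.coe_mul, Matrix.SpecialLinearGroup.coe_mul, coe_w₀Dot_inv,
    antiMat_mul_mul_w₀Dot_apply, hu _ _ (Fin.rev_le_rev.2 hij.le), if_neg, zero_mul, mul_zero]
  intro h
  exact hij.ne (Fin.rev_injective h)

theorem diagElt_mem_Bminus {d : Fin (n + 1) → ℂ} (hd : ∀ i, d i ≠ 0) : diagElt d ∈ Bminus n := by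
  rw [← pmk_diagonal, pmk_mem_Bminus_iff (det_diagonal_ne_zero hd)]
  intro i j hij
  exact Matrix.diagonal_apply_ne _ hij.ne

/-- Solving the definition of `β` for `x_𝐜` gives `x_𝐜 = β ẇ₀ (ẇ₀⁻¹ x_𝐝(-σ) ẇ₀) τ⁻¹`, and all
factors other than `ẇ₀` lie in `B_-`. -/
theorem gammaMap_mem_Rich {σ : Arrow n → ℂ} (hσ : σ ∈ Zquiver n) : gammaMap σ ∈ Rich n := by
  refine ⟨cover (xc σ), ⟨⟨cover (xc σ), ?_, 1, one_mem _, (mul_one _).symm⟩, beta σ,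
    beta_mem_Bminus hσ, cover ((w₀Dot n)⁻¹ * xd (-σ) * w₀Dot n) * (diagElt (tauVec (qTilde σ)))⁻¹,
    mul_mem (w₀Dot_conj_mem_Bminus (isUni_xd _))
      (inv_mem (diagElt_mem_Bminus (tauVec_ne_zero (qTilde_ne_zero hσ)))), ?_⟩, rfl⟩
  · refine ⟨Matrix.SpecialLinearGroup.toGL (xc σ), fun i j hij => ?_, rfl⟩
    have := isUni_xc σ i j hij.le
    rw [if_neg hij.ne'] at this
    exact this
  · rw [beta_eq, map_mul, map_mul, map_inv, map_inv]
    group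

theorem isMorphism_gammaMap {S : Set (Arrow n → ℂ)} {R : Set (Flag n)}
    (h : Set.MapsTo gammaMap S R) : IsMorphism arrowCoord S bigCellCoord R gammaMap := by
  refine ⟨h, fun l => ?_⟩
  change (fun σ : S => bigCellCoord (gammaMap (σ : Arrow n → ℂ)) l) ∈ regularRing arrowCoord S
  simp only [bigCellCoord_gammaMap]
  exact xc_mem_regularRing S _ _

theorem unip_mem_regularRing (R : Set (Flag n)) (i j : Fin (n + 1)) :
    (fun p : R => (unip (bigCellCoord (p : Flag n)) : Mat n) i j) ∈ regularRing bigCellCoord R := by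
  by_cases h : i < j
  · have : ∀ p : R, (unip (bigCellCoord (p : Flag n)) : Mat n) i j =
        bigCellCoord (p : Flag n) ⟨(i, j), h⟩ := fun p => unip_apply _ ⟨(i, j), h⟩
    simp only [this]
    exact coord_mem_regularRing _ _ _
  · simp only [isUni_unip _ i j (not_lt.1 h)]
    exact const_mem_regularRing _ _ _

theorem bigCell_bigCellCoord {p : Flag n} (hp : p ∈ Set.range (bigCell (n := n))) :
    bigCell (bigCellCoord p) = p := by
  obtain ⟨u, rfl⟩ := hp
  rw [bigCellCoord_bigCell]

theorem isOpenEmbedding_gammaMap (hn : 1 ≤ n) {Q : Fin n → ℂ} (hQ : ∀ i, Q i ≠ 0) :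
    IsOpenEmbedding arrowCoord (Zfiber Q) bigCellCoord (Rich n) gammaMap := by
  refine isOpenEmbedding_of_minors hn (fun σ hσ => hσ.1)
    (isMorphism_gammaMap fun σ hσ => gammaMap_mem_Rich hσ.1)
    (fun a b p => cornerMinor (unip (bigCellCoord (p : Flag n)) : Mat n) a b)
    (fun a b _ => cornerMinor_mem_regularRing (unip_mem_regularRing _) a b)
    (fun i _ => Q i) (fun i => const_mem_regularRing _ _ _) (fun i _ => hQ i) ?_ ?_ ?_
  · intro σ hσ a b _
    simp only [unip_bigCellCoord_gammaMap]
  · intro σ hσ i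
    exact (congrFun hσ.2 i).symm
  · rintro ⟨p, hp⟩ h0
    obtain ⟨σ, hσ, hσu⟩ := (isUni_unip _).exists_xc h0 hQ
    refine ⟨σ, hσ, ?_⟩
    rw [gammaMap, hσu]
    exact bigCell_bigCellCoord (Rich_subset hp)

end Embeddings

/-! ### The Peterson condition in terms of the Lax matrix, and the bijection on points. -/

section Peterson

variable {n : ℕ}

theorem Ad_cover (u : SLv n) (X : Mat n) :
    Ad (cover u) X = (u : Mat n) * X * ((u⁻¹ : SLv n) : Mat n) := by
  rw [cover_eq_mk, Ad, Matrix.ProjGenLinGroup.lift_mk]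
  change (u : Mat n) * X * (((Matrix.SpecialLinearGroup.toGL u)⁻¹ :
    Matrix.GeneralLinearGroup (Fin (n + 1)) ℂ) : Mat n) = _
  rw [← map_inv]
  rfl

theorem Ad_mk (g : Matrix.GeneralLinearGroup (Fin (n + 1)) ℂ) (X : Mat n) :
    Ad (Matrix.ProjGenLinGroup.mk g) X =
      (g : Mat n) * X * ((g⁻¹ : Matrix.GeneralLinearGroup (Fin (n + 1)) ℂ) : Mat n) := by
  rw [Ad, Matrix.ProjGenLinGroup.lift_mk]
  rfl

theorem Ffun_eq_trace (X : Mat n) : Ffun X = (lowNil ℂ n * X).trace := by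
  rw [Ffun, Matrix.trace, Fin.sum_univ_succ]
  simp only [Matrix.diag_apply, Matrix.mul_apply, lowNil, Matrix.of_apply]
  refine (zero_add _).symm.trans (congrArg₂ (· + ·)
    (Finset.sum_eq_zero fun b _ => by simp).symm (Finset.sum_congr rfl fun i _ => ?_))
  rw [Finset.sum_eq_single i.castSucc]
  · simp
  · intro b _ hb
    rw [if_neg, zero_mul]
    intro h
    apply hb
    ext
    simp at h ⊢
    omega
  · simp

/-- The matrix `u⁻¹ f u`. -/
def laxOf (u : SLv n) : Mat n := ((u⁻¹ : SLv n) : Mat n) * lowNil ℂ n * (u : Mat n)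

/-- Since `F(X) = tr(f X)`, the functional moved by `u⁻¹` is the trace pairing with `u⁻¹ f u`. -/
theorem Ffun_Ad (u : SLv n) (X : Mat n) :
    Ffun (Ad (cover u) X) = ∑ i, ∑ j, laxOf u i j * X j i := by
  rw [Ad_cover, Ffun_eq_trace, ← mul_assoc, Matrix.trace_mul_comm, ← mul_assoc, ← mul_assoc]
  rfl

theorem laxOf_xc (σ : Arrow n → ℂ) : laxOf (xc σ) = laxMat n (vertArrow σ) := by
  have h : (((xc σ)⁻¹ : SLv n) : Mat n) = psiMat n (vertArrow σ) := by
    have h1 : (((xc σ)⁻¹ : SLv n) : Mat n) * (xc σ : Mat n) = 1 := by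
      rw [← Matrix.SpecialLinearGroup.coe_mul, inv_mul_cancel, Matrix.SpecialLinearGroup.coe_one]
    calc (((xc σ)⁻¹ : SLv n) : Mat n)
        = ((xc σ)⁻¹ : SLv n) * (partialMat n (vertArrow σ) n * psiMat n (vertArrow σ)) := by
          rw [partialMat_mul_psiMat, mul_one]
      _ = (((xc σ)⁻¹ : SLv n) * (xc σ : Mat n)) * psiMat n (vertArrow σ) := by
          rw [coe_xc, mul_assoc]
          rfl
      _ = _ := by rw [h1, one_mul]
  rw [laxOf, h, coe_xc]
  rfl

theorem InUminus.mul_apply {X X' : Mat n} (h : InUminus X) (h' : InUminus X') {i j : Fin (n + 1)}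
    (hij : (i : ℕ) < j + 2) : (X * X') i j = 0 := by
  rw [Matrix.mul_apply]
  refine Finset.sum_eq_zero fun k _ => ?_
  rcases le_or_gt i k with hk | hk
  · rw [h i k hk, zero_mul]
  · have : k ≤ j := by
      have : (k : ℕ) < i := hk
      change (k : ℕ) ≤ j
      omega
    rw [h' k j this, mul_zero]

theorem InUminus.lie_apply {X X' : Mat n} (h : InUminus X) (h' : InUminus X') {i j : Fin (n + 1)}
    (hij : (i : ℕ) < j + 2) : ⁅X, X'⁆ i j = 0 := by
  rw [Ring.lie_def, Matrix.sub_apply, h.mul_apply h' hij, h'.mul_apply h hij, sub_zero]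

theorem inUminus_single {i j : Fin (n + 1)} (h : j < i) : InUminus (Matrix.single i j (1 : ℂ)) := by
  intro a b hab
  rw [Matrix.single_apply, if_neg]
  rintro ⟨rfl, rfl⟩
  exact hab.not_gt h

/-- Use `E_{ij} = [E_{i,i-1}, E_{i-1,j}]`. So the derived algebra sees every entry at distance at
least two from the diagonal. -/
theorem exists_lie_eq_single {i j : Fin (n + 1)} (h : (j : ℕ) + 2 ≤ i) :
    ∃ X X' : Mat n, InUminus X ∧ InUminus X' ∧ ⁅X, X'⁆ = Matrix.single i j 1 := by
  have hi := i.2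
  let k : Fin (n + 1) := ⟨i - 1, by omega⟩
  have hki : k < i := by
    change (i : ℕ) - 1 < i
    omega
  have hjk : j < k := by
    change (j : ℕ) < i - 1
    omega
  refine ⟨Matrix.single i k 1, Matrix.single k j 1, inUminus_single hki, inUminus_single hjk, ?_⟩
  rw [Ring.lie_def, Matrix.single_mul_single_same, Matrix.single_mul_single_of_ne _ _ _ _
    (hjk.trans hki).ne, sub_zero, one_mul]

theorem Ffun_Ad_single (u : SLv n) (i j : Fin (n + 1)) :
    Ffun (Ad (cover u) (Matrix.single j i 1)) = laxOf u i j := by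
  rw [Ffun_Ad, Finset.sum_eq_single i, Finset.sum_eq_single j]
  · simp
  · intro b _ hb
    rw [Matrix.single_apply_of_row_ne hb.symm, mul_zero]
  · simp
  · intro b _ hb
    refine Finset.sum_eq_zero fun a _ => ?_
    rw [Matrix.single_apply_of_col_ne _ _ hb.symm, mul_zero]
  · simp

theorem Ad_mem_InUminus {b : Gv n} (hb : b ∈ Bminus n) {X : Mat n} (hX : InUminus X) :
    InUminus (Ad b X) := by
  obtain ⟨g, rfl⟩ := Matrix.ProjGenLinGroup.mk_surjective b
  have hg := mk_mem_Bminus_iff.1 hb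
  have hg' := mk_mem_Bminus_iff.1 (show Matrix.ProjGenLinGroup.mk g⁻¹ ∈ Bminus n by
    rw [map_inv]
    exact inv_mem hb)
  rw [Ad_mk]
  intro i j hij
  rw [Matrix.mul_apply]
  refine Finset.sum_eq_zero fun k _ => ?_
  rcases lt_or_ge k j with hk | hk
  · rw [hg' k j hk, mul_zero]
  · rw [Matrix.mul_apply, Finset.sum_eq_zero, zero_mul]
    intro l _
    rcases lt_or_ge i l with hl | hl
    · rw [hg i l hl, zero_mul]
    · rw [hX l k (hl.trans (hij.trans hk)), mul_zero]

theorem Ad_lie (g : Gv n) (X X' : Mat n) : Ad g ⁅X, X'⁆ = ⁅Ad g X, Ad g X'⁆ := by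
  obtain ⟨g, rfl⟩ := Matrix.ProjGenLinGroup.mk_surjective g
  have h : ∀ Y Y' : Mat n, (g : Mat n) * Y * ((g⁻¹ : Matrix.GeneralLinearGroup (Fin (n + 1)) ℂ) :
      Mat n) * ((g : Mat n) * Y' * ((g⁻¹ : Matrix.GeneralLinearGroup (Fin (n + 1)) ℂ) : Mat n)) =
      (g : Mat n) * (Y * Y') * ((g⁻¹ : Matrix.GeneralLinearGroup (Fin (n + 1)) ℂ) : Mat n) := by
    intro Y Y'
    have h1 : ((g⁻¹ : Matrix.GeneralLinearGroup (Fin (n + 1)) ℂ) : Mat n) * (g : Mat n) = 1 := by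
      rw [← Units.val_mul, inv_mul_cancel, Units.val_one]
    calc _ = (g : Mat n) * Y * (((g⁻¹ : Matrix.GeneralLinearGroup (Fin (n + 1)) ℂ) : Mat n) *
        (g : Mat n)) * Y' * ((g⁻¹ : Matrix.GeneralLinearGroup (Fin (n + 1)) ℂ) : Mat n) := by
          simp only [mul_assoc]
      _ = _ := by rw [h1, mul_one, mul_assoc (g : Mat n)]
  rw [Ad_mk, Ad_mk, Ad_mk, Ring.lie_def, Ring.lie_def, h, h, mul_sub, sub_mul]

theorem mem_Peterson_iff (u : SLv n) : (QuotientGroup.mk (cover u) : Flag n) ∈ Peterson n ↔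
    ∀ i j : Fin (n + 1), (i : ℕ) + 2 ≤ j → laxOf u i j = 0 := by
  constructor
  · intro h i j hij
    obtain ⟨X, X', hX, hX', e⟩ := exists_lie_eq_single hij
    rw [← Ffun_Ad_single, ← e]
    exact h _ rfl X X' hX hX'
  · intro h g hg X X' hX hX'
    have hb : (cover u)⁻¹ * g ∈ Bminus n := QuotientGroup.eq.1 hg.symm
    -- Another representative differs by an element of `B_-`, whose adjoint action preserves `𝔲_-`
    -- and brackets; the condition may thus be tested on `u`.
    have e : Ad g ⁅X, X'⁆ = Ad (cover u) ⁅Ad ((cover u)⁻¹ * g) X, Ad ((cover u)⁻¹ * g) X'⁆ := by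
      rw [← Ad_lie, ← Module.End.mul_apply, ← map_mul, mul_inv_cancel_left]
    rw [e, Ffun_Ad]
    refine Finset.sum_eq_zero fun i _ => Finset.sum_eq_zero fun j _ => ?_
    by_cases hij : (i : ℕ) + 2 ≤ j
    · rw [h i j hij, zero_mul]
    · rw [(Ad_mem_InUminus hb hX).lie_apply (Ad_mem_InUminus hb hX') (by omega), mul_zero]

theorem laxOf_mem_regularRing (S : Set (Flag n)) (i j : Fin (n + 1)) :
    (fun p : S => laxOf (unip (bigCellCoord (p : Flag n))) i j) ∈ regularRing bigCellCoord S := by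
  have h1 : ∀ i j, (fun p : S => (((unip (bigCellCoord (p : Flag n)))⁻¹ : SLv n) : Mat n) i j) ∈
      regularRing bigCellCoord S := by
    simp only [Matrix.SpecialLinearGroup.coe_inv]
    exact matrix_adjugate_mem_regularRing (unip_mem_regularRing S)
  have h2 := matrix_mul_mem_regularRing (N := fun _ => lowNil ℂ n) h1
    fun i j => const_mem_regularRing _ _ _
  exact matrix_mul_mem_regularRing h2 (unip_mem_regularRing S) i j

/-- The entries of `u⁻¹ f u` as regular functions. -/
def laxFun (S : Set (Flag n)) (i j : Fin (n + 1)) : regularRing (bigCellCoord (n := n)) S :=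
  ⟨_, laxOf_mem_regularRing S i j⟩

theorem petersonIdeal_eq (S : Set (Flag n)) : petersonIdeal S =
    Ideal.span {f | ∃ i j : Fin (n + 1), (i : ℕ) + 2 ≤ j ∧ f = laxFun S i j} := by
  refine le_antisymm (Ideal.span_le.2 ?_) (Ideal.span_le.2 ?_)
  · rintro f ⟨X, X', hX, hX', hf⟩
    have e : f = ∑ i, ∑ j, algebraMap ℂ (regularRing (bigCellCoord (n := n)) S) (⁅X, X'⁆ j i) *
        laxFun S i j := by
      refine Subtype.ext (funext fun p => ?_)
      change (f : S → ℂ) p = evalAt bigCellCoord S p (∑ i, ∑ j,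
        algebraMap ℂ (regularRing (bigCellCoord (n := n)) S) (⁅X, X'⁆ j i) * laxFun S i j)
      simp only [map_sum, map_mul]
      rw [hf p, Ffun_Ad]
      exact Finset.sum_congr rfl fun i _ => Finset.sum_congr rfl fun j _ => mul_comm _ _
    rw [e]
    refine sum_mem fun i _ => sum_mem fun j _ => ?_
    by_cases hij : (i : ℕ) + 2 ≤ j
    · exact Ideal.mul_mem_left _ _ (Ideal.subset_span ⟨i, j, hij, rfl⟩)
    · rw [hX.lie_apply hX' (by omega), map_zero, zero_mul]
      exact zero_mem _
  · rintro _ ⟨i, j, hij, rfl⟩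
    obtain ⟨X, X', hX, hX', e⟩ := exists_lie_eq_single hij
    refine Ideal.subset_span ⟨X, X', hX, hX', fun p => ?_⟩
    rw [e, Ffun_Ad_single]
    rfl

/-! ### The open Deodhar stratum -/

theorem nodup_cOrder : (cOrder n).Nodup := by
  rw [cOrder, List.nodup_flatMap]
  refine ⟨fun k _ => ?_, ?_⟩
  · refine (List.nodup_reverse.2 (List.nodup_finRange n)).filterMap fun a a' b hb hb' => ?_
    simp only [Option.mem_def, Option.dite_none_right_eq_some, Option.some.injEq] at hb hb'
    obtain ⟨_, rfl⟩ := hb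
    obtain ⟨_, h⟩ := hb'
    exact (congrArg (fun x : Tri n => x.1.1) h).symm
  · refine (List.nodup_finRange n).imp fun {k k'} hkk' => ?_
    intro a ha ha'
    simp only [List.mem_filterMap, Option.dite_none_right_eq_some, Option.some.injEq] at ha ha'
    obtain ⟨j, -, _, rfl⟩ := ha
    obtain ⟨j', -, _, h⟩ := ha'
    exact hkk' (congrArg (fun x : Tri n => x.1.2) h).symm

theorem mem_cOrder (a : Tri n) : a ∈ cOrder n := by
  rw [cOrder, List.mem_flatMap]
  refine ⟨a.1.2, List.mem_finRange _, ?_⟩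
  rw [List.mem_filterMap]
  exact ⟨a.1.1, List.mem_reverse.2 (List.mem_finRange _), dif_pos a.2⟩

/-- The labels in `A` are distinct although the letters `f a` repeat, so the parameters of a word
can be regarded as a function of the labels. -/
theorem exists_map_eq {α β : Type*} [DecidableEq α] (f : α → β) {A : List α} (hA : A.Nodup)
    {L : List (β × ℂ)} (hL : L.map Prod.fst = A.map f) (h0 : ∀ a ∈ L, a.2 ≠ 0) :
    ∃ c : α → ℂ, (∀ a, c a ≠ 0) ∧ L = A.map fun a => (f a, c a) := by
  induction A generalizing L with
  | nil =>
    refine ⟨fun _ => 1, fun _ => one_ne_zero, ?_⟩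
    simpa using hL
  | cons a A ih =>
    rcases L with _ | ⟨⟨b, t⟩, L⟩
    · simp at hL
    · simp only [List.map_cons, List.cons.injEq] at hL
      obtain ⟨rfl, hL⟩ := hL
      rw [List.nodup_cons] at hA
      obtain ⟨c, hc, rfl⟩ := ih hA.2 hL fun a ha => h0 a (List.mem_cons_of_mem _ ha)
      refine ⟨Function.update c a t, fun a' => ?_, ?_⟩
      · by_cases h : a' = a
        · subst h
          rw [Function.update_self]
          exact h0 _ List.mem_cons_self
        · rw [Function.update_of_ne h]
          exact hc a'
      · rw [List.map_cons, Function.update_self]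
        congr 1
        refine List.map_congr_left fun a' ha' => ?_
        rw [Function.update_of_ne]
        rintro rfl
        exact hA.1 ha'

theorem gammaMap_eq_stratumPoint (σ : Arrow n → ℂ) :
    gammaMap σ = stratumPoint ((cOrder n).map fun a => (a.1.1, σ (.inl a))) := by
  rw [gammaMap, stratumPoint, xc, List.map_map]
  rfl

theorem gammaMap_mem_openStratum {σ : Arrow n → ℂ} (hσ : σ ∈ Zquiver n) :
    gammaMap σ ∈ openStratum (word₀ n) := by
  refine ⟨_, ?_, ?_, gammaMap_eq_stratumPoint σ⟩
  · rw [List.map_map]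
    rfl
  · intro a ha
    rw [List.mem_map] at ha
    obtain ⟨b, -, rfl⟩ := ha
    exact hσ.1 _

theorem exists_of_mem_openStratum {p : Flag n} (hp : p ∈ openStratum (word₀ n)) :
    ∃ c : Tri n → ℂ, (∀ a, c a ≠ 0) ∧
      ∀ σ : Arrow n → ℂ, (∀ a, σ (.inl a) = c a) → gammaMap σ = p := by
  obtain ⟨L, hL, h0, rfl⟩ := hp
  obtain ⟨c, hc, rfl⟩ := exists_map_eq (fun a : Tri n => a.1.1) nodup_cOrder hL h0
  refine ⟨c, hc, fun σ hσ => ?_⟩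
  rw [gammaMap_eq_stratumPoint]
  simp only [hσ]

/-! ### Critical points -/

theorem fiberDifferential_eq_zero_iff (hn : 1 ≤ n) {σ : Arrow n → ℂ} (hσ : σ ∈ Zquiver n) :
    fiberDifferential σ = 0 ↔ ∀ m l, m < n → l ≤ m →
      vertexEq (vertArrow σ) (outArrow (horArrow σ)) m l = 0 := by
  constructor
  · intro h m l hm hl
    let v : Below n := ⟨(⟨m + 1, by omega⟩, ⟨l, by omega⟩), show l < m + 1 by omega⟩
    have h1 := fiberDifferential_single_eq hn hσ v
    rw [h, zero_apply, eq_comm, div_eq_zero_iff] at h1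
    rcases h1 with h1 | h1
    · exact h1
    · rw [vertexCoord_eq hn] at h1
      exact absurd h1 (vertexVar_ne_zero hσ v.2.le)
  · intro h
    have h1 : ∀ v : Below n, fiberDifferential σ (Pi.single v 1) = 0 := by
      intro v
      have hv : (v.1.2 : ℕ) < v.1.1 := v.2
      rw [fiberDifferential_single_eq hn hσ, h _ _ (by omega) (by omega), zero_div]
    ext x
    rw [← Finset.univ_sum_single x, map_sum]
    refine Finset.sum_eq_zero fun v _ => ?_
    have h2 : (Pi.single v (x v) : Below n → ℂ) = x v • Pi.single v 1 := by
      ext w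
      simp [Pi.single_apply]
    rw [h2, map_smul, h1, smul_zero]

theorem outArrow_zero {K : Type*} [Zero K] (d : ℕ → ℕ → K) (m : ℕ) : outArrow d m 0 = 0 := by
  cases m <;> rfl

theorem vertArrow_top (σ : Arrow n → ℂ) (l : ℕ) : vertArrow σ n l = 0 :=
  extTri_of_not _ (by omega)

theorem box_outArrow {σ : Arrow n → ℂ} (hσ : σ ∈ Zquiver n) (m l : ℕ) (hl : l ≤ m)
    (hm : m + 1 < n) : outArrow (horArrow σ) (m + 2) (l + 1) * vertArrow σ (m + 1) l =
      outArrow (horArrow σ) (m + 1) (l + 1) * vertArrow σ (m + 1) (l + 1) := by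
  have := box_of_mem hσ hl hm
  simp only [outArrow]
  rw [this, mul_comm]

/-- The zero ideal in `laxMat_sub_mem`: at a critical point the Lax matrix is the Toda matrix. -/
theorem laxMat_of_crit (hn : 1 ≤ n) {σ : Arrow n → ℂ} (hσ : σ ∈ Zcrit n) :
    (∀ i j : Fin (n + 1), (i : ℕ) + 2 ≤ j → laxMat n (vertArrow σ) i j = 0) ∧
    ∀ i : Fin n, laxMat n (vertArrow σ) i.castSucc i.succ = - qTilde σ i := by
  have h := laxMat_sub_mem (J := (⊥ : Ideal ℂ)) (outArrow_zero (horArrow σ)) (vertArrow_top σ)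
    (box_outArrow hσ.1) (fun r l hr hl =>
      (fiberDifferential_eq_zero_iff hn hσ.1).1 hσ.2 r l hr hl)
  simp only [Ideal.mem_bot, sub_eq_zero] at h
  refine ⟨fun i j hij => ?_, fun i => ?_⟩
  · rw [h, todaMat_apply, if_neg (by omega), if_neg (by rw [Fin.ext_iff]; omega), if_neg (by omega)]
    simp
  · rw [h, todaMat_apply, if_neg (by simp; omega), if_neg (by simp [Fin.ext_iff]), if_pos (by simp),
      qTilde_eq]
    simp [outArrow]

/-- Needed so that minus the superdiagonal entries are admissible values of `q̃`. Their product is,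
up to sign, a monomial in the nonzero `c`. -/
theorem laxMat_ne_zero {c : Tri n → ℂ} (hc : ∀ a, c a ≠ 0)
    (h1 : ∀ i j : Fin (n + 1), (i : ℕ) + 2 ≤ j → laxMat n (extTri c) i j = 0) (i : Fin n) :
    laxMat n (extTri c) i.castSucc i.succ ≠ 0 := by
  have h := prod_laxMat_sub_mem (J := (⊥ : Ideal ℂ)) (extTri c) h1
  rw [Ideal.mem_bot, sub_eq_zero] at h
  have hu : IsUnit (psi (extTri c) n 0 0) := isUnit_psi_diag (Nat.zero_le n) fun r _ hr => by
    rw [extTri_of_lt _ (Nat.zero_le r) hr]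
    exact (hc _).isUnit
  have h2 : (∏ i : Fin n, laxMat n (extTri c) i.castSucc i.succ) ≠ 0 := by
    rw [h]
    refine mul_ne_zero hu.ne_zero (Finset.prod_ne_zero_iff.2 fun k hk => ?_)
    rw [Finset.mem_range] at hk
    rw [extTri_of_lt _ le_rfl hk]
    exact hc _
  exact Finset.prod_ne_zero_iff.1 h2 i (Finset.mem_univ i)

/-- The point of the stratum determines the vertical arrows through minors, and criticality
determines `q̃` through the Lax matrix. Conversely, in the Peterson variety this value of `q̃`
solves the critical equations. -/
theorem bijOn_gammaMap (hn : 1 ≤ n) :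
    Set.BijOn gammaMap (Zcrit n) (PetersonB n ∩ openStratum (word₀ n)) := by
  refine ⟨fun σ hσ => ⟨⟨?_, ?_⟩, gammaMap_mem_openStratum hσ.1⟩, fun σ hσ σ' hσ' h => ?_, ?_⟩
  · rw [gammaMap, mem_Peterson_iff, laxOf_xc]
    exact (laxMat_of_crit hn hσ).1
  · rw [gammaMap_eq_bigCell]
    exact Set.mem_range_self _
  · have hx : xc σ = xc σ' := (isUni_xc σ).eq_of_mk_eq (isUni_xc σ') h
    have hc : (fun a => σ (.inl a)) = fun a : Tri n => σ' (.inl a) := by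
      rw [← triOf_cornerMinor hσ.1 fun a b _ => rfl, ← triOf_cornerMinor hσ'.1 fun a b _ => rfl, hx]
    have hQ : qTilde σ = qTilde σ' := by
      funext i
      have h1 := (laxMat_of_crit hn hσ).2 i
      have h2 := (laxMat_of_crit hn hσ').2 i
      rw [vertArrow] at h1 h2
      rw [hc] at h1
      exact neg_injective (h1.symm.trans h2)
    rw [← pointOf_eq hn hσ.1, ← pointOf_eq hn hσ'.1, hc, hQ]
  · rintro p ⟨⟨hP, -⟩, hp⟩
    obtain ⟨c, hc, hγ⟩ := exists_of_mem_openStratum hp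
    have hlax : ∀ i j : Fin (n + 1), (i : ℕ) + 2 ≤ j → laxMat n (extTri c) i j = 0 := by
      have h1 := hγ (Sum.elim c c) fun a => rfl
      rw [← h1, gammaMap, mem_Peterson_iff, laxOf_xc] at hP
      exact hP
    -- This is the only possible value of `q̃` at a critical point over `p`.
    set Q : Fin n → ℂ := fun i => - laxMat n (extTri c) i.castSucc i.succ with hQdef
    have hQ : ∀ i, Q i ≠ 0 := fun i => neg_ne_zero.2 (laxMat_ne_zero hc hlax i)
    have hσ := pointOf_mem hc hQ
    have hv : vertArrow (pointOf c Q) = extTri c := by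
      rw [vertArrow, funext (pointOf_inl hc hQ)]
    refine ⟨pointOf c Q, ⟨hσ.1, ?_⟩, hγ _ (pointOf_inl hc hQ)⟩
    rw [fiberDifferential_eq_zero_iff hn hσ.1]
    intro m l hm hl
    have := vertexEq_mem_of_laxMat (J := (⊥ : Ideal ℂ)) (outArrow_zero (horArrow (pointOf c Q)))
      (vertArrow_top _) (box_outArrow hσ.1)
      (fun i j hij hi => (vertArrow_ne_zero hσ.1 hij hi).isUnit)
      (fun i j hij => by rw [hv]; exact hlax i j hij) (fun i => by
        have h1 := congrFun hσ.2 i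
        rw [qTilde_eq] at h1
        have h2 : laxMat n (vertArrow (pointOf c Q)) i.castSucc i.succ = - Q i := by
          rw [hv, hQdef, neg_neg]
        rw [h2, outArrow, h1]
        exact neg_add_cancel _) hm hl
    exact this

end Peterson

/-! ### Compatibility of the Toda and Lax constructions with ring homomorphisms. -/

section Functoriality

variable {K K' : Type*} [CommRing K] [CommRing K'] (f : K →+* K')

theorem stepMat_map (n : ℕ) (c : ℕ → ℕ → K) (k : ℕ) :
    (stepMat n c k).map f = stepMat n (fun i j => f (c i j)) k := by
  ext i j
  simp only [stepMat, Matrix.map_apply, Matrix.of_apply, map_add, apply_ite f, map_one, map_zero]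

theorem partialMat_map (n : ℕ) (c : ℕ → ℕ → K) (k : ℕ) :
    (partialMat n c k).map f = partialMat n (fun i j => f (c i j)) k := by
  induction k with
  | zero => exact Matrix.map_one f (map_zero f) (map_one f)
  | succ k ih => rw [partialMat, Matrix.map_mul, ih, stepMat_map, partialMat]

theorem psi_map (c : ℕ → ℕ → K) (m k i : ℕ) :
    f (psi c m k i) = psi (fun i j => f (c i j)) m k i := by
  induction m generalizing k with
  | zero => simp only [psi, Pi.single_apply, apply_ite f, map_one, map_zero]
  | succ m ih =>
    simp only [psi_succ, Pi.sub_apply, Finset.sum_apply, Pi.smul_apply, smul_eq_mul, map_sub,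
      map_sum, map_mul, ih, Pi.single_apply, apply_ite f, map_one, map_zero]

theorem laxMat_map (n : ℕ) (c : ℕ → ℕ → K) (i j : Fin (n + 1)) :
    f (laxMat n c i j) = laxMat n (fun i j => f (c i j)) i j := by
  have h : (laxMat n c).map f = laxMat n fun i j => f (c i j) := by
    rw [laxMat, laxMat, Matrix.map_mul, Matrix.map_mul, partialMat_map]
    congr 2
    · ext i j
      simp only [psiMat, Matrix.map_apply, Matrix.of_apply, psi_map]
    · ext i j
      simp only [lowNil, Matrix.map_apply, Matrix.of_apply, apply_ite f, map_one, map_zero]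
  exact congrFun (congrFun h i) j

theorem extTri_map {n : ℕ} (c : Tri n → K) (i j : ℕ) :
    f (extTri c i j) = extTri (fun a => f (c a)) i j := by
  by_cases h : j ≤ i ∧ i < n
  · rw [extTri_of_lt _ h.1 h.2, extTri_of_lt _ h.1 h.2]
  · rw [extTri_of_not _ h, extTri_of_not _ h, map_zero]

theorem outArrow_map (d : ℕ → ℕ → K) (m l : ℕ) :
    f (outArrow d m l) = outArrow (fun i j => f (d i j)) m l := by
  rcases m with _ | m <;> rcases l with _ | l <;> simp [outArrow]

end Functoriality

/-! ### Coordinate rings, generators of the critical ideal, and Laurent expansion in `q̃`. -/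

section Schemes

variable {n : ℕ}

/-- The coordinate ring of `𝒵`. -/
abbrev ringZ (n : ℕ) : Subalgebra ℂ (Zquiver n → ℂ) := regularRing arrowCoord (Zquiver n)

/-- The coordinate ring of the open Deodhar stratum. -/
abbrev ringS (n : ℕ) : Subalgebra ℂ (openStratum (word₀ n) → ℂ) :=
  regularRing bigCellCoord (openStratum (word₀ n))

theorem ringZ_ext {f g : ringZ n}
    (h : ∀ σ, evalAt arrowCoord (Zquiver n) σ f = evalAt arrowCoord (Zquiver n) σ g) : f = g :=
  Subtype.ext (funext h)

theorem ringS_ext {f g : ringS n} (h : ∀ p, evalAt bigCellCoord (openStratum (word₀ n)) p f =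
    evalAt bigCellCoord (openStratum (word₀ n)) p g) : f = g :=
  Subtype.ext (funext h)

/-- `γ` as a map to the open Deodhar stratum. -/
def gammaRes (σ : Zquiver n) : openStratum (word₀ n) := ⟨gammaMap σ, gammaMap_mem_openStratum σ.2⟩

/-- Pull-back of regular functions under `γ`. -/
def gammaPull (n : ℕ) : ringS n →ₐ[ℂ] ringZ n where
  toFun f := ⟨fun σ => (f : openStratum (word₀ n) → ℂ) (gammaRes σ),
    comp_mem_regularRing (φ := gammaRes)
      (isMorphism_gammaMap fun _ hσ => gammaMap_mem_openStratum hσ).regular f.2⟩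
  map_one' := rfl
  map_mul' _ _ := rfl
  map_zero' := rfl
  map_add' _ _ := rfl
  commutes' _ := rfl

theorem evalAt_gammaPull (σ : Zquiver n) (f : ringS n) :
    evalAt arrowCoord (Zquiver n) σ (gammaPull n f) =
      evalAt bigCellCoord (openStratum (word₀ n)) (gammaRes σ) f := rfl

/-- Every point of the open stratum is the image of a point of each fibre `𝒵_Q`. -/
theorem exists_gammaRes_eq (p : openStratum (word₀ n)) {Q : Fin n → ℂ} (hQ : ∀ i, Q i ≠ 0) :
    ∃ σ : Zquiver n, gammaRes σ = p ∧ qTilde (σ : Arrow n → ℂ) = Q := by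
  obtain ⟨c, hc, h⟩ := exists_of_mem_openStratum p.2
  have hσ := pointOf_mem hc hQ
  exact ⟨⟨pointOf c Q, hσ.1⟩, Subtype.ext (h _ (pointOf_inl hc hQ)), hσ.2⟩

theorem exists_gammaRes (p : openStratum (word₀ n)) : ∃ σ : Zquiver n, gammaRes σ = p := by
  obtain ⟨σ, h, -⟩ := exists_gammaRes_eq p (Q := fun _ => 1) fun _ => one_ne_zero
  exact ⟨σ, h⟩

/-- The vertical arrow variables as regular functions on `𝒵`. -/
def vertFun (a : Tri n) : ringZ n := ⟨_, coord_mem_regularRing arrowCoord (Zquiver n) (.inl a)⟩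

/-- The horizontal arrow variables as regular functions on `𝒵`. -/
def horFun (a : Tri n) : ringZ n := ⟨_, coord_mem_regularRing arrowCoord (Zquiver n) (.inr a)⟩

/-- The functions `q̃_i` on `𝒵`. -/
def qFun (i : Fin n) : ringZ n := vertFun ⟨(i, i), le_rfl⟩ * horFun ⟨(i, i), le_rfl⟩

theorem evalAt_extTri_vertFun (σ : Zquiver n) (i j : ℕ) :
    evalAt arrowCoord (Zquiver n) σ (extTri vertFun i j) = vertArrow (σ : Arrow n → ℂ) i j :=
  extTri_map _ _ _ _

theorem evalAt_extTri_horFun (σ : Zquiver n) (i j : ℕ) :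
    evalAt arrowCoord (Zquiver n) σ (extTri horFun i j) = horArrow (σ : Arrow n → ℂ) i j :=
  extTri_map _ _ _ _

theorem evalAt_outArrow_horFun (σ : Zquiver n) (i j : ℕ) :
    evalAt arrowCoord (Zquiver n) σ (outArrow (extTri horFun) i j) =
      outArrow (horArrow (σ : Arrow n → ℂ)) i j := by
  rw [outArrow_map]
  simp only [evalAt_extTri_horFun]

theorem evalAt_vertexEq (σ : Zquiver n) (m l : ℕ) :
    evalAt arrowCoord (Zquiver n) σ (vertexEq (extTri vertFun) (outArrow (extTri horFun)) m l) =
      vertexEq (vertArrow (σ : Arrow n → ℂ)) (outArrow (horArrow (σ : Arrow n → ℂ))) m l := by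
  simp only [vertexEq, map_add, map_sub, evalAt_extTri_vertFun, evalAt_outArrow_horFun]

theorem cornerMinor_ne_zero_of_mem (p : openStratum (word₀ n)) {a b : ℕ} (h : a + b ≤ n + 1) :
    cornerMinor (unip (bigCellCoord (p : Flag n)) : Mat n) a b ≠ 0 := by
  obtain ⟨σ, rfl⟩ := exists_gammaRes p
  change cornerMinor (unip (bigCellCoord (gammaMap (σ : Arrow n → ℂ))) : Mat n) a b ≠ 0
  rw [unip_bigCellCoord_gammaMap]
  exact cornerMinor_xc_ne_zero σ.2 h

/-- The standard coordinates on the open stratum, as regular functions. -/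
def stratumFun (a : Tri n) : ringS n :=
  ⟨fun p => triOf (fun a b => cornerMinor (unip (bigCellCoord (p : Flag n)) : Mat n) a b) a, by
    have h : (a.1.2 : ℕ) ≤ a.1.1 := a.2
    have h' := a.1.1.2
    have hm : ∀ a b, (fun p : openStratum (word₀ n) =>
        cornerMinor (unip (bigCellCoord (p : Flag n)) : Mat n) a b) ∈ ringS n :=
      cornerMinor_mem_regularRing (unip_mem_regularRing _)
    exact div_mem_regularRing (mul_mem_regularRing (hm _ _) (hm _ _))
      (mul_mem_regularRing (hm _ _) (hm _ _)) fun p => mul_ne_zero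
        (cornerMinor_ne_zero_of_mem p (by omega)) (cornerMinor_ne_zero_of_mem p (by omega))⟩

theorem gammaPull_stratumFun (a : Tri n) : gammaPull n (stratumFun a) = vertFun a := by
  refine ringZ_ext fun σ => ?_
  change triOf (fun a b => cornerMinor
    (unip (bigCellCoord (gammaMap (σ : Arrow n → ℂ))) : Mat n) a b) a = (σ : Arrow n → ℂ) (.inl a)
  exact congrFun (triOf_cornerMinor σ.2 fun a b _ => by rw [unip_bigCellCoord_gammaMap]) a

theorem evalAt_stratumFun (σ : Zquiver n) (a : Tri n) :
    evalAt bigCellCoord (openStratum (word₀ n)) (gammaRes σ) (stratumFun a) =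
      (σ : Arrow n → ℂ) (.inl a) := by
  rw [← evalAt_gammaPull, gammaPull_stratumFun]
  rfl

theorem isUnit_stratumFun (a : Tri n) : IsUnit (stratumFun a) := by
  have h0 : ∀ p, (stratumFun a : openStratum (word₀ n) → ℂ) p ≠ 0 := by
    intro p
    obtain ⟨σ, rfl⟩ := exists_gammaRes p
    have := evalAt_stratumFun σ a
    rw [evalAt_apply] at this
    rw [this]
    exact σ.2.1 _
  refine IsUnit.of_mul_eq_one ⟨_, inv_mem_regularRing (stratumFun a).2 h0⟩ (ringS_ext fun p => ?_)
  exact mul_inv_cancel₀ (h0 p)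

theorem isUnit_vertFun (a : Tri n) : IsUnit (vertFun a) := by
  rw [← gammaPull_stratumFun]
  exact (isUnit_stratumFun a).map (gammaPull n)

/-- Expressing the matrix entries by the stratum coordinates makes the ring-level Toda identities
available on the stratum. -/
theorem laxFun_eq (i j : Fin (n + 1)) :
    laxFun (openStratum (word₀ n)) i j = laxMat n (extTri stratumFun) i j := by
  refine ringS_ext fun p => ?_
  obtain ⟨σ, rfl⟩ := exists_gammaRes p
  rw [laxMat_map]
  simp only [extTri_map, evalAt_stratumFun]
  change laxOf (unip (bigCellCoord (gammaMap (σ : Arrow n → ℂ)))) i j = _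
  rw [unip_bigCellCoord_gammaMap, laxOf_xc]
  rfl

theorem gammaPull_laxFun (i j : Fin (n + 1)) :
    gammaPull n (laxFun _ i j) = laxMat n (extTri vertFun) i j := by
  rw [laxFun_eq]
  have := laxMat_map (gammaPull n : ringS n →+* ringZ n) n (extTri stratumFun) i j
  simp only [extTri_map, AlgHom.coe_toRingHom, gammaPull_stratumFun] at this
  exact this

/-- The generators of the ideal of the critical locus which come from the Lax matrix. -/
def laxGens (n : ℕ) : Set (ringZ n) :=
  {f | (∃ i j : Fin (n + 1), (i : ℕ) + 2 ≤ j ∧ f = gammaPull n (laxFun _ i j)) ∨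
    ∃ i : Fin n, f = gammaPull n (laxFun _ i.castSucc i.succ) + qFun i}

theorem qFun_eq (i : Fin n) : qFun i = extTri vertFun i i * outArrow (extTri horFun) (i + 1) (i + 1) := by
  rw [extTri_of_lt _ le_rfl i.2, outArrow, extTri_of_lt _ le_rfl i.2]
  rfl

theorem box_ringZ (m l : ℕ) (hl : l ≤ m) (hm : m + 1 < n) :
    outArrow (extTri (horFun (n := n))) (m + 2) (l + 1) * extTri vertFun (m + 1) l =
      outArrow (extTri horFun) (m + 1) (l + 1) * extTri vertFun (m + 1) (l + 1) := by
  refine ringZ_ext fun σ => ?_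
  simp only [map_mul, evalAt_extTri_vertFun, evalAt_outArrow_horFun]
  exact box_outArrow σ.2 m l hl hm

/-- The two directions of the comparison of Lax and Toda matrices, applied over the coordinate ring
of `𝒵`. The equations `q̃_i = -(u⁻¹ f u)_{i,i+1}` appear as the second family of generators. -/
theorem critIdeal_eq (hn : 1 ≤ n) : critIdeal n = Ideal.span (laxGens n) := by
  have ht0 : ∀ (v : Below n) (σ : Zquiver n), vertexCoord (σ : Arrow n → ℂ) v ≠ 0 := by
    intro v σ
    rw [vertexCoord_eq hn]
    exact vertexVar_ne_zero σ.2 v.2.le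
  have ht : ∀ v : Below n, (fun σ : Zquiver n => vertexCoord (σ : Arrow n → ℂ) v) ∈ ringZ n :=
    fun v => mul_mem_regularRing (prod_mem_regularRing fun a _ => (vertFun a).2)
      (prod_mem_regularRing fun a _ => (horFun a).2)
  refine le_antisymm (Ideal.span_le.2 ?_) (Ideal.span_le.2 ?_)
  · rintro f ⟨v, hf⟩
    have hv : (v.1.2 : ℕ) < v.1.1 := v.2
    -- Ordinary and logarithmic derivatives differ by the vertex variable, a unit, so they generate
    -- the same ideal.
    have e : f = vertexEq (extTri vertFun) (outArrow (extTri horFun)) (v.1.1 - 1) v.1.2 *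
        ⟨_, inv_mem_regularRing (ht v) (ht0 v)⟩ := by
      refine ringZ_ext fun σ => ?_
      rw [map_mul, evalAt_vertexEq]
      change (f : Zquiver n → ℂ) σ = _
      rw [hf σ, fiberDifferential_single_eq hn σ.2, div_eq_mul_inv]
      rfl
    rw [e]
    refine Ideal.mul_mem_right _ _ (vertexEq_mem_of_laxMat (n := n)
      (outArrow_zero _) (fun l => extTri_of_not _ (by omega)) box_ringZ
      (fun i j hij hi => ?_) (fun i j hij => ?_) (fun i => ?_) (by omega) (by omega))
    · rw [extTri_of_lt _ hij hi]
      exact isUnit_vertFun _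
    · exact Ideal.subset_span (Or.inl ⟨i, j, hij, (gammaPull_laxFun i j).symm⟩)
    · rw [← qFun_eq, ← gammaPull_laxFun]
      exact Ideal.subset_span (Or.inr ⟨i, rfl⟩)
  · have hmem : ∀ m l, m < n → l ≤ m →
        vertexEq (extTri vertFun) (outArrow (extTri horFun)) m l ∈ critIdeal n := by
      intro m l hm hl
      let v : Below n := ⟨(⟨m + 1, by omega⟩, ⟨l, by omega⟩), show l < m + 1 by omega⟩
      have e : vertexEq (extTri vertFun) (outArrow (extTri horFun)) m l =
          ⟨_, ht v⟩ * (vertexEq (extTri vertFun) (outArrow (extTri horFun)) m l *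
            ⟨_, inv_mem_regularRing (ht v) (ht0 v)⟩ : ringZ n) := by
        refine ringZ_ext fun σ => ?_
        rw [map_mul, map_mul]
        exact (mul_div_cancel₀ _ (ht0 v σ)).symm
      rw [e]
      refine Ideal.mul_mem_left _ _ (Ideal.subset_span ⟨v, fun σ => ?_⟩)
      rw [fiberDifferential_single_eq hn σ.2, div_eq_mul_inv]
      exact congrArg (· * (vertexCoord (σ : Arrow n → ℂ) v)⁻¹) (evalAt_vertexEq σ m l)
    have h := laxMat_sub_mem (n := n) (outArrow_zero (extTri (horFun (n := n))))
      (fun l => extTri_of_not _ (by omega)) box_ringZ hmem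
    rintro f (⟨i, j, hij, rfl⟩ | ⟨i, rfl⟩)
    · have := h i j
      rw [todaMat_apply, if_neg (by omega), if_neg (by rw [Fin.ext_iff]; omega),
        if_neg (by omega)] at this
      rw [gammaPull_laxFun]
      simpa using this
    · have := h i.castSucc i.succ
      rw [todaMat_apply, if_neg (by simp; omega), if_neg (by simp [Fin.ext_iff]),
        if_pos (by simp)] at this
      simp only [Fin.val_castSucc] at this
      rw [← qFun_eq] at this
      rw [gammaPull_laxFun]
      simpa using this

/-- Polynomials in the `q̃_i` over the coordinate ring of the stratum. -/
def qPoly (n : ℕ) : MvPolynomial (Fin n) (ringS n) →+* ringZ n :=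
  MvPolynomial.eval₂Hom (gammaPull n : ringS n →+* ringZ n) qFun

theorem qPoly_C (f : ringS n) : qPoly n (MvPolynomial.C f) = gammaPull n f :=
  MvPolynomial.eval₂_C _ _ _

theorem qPoly_X (i : Fin n) : qPoly n (MvPolynomial.X i) = qFun i :=
  MvPolynomial.eval₂_X _ _ _

/-- Over a fixed point of the stratum `q̃` takes every value in the torus. So a polynomial relation
has vanishing coefficients at each point. -/
theorem qPoly_injective : Function.Injective (qPoly n) := by
  rw [injective_iff_map_eq_zero]
  intro P hP
  ext m p
  have h : MvPolynomial.map (evalAt bigCellCoord (openStratum (word₀ n)) p) P = 0 := by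
    refine eq_zero_of_eval_torus fun Q hQ => ?_
    obtain ⟨σ, rfl, hσ⟩ := exists_gammaRes_eq p hQ
    have h1 := congrArg (evalAt arrowCoord (Zquiver n) σ) hP
    rw [map_zero, qPoly, MvPolynomial.coe_eval₂Hom, MvPolynomial.hom_eval₂] at h1
    rw [MvPolynomial.eval_map, ← h1, ← hσ]
    rfl
  have h2 := congrArg (MvPolynomial.coeff m) h
  rw [MvPolynomial.coeff_map, MvPolynomial.coeff_zero] at h2
  exact h2

theorem aeval_eq_qPoly (P : MvPolynomial (Tri n ⊕ Fin n) ℂ) :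
    MvPolynomial.aeval (Sum.elim vertFun qFun) P = qPoly n
      (MvPolynomial.aeval (Sum.elim (fun a => MvPolynomial.C (stratumFun a)) MvPolynomial.X) P) := by
  induction P using MvPolynomial.induction_on with
  | C z =>
    rw [MvPolynomial.aeval_C, MvPolynomial.aeval_C, IsScalarTower.algebraMap_apply ℂ (ringS n)
        (MvPolynomial (Fin n) (ringS n)), MvPolynomial.algebraMap_eq, qPoly_C, AlgHom.commutes]
  | add P P' h h' => rw [map_add, map_add, map_add, h, h']
  | mul_X P x h =>
    rw [map_mul, map_mul, map_mul, h, MvPolynomial.aeval_X, MvPolynomial.aeval_X]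
    congr 1
    rcases x with a | i
    · exact (gammaPull_stratumFun a).symm.trans (qPoly_C _).symm
    · exact (qPoly_X i).symm

/-- The point of `𝒵` given by vertical arrow variables and values of `q̃`. -/
def torusPoint (z : torus (Tri n ⊕ Fin n)) : Zquiver n :=
  ⟨pointOf (fun a => (z : Tri n ⊕ Fin n → ℂ) (.inl a)) (fun i => (z : Tri n ⊕ Fin n → ℂ) (.inr i)),
    (pointOf_mem (fun _ => z.2 _) fun _ => z.2 _).1⟩

/-- The vertical arrow variables and the values of `q̃` of a point of `𝒵`. -/
def torusCoord (σ : Zquiver n) : torus (Tri n ⊕ Fin n) :=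
  ⟨Sum.elim (fun a => (σ : Arrow n → ℂ) (.inl a)) (qTilde (σ : Arrow n → ℂ)), by
    rintro (a | i)
    · exact σ.2.1 _
    · exact qTilde_ne_zero σ.2 i⟩

theorem torusPoint_torusCoord (hn : 1 ≤ n) (σ : Zquiver n) : torusPoint (torusCoord σ) = σ :=
  Subtype.ext (pointOf_eq hn σ.2)

theorem torusPoint_mem_regularRing (a : Arrow n) :
    (fun z : torus (Tri n ⊕ Fin n) => arrowCoord (torusPoint z : Arrow n → ℂ) a) ∈
      regularRing (fun z : Tri n ⊕ Fin n → ℂ => z) (torus (Tri n ⊕ Fin n)) :=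
  pointOf_mem_regularRing
    (c := fun a (z : torus (Tri n ⊕ Fin n)) => (z : Tri n ⊕ Fin n → ℂ) (.inl a))
    (Q := fun i (z : torus (Tri n ⊕ Fin n)) => (z : Tri n ⊕ Fin n → ℂ) (.inr i))
    (fun a => coord_mem_regularRing (fun z : Tri n ⊕ Fin n → ℂ => z) _ (.inl a))
    (fun _ z => z.2 _)
    (fun i => coord_mem_regularRing (fun z : Tri n ⊕ Fin n → ℂ => z) _ (.inr i))
    (fun _ z => z.2 _) a

theorem evalAt_aeval (σ : Zquiver n) (P : MvPolynomial (Tri n ⊕ Fin n) ℂ) :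
    evalAt arrowCoord (Zquiver n) σ (MvPolynomial.aeval (Sum.elim vertFun qFun) P) =
      MvPolynomial.eval (torusCoord σ : Tri n ⊕ Fin n → ℂ) P := by
  induction P using MvPolynomial.induction_on with
  | C z =>
    rw [MvPolynomial.aeval_C, MvPolynomial.eval_C]
    rfl
  | add P P' h h' => rw [map_add, map_add, map_add, h, h']
  | mul_X P x h =>
    rw [map_mul, map_mul, map_mul, h, MvPolynomial.aeval_X, MvPolynomial.eval_X]
    congr 1
    rcases x with a | i <;> rfl

/-- Transport `g` to the torus by `torusPoint`, apply `exists_laurent_of_regular`, and evaluate at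
`torusCoord`. -/
theorem exists_laurent_ringZ (hn : 1 ≤ n) (g : ringZ n) :
    ∃ (N : ℕ) (P : MvPolynomial (Tri n ⊕ Fin n) ℂ), (∏ a, vertFun a) ^ N *
      ((∏ i, qFun i) ^ N * g) = MvPolynomial.aeval (Sum.elim vertFun qFun) P := by
  obtain ⟨P, N, hP⟩ := exists_laurent_of_regular
    (comp_mem_regularRing (φ := torusPoint (n := n)) torusPoint_mem_regularRing g.2)
  refine ⟨N, P, ringZ_ext fun σ => ?_⟩
  have h2 := hP (torusCoord σ)
  rw [torusPoint_torusCoord hn, Fintype.prod_sum_type, mul_pow, mul_assoc] at h2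
  rw [evalAt_aeval, ← h2]
  simp only [map_mul, map_pow, map_prod]
  rfl

/-- Every regular function on `𝒵` is a Laurent polynomial in the `q̃_i` over the coordinate ring of
the open stratum. -/
theorem exists_qPoly (hn : 1 ≤ n) (g : ringZ n) :
    ∃ (N : ℕ) (P : MvPolynomial (Fin n) (ringS n)), (∏ i, qFun i) ^ N * g = qPoly n P := by
  obtain ⟨N, P, h1⟩ := exists_laurent_ringZ hn g
  -- Denominators in the vertical variables are invertible already on the stratum; only powers of
  -- the `q̃_i` have to be cleared.
  obtain ⟨u, hu⟩ : IsUnit (∏ a : Tri n, stratumFun a) := by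
    rw [IsUnit.prod_univ_iff]
    exact isUnit_stratumFun
  refine ⟨N, MvPolynomial.C ((↑u⁻¹ : ringS n) ^ N) *
    MvPolynomial.aeval (Sum.elim (fun a => MvPolynomial.C (stratumFun a)) MvPolynomial.X) P, ?_⟩
  have h5 : gammaPull n ((↑u⁻¹ : ringS n) ^ N) * (∏ a : Tri n, vertFun a) ^ N = 1 := by
    simp only [← gammaPull_stratumFun, ← map_prod, ← hu, ← map_pow, ← map_mul]
    rw [← mul_pow, Units.inv_mul, one_pow, map_one]
  rw [map_mul, ← aeval_eq_qPoly, ← h1, qPoly_C, ← mul_assoc, h5, one_mul]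

end Schemes

/-! ### Elimination of `q̃` and the isomorphism of schemes. -/

section SchemeIso

variable {n : ℕ}

/-- The ideal of the Peterson variety in the coordinate ring of the open Deodhar stratum. -/
abbrev idealS (n : ℕ) : Ideal (ringS n) := petersonIdeal (openStratum (word₀ n))

theorem laxFun_mem (i j : Fin (n + 1)) (h : (i : ℕ) + 2 ≤ j) :
    laxFun (openStratum (word₀ n)) i j ∈ idealS n := by
  rw [idealS, petersonIdeal_eq]
  exact Ideal.subset_span ⟨i, j, h, rfl⟩

/-- Substitution of the critical values for the `q̃_i`. -/
def qSubst (n : ℕ) : MvPolynomial (Fin n) (ringS n) →+* ringS n :=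
  MvPolynomial.eval₂Hom (RingHom.id _) fun i => - laxFun _ i.castSucc i.succ

theorem qSubst_C (f : ringS n) : qSubst n (MvPolynomial.C f) = f := MvPolynomial.eval₂_C _ _ _

theorem qSubst_X (i : Fin n) : qSubst n (MvPolynomial.X i) = - laxFun _ i.castSucc i.succ :=
  MvPolynomial.eval₂_X _ _ _

/-- Modulo the critical ideal each `q̃_i` may be replaced by its critical value. -/
theorem qPoly_sub_mem (hn : 1 ≤ n) (P : MvPolynomial (Fin n) (ringS n)) :
    qPoly n P - gammaPull n (qSubst n P) ∈ critIdeal n := by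
  induction P using MvPolynomial.induction_on with
  | C f =>
    rw [qPoly_C, qSubst_C, sub_self]
    exact zero_mem _
  | add P P' h h' =>
    rw [map_add, map_add, map_add, add_sub_add_comm]
    exact add_mem h h'
  | mul_X P i h =>
    have hX : qFun i - gammaPull n (- laxFun _ i.castSucc i.succ) ∈ critIdeal n := by
      rw [map_neg, sub_neg_eq_add, add_comm, critIdeal_eq hn]
      exact Ideal.subset_span (Or.inr ⟨i, rfl⟩)
    rw [map_mul, map_mul, map_mul, qPoly_X, qSubst_X, show ∀ x y z w : ringZ n,
      x * y - z * w = (x - z) * y + z * (y - w) by intros; ring]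
    exact add_mem (Ideal.mul_mem_right _ _ h) (Ideal.mul_mem_left _ _ hX)

theorem prod_neg_eq {R : Type*} [CommRing R] (f : Fin n → R) :
    ∏ i, -f i = (-1) ^ n * ∏ i, f i := by
  rw [Finset.prod_neg]
  simp

/-- The critical value of `∏ q̃_i` is, modulo the Peterson ideal, a signed monomial in the
invertible stratum coordinates. This permits division by `q̃` after substitution. -/
theorem exists_unit_sub_mem : ∃ u : (ringS n)ˣ,
    qSubst n (∏ i, MvPolynomial.X i) - u ∈ idealS n := by
  have h := prod_laxMat_sub_mem (n := n) (extTri stratumFun) (J := idealS n)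
    fun i j hij => by rw [← laxFun_eq]; exact laxFun_mem i j hij
  have hu : IsUnit (psi (extTri (stratumFun (n := n))) n 0 0 *
      ∏ i ∈ Finset.range n, extTri (stratumFun (n := n)) i i) := by
    refine IsUnit.mul (isUnit_psi_diag (Nat.zero_le n) fun r _ hr => ?_)
      (IsUnit.prod_iff.2 fun k hk => ?_)
    · rw [extTri_of_lt _ (Nat.zero_le r) hr]
      exact isUnit_stratumFun _
    · rw [Finset.mem_range] at hk
      rw [extTri_of_lt _ le_rfl hk]
      exact isUnit_stratumFun _
  obtain ⟨u, hu'⟩ := ((IsUnit.of_mul_eq_one (-1) (by ring) : IsUnit (-1 : ringS n)).pow n).mul hu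
  refine ⟨u, ?_⟩
  have e : qSubst n (∏ i, MvPolynomial.X i) =
      (-1) ^ n * ∏ i : Fin n, laxMat n (extTri stratumFun) i.castSucc i.succ := by
    rw [map_prod]
    simp only [qSubst_X, ← laxFun_eq]
    exact prod_neg_eq _
  rw [e, hu', ← mul_sub]
  exact Ideal.mul_mem_left _ _ h

theorem qPoly_prod_X : qPoly n (∏ i, MvPolynomial.X i) = ∏ i, qFun i := by
  rw [map_prod]
  simp only [qPoly_X]

/-- Substitution sends the generators `q̃_i + (u⁻¹ f u)_{i,i+1}` to zero and the others into the
Peterson ideal. Clearing powers of `∏ q̃_i` extends this to all multiples. -/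
theorem exists_qPoly_of_mem_critIdeal (hn : 1 ≤ n) {g : ringZ n} (hg : g ∈ critIdeal n) :
    ∃ (N : ℕ) (P : MvPolynomial (Fin n) (ringS n)), (∏ i, qFun i) ^ N * g = qPoly n P ∧
      qSubst n P ∈ idealS n := by
  rw [critIdeal_eq hn] at hg
  induction hg using Submodule.span_induction with
  | mem g hg =>
    rcases hg with ⟨i, j, hij, rfl⟩ | ⟨i, rfl⟩
    · refine ⟨0, MvPolynomial.C (laxFun _ i j), ?_, ?_⟩
      · rw [pow_zero, one_mul, qPoly_C]
      · rw [qSubst_C]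
        exact laxFun_mem i j hij
    · refine ⟨0, MvPolynomial.C (laxFun _ i.castSucc i.succ) + MvPolynomial.X i, ?_, ?_⟩
      · rw [pow_zero, one_mul, map_add, qPoly_C, qPoly_X]
      · rw [map_add, qSubst_C, qSubst_X, add_neg_cancel]
        exact zero_mem _
  | zero => exact ⟨0, 0, by rw [mul_zero, map_zero], by rw [map_zero]; exact zero_mem _⟩
  | add g g' _ _ h h' =>
    obtain ⟨N, P, hP, hP'⟩ := h
    obtain ⟨M, R, hR, hR'⟩ := h'
    refine ⟨N + M, (∏ i, MvPolynomial.X i) ^ M * P + (∏ i, MvPolynomial.X i) ^ N * R, ?_, ?_⟩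
    · rw [map_add, map_mul, map_mul, ← hP, ← hR, map_pow, map_pow, qPoly_prod_X]
      ring
    · rw [map_add, map_mul, map_mul]
      exact add_mem (Ideal.mul_mem_left _ _ hP') (Ideal.mul_mem_left _ _ hR')
  | smul a g _ h =>
    obtain ⟨N, P, hP, hP'⟩ := h
    obtain ⟨M, R, hR⟩ := exists_qPoly hn a
    refine ⟨N + M, R * P, ?_, ?_⟩
    · rw [map_mul, ← hP, ← hR, smul_eq_mul]
      ring
    · rw [map_mul]
      exact Ideal.mul_mem_left _ _ hP'

/-- Injectivity of the induced map. If the pull-back of `f` is in the critical ideal, uniqueness of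
the expansion in `q̃` and substitution put a unit multiple of `f` in the Peterson ideal. -/
theorem idealS_eq_comap (hn : 1 ≤ n) : (critIdeal n).comap (gammaPull n) = idealS n := by
  refine le_antisymm (fun f hf => ?_) ?_
  · obtain ⟨N, P, hP, hP'⟩ := exists_qPoly_of_mem_critIdeal hn (Ideal.mem_comap.1 hf)
    rw [← qPoly_C, ← qPoly_prod_X, ← map_pow, ← map_mul] at hP
    rw [← qPoly_injective hP, map_mul, map_pow, qSubst_C] at hP'
    obtain ⟨u, hu⟩ := exists_unit_sub_mem (n := n)
    rw [← Ideal.Quotient.eq] at hu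
    rw [← Ideal.Quotient.eq_zero_iff_mem] at hP' ⊢
    rw [map_mul, map_pow, hu] at hP'
    exact (((u.isUnit.map (Ideal.Quotient.mk (idealS n))).pow N).mul_right_eq_zero).1 hP'
  · rw [idealS, petersonIdeal_eq, Ideal.span_le]
    rintro _ ⟨i, j, hij, rfl⟩
    change gammaPull n _ ∈ critIdeal n
    rw [critIdeal_eq hn]
    exact Ideal.subset_span (Or.inl ⟨i, j, hij, rfl⟩)

theorem map_sub_mem_of_pow_mul_sub_mem {R S : Type*} [CommRing R] [CommRing S] (φ : R →+* S)
    {J : Ideal S} {q g : S} {f : R} {u : Rˣ} {N : ℕ} (hq : q - φ u ∈ J)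
    (hg : q ^ N * g - φ f ∈ J) : φ ((↑u⁻¹ : R) ^ N * f) - g ∈ J := by
  rw [← Ideal.Quotient.eq] at hq hg ⊢
  have h3 : φ (↑u⁻¹ : R) * φ (u : R) = 1 := by rw [← map_mul, Units.inv_mul, map_one]
  have h4 : Ideal.Quotient.mk J (φ (↑u⁻¹ : R)) * Ideal.Quotient.mk J (φ (u : R)) = 1 := by
    rw [← map_mul, h3, map_one]
  rw [map_mul, map_pow, hq] at hg
  rw [map_mul, map_mul, ← hg, map_pow, map_pow, ← mul_assoc, ← mul_pow, h4, one_pow, one_mul]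

/-- Surjectivity of the induced map: clear the powers of `∏ q̃_i`, substitute the critical values,
and divide by the corresponding unit. -/
theorem exists_gammaPull_sub_mem (hn : 1 ≤ n) (g : ringZ n) :
    ∃ f, gammaPull n f - g ∈ critIdeal n := by
  obtain ⟨N, P, hP⟩ := exists_qPoly hn g
  obtain ⟨u, hu⟩ := exists_unit_sub_mem (n := n)
  have h2 : (∏ i, qFun i) - gammaPull n (u : ringS n) ∈ critIdeal n := by
    have h3 := qPoly_sub_mem hn (∏ i, MvPolynomial.X i)
    rw [← idealS_eq_comap hn] at hu
    have h4 : gammaPull n (qSubst n (∏ i, MvPolynomial.X i) - u) ∈ critIdeal n := hu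
    rw [map_sub] at h4
    rw [← qPoly_prod_X]
    have h5 := add_mem h3 h4
    rwa [sub_add_sub_cancel] at h5
  have h3 := qPoly_sub_mem hn P
  rw [← hP] at h3
  exact ⟨_, map_sub_mem_of_pow_mul_sub_mem (gammaPull n : ringS n →+* ringZ n) h2 h3⟩

/-- The isomorphism of (possibly non-reduced) schemes induced by `γ`. -/
theorem exists_quotient_equiv (hn : 1 ≤ n) :
    ∃ e : (ringS n ⧸ idealS n) ≃ₐ[ℂ] (ringZ n ⧸ critIdeal n),
      ∀ f, e (Ideal.Quotient.mk _ f) = Ideal.Quotient.mk _ (gammaPull n f) := by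
  let φ : (ringS n ⧸ idealS n) →ₐ[ℂ] (ringZ n ⧸ critIdeal n) :=
    Ideal.quotientMapₐ (critIdeal n) (gammaPull n) (idealS_eq_comap hn).ge
  have hφ : ∀ f, φ (Ideal.Quotient.mk _ f) = Ideal.Quotient.mk _ (gammaPull n f) := fun f => rfl
  refine ⟨AlgEquiv.ofBijective φ ⟨?_, ?_⟩, hφ⟩
  · rw [injective_iff_map_eq_zero]
    intro x hx
    obtain ⟨f, rfl⟩ := Ideal.Quotient.mk_surjective x
    rw [hφ, Ideal.Quotient.eq_zero_iff_mem] at hx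
    rw [Ideal.Quotient.eq_zero_iff_mem, ← idealS_eq_comap hn]
    exact hx
  · intro y
    obtain ⟨g, rfl⟩ := Ideal.Quotient.mk_surjective y
    obtain ⟨f, hf⟩ := exists_gammaPull_sub_mem hn g
    exact ⟨Ideal.Quotient.mk _ f, (hφ f).trans (Ideal.Quotient.eq.2 hf)⟩

theorem exists_scheme_iso (hn : 1 ≤ n) :
    ∃ e : (regularRing bigCellCoord (openStratum (word₀ n)) ⧸
            petersonIdeal (openStratum (word₀ n))) ≃ₐ[ℂ]
          (regularRing arrowCoord (Zquiver n) ⧸ critIdeal n),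
        ∀ (f : regularRing bigCellCoord (openStratum (word₀ n)))
          (g : regularRing arrowCoord (Zquiver n)),
          (∀ (σ : Zquiver n) (p : openStratum (word₀ n)), (p : Flag n) = gammaMap σ →
            (g : Zquiver n → ℂ) σ = (f : openStratum (word₀ n) → ℂ) p) →
          e (Ideal.Quotient.mk _ f) = Ideal.Quotient.mk _ g := by
  obtain ⟨e, he⟩ := exists_quotient_equiv hn
  refine ⟨e, fun f g h => ?_⟩
  have : g = gammaPull n f := ringZ_ext fun σ => h σ (gammaRes σ) rfl
  rw [this]
  exact he f

end SchemeIso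

/-! ### Pull-back of the holomorphic form to the fibres. -/

section Form

variable {n : ℕ}

/-- The tails of the vertical arrows are the vertices below the diagonal. -/
def tailEquiv (n : ℕ) : Tri n ≃ Below n where
  toFun a := ⟨(a.1.1.succ, a.1.2.castSucc), Nat.lt_succ_of_le a.2⟩
  invFun v := ⟨(⟨v.1.1 - 1, by have := v.1.1.2; have : (v.1.2 : ℕ) < v.1.1 := v.2; omega⟩,
    ⟨v.1.2, by have := v.1.1.2; have : (v.1.2 : ℕ) < v.1.1 := v.2; omega⟩), by
      have : (v.1.2 : ℕ) < v.1.1 := v.2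
      change (v.1.2 : ℕ) ≤ v.1.1 - 1
      omega⟩
  left_inv a := by simp
  right_inv v := by
    have : (v.1.2 : ℕ) < v.1.1 := v.2
    refine Subtype.ext (Prod.ext (Fin.ext ?_) (Fin.ext rfl))
    change (v.1.1 : ℕ) - 1 + 1 = v.1.1
    omega

/-- The equivalence `e` enters only through cardinality: there are `nB n` vertices below the
diagonal, hence as many vertical arrows. -/
theorem exists_ofFn_cOrder (e : Fin (nB n) ≃ Below n) :
    ∃ A : Fin (nB n) ≃ Tri n, List.ofFn A = cOrder n := by
  have hlen : (cOrder n).length = nB n := by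
    have h1 := Fintype.card_congr (nodup_cOrder.getEquivOfForallMemList (cOrder n) mem_cOrder)
    have h2 := Fintype.card_congr (e.trans (tailEquiv n).symm)
    rw [Fintype.card_fin] at h1 h2
    rw [h1, h2]
  refine ⟨(finCongr hlen.symm).trans (nodup_cOrder.getEquivOfForallMemList (cOrder n) mem_cOrder), ?_⟩
  refine List.ext_getElem (by simp [hlen]) fun i h1 h2 => ?_
  simp

theorem isReducedWord_of_ofFn {A : Fin (nB n) ≃ Tri n} (hA : List.ofFn A = cOrder n) :
    IsReducedWord fun l => (A l).1.1 := by
  have h := prod_swap_word₀ (n := n)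
  rw [word₀, ← hA, List.map_ofFn, List.map_ofFn] at h
  exact h

theorem stratumParam_of_ofFn {A : Fin (nB n) ≃ Tri n} (hA : List.ofFn A = cOrder n)
    (σ : Arrow n → ℂ) :
    gammaMap σ = stratumParam (fun l => (A l).1.1) fun l => σ (.inl (A l)) := by
  rw [gammaMap_eq_stratumPoint, ← hA, List.map_ofFn]
  rfl

theorem differentiable_list_prod {ι E : Type*} [NormedAddCommGroup E] [NormedSpace ℂ E]
    (f : ι → Fin n) {s : ι → E → ℂ} (hs : ∀ a, Differentiable ℂ (s a)) (L : List ι)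
    (i j : Fin (n + 1)) :
    Differentiable ℂ fun z => ((L.map fun a => xRoot (f a) (s a z)).prod : Mat n) i j := by
  induction L generalizing i j with
  | nil => exact differentiable_const _
  | cons a L ih =>
    simp only [List.map_cons, List.prod_cons, Matrix.SpecialLinearGroup.coe_mul, Matrix.mul_apply]
    refine Differentiable.fun_sum fun k _ => Differentiable.fun_mul ?_ (ih k j)
    simp only [coe_xRoot, xMat, Matrix.of_apply]
    refine (differentiable_const _).fun_add ?_
    split_ifs
    · exact hs a
    · exact differentiable_const _

theorem differentiable_stratumParam {A : Fin (nB n) ≃ Tri n} (hA : List.ofFn A = cOrder n) :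
    Differentiable ℂ fun t => bigCellCoord (stratumParam (fun l => (A l).1.1) t) := by
  have h : ∀ t : Fin (nB n) → ℂ, bigCellCoord (stratumParam (fun l => (A l).1.1) t) =
      fun p => (xc (Sum.elim (fun a => t (A.symm a)) fun _ => 0) : Mat n) p.1.1 p.1.2 := by
    intro t
    funext p
    rw [← bigCellCoord_gammaMap, stratumParam_of_ofFn hA]
    simp
  simp only [h]
  rw [differentiable_pi]
  intro p
  exact differentiable_list_prod (fun a : Tri n => a.1.1) (s := fun a (t : Fin (nB n) → ℂ) => t (A.symm a))
    (fun a => differentiable_apply _) (cOrder n) _ _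

/-- The derivative of the vertex variable `w` in the vertex coordinates. -/
def vertexDeriv (w : Vertex n) : (Below n → ℂ) →L[ℂ] ℂ :=
  if h : w.1.2 < w.1.1 then ContinuousLinearMap.proj (R := ℂ) (φ := fun _ : Below n => ℂ)
    ⟨w.1, h⟩ else 0

theorem vertexDeriv_div (Q : Fin n → ℂ) (z v : Below n → ℂ) (w : Vertex n) :
    vertexDeriv w v / vertexExtend Q z w = ∑ b, v b / z b * if w.1 = b.1 then 1 else 0 := by
  rw [vertexDeriv, vertexExtend]
  split_ifs with h
  · rw [Finset.sum_eq_single ⟨w.1, h⟩]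
    · simp
    · intro b _ hb
      rw [if_neg, mul_zero]
      intro hw
      exact hb (Subtype.ext hw.symm)
    · simp
  · rw [zero_apply, zero_div, Finset.sum_eq_zero]
    intro b _
    rw [if_neg, mul_zero]
    intro hw
    exact h (by rw [hw]; exact b.2)

theorem hasFDerivAt_arrowsOf {Q : Fin n → ℂ} (hQ : ∀ i, Q i ≠ 0) {z : Below n → ℂ}
    (hz : ∀ v, z v ≠ 0) (a : Arrow n) :
    HasFDerivAt (fun z => arrowsOf Q z a)
      (arrowsOf Q z a • ((vertexExtend Q z (head a))⁻¹ • vertexDeriv (head a) -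
        (vertexExtend Q z (tail a))⁻¹ • vertexDeriv (tail a))) z := by
  have h1 := vertexExtend_ne_zero hQ hz (head a)
  have h2 := vertexExtend_ne_zero hQ hz (tail a)
  refine (hasFDerivAt_div (hasFDerivAt_vertexExtend Q z (head a))
    (hasFDerivAt_vertexExtend Q z (tail a)) h2).congr_fderiv ?_
  change (vertexExtend Q z (tail a))⁻¹ • vertexDeriv (head a) -
    (vertexExtend Q z (head a) / vertexExtend Q z (tail a) ^ 2) • vertexDeriv (tail a) = _
  rw [smul_sub, smul_smul, smul_smul, arrowsOf]
  congr 2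
  · field_simp
  · field_simp

/-- The incidence matrix of the vertical arrows, with rows and columns labelled by the vertices
below the diagonal (a vertical arrow being labelled by its tail). -/
def incidence (n : ℕ) : Matrix (Below n) (Below n) ℤ :=
  Matrix.of (fun w w' => if (w.1.1 : ℕ) + 1 = w'.1.1 ∧ w.1.2 = w'.1.2 then 1 else 0) - 1

/-- The head part raises the row index by exactly one, so its `(n + 1)`-st power is zero, and a
nilpotent matrix minus the identity is invertible over `ℤ`. -/
theorem isUnit_incidence : IsUnit (incidence n) := by
  refine IsNilpotent.isUnit_sub_one ⟨n + 1, ?_⟩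
  have h : ∀ (k : ℕ) (w w' : Below n), (w.1.1 : ℕ) + k ≠ w'.1.1 →
      ((Matrix.of fun w w' : Below n => if (w.1.1 : ℕ) + 1 = w'.1.1 ∧ w.1.2 = w'.1.2
        then (1 : ℤ) else 0) ^ k) w w' = 0 := by
    intro k
    induction k with
    | zero =>
      intro w w' h
      rw [pow_zero, Matrix.one_apply_ne]
      rintro rfl
      exact h rfl
    | succ k ih =>
      intro w w' h
      rw [pow_succ, Matrix.mul_apply, Finset.sum_eq_zero]
      intro x _
      by_cases hx : (w.1.1 : ℕ) + k = x.1.1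
      · rw [Matrix.of_apply, if_neg, mul_zero]
        rintro ⟨h1, -⟩
        omega
      · rw [ih w x hx, zero_mul]
  ext w w'
  have := w'.1.1.2
  rw [h _ _ _ (by omega), Matrix.zero_apply]

theorem incidence_tail (b : Below n) (a : Tri n) : ((incidence n b (tailEquiv n a) : ℤ) : ℂ) =
    (if (head (Sum.inl a)).1 = b.1 then 1 else 0) - if (tail (Sum.inl a)).1 = b.1 then 1 else 0 := by
  have hb : (b.1.2 : ℕ) < b.1.1 := b.2
  rw [incidence, Matrix.sub_apply, Matrix.of_apply, Matrix.one_apply]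
  push_cast
  congr 1
  · congr 1
    rw [eq_iff_iff, Prod.ext_iff, Fin.ext_iff, Fin.ext_iff, Fin.ext_iff]
    simp only [tailEquiv, head, Equiv.coe_fn_mk, Fin.val_succ, Fin.val_castSucc]
    omega
  · congr 1
    rw [eq_iff_iff, Subtype.ext_iff, eq_comm]
    rfl

/-- Chain rule through the stratum parameters. Arrows with a diagonal head lose that term because
the diagonal vertices are constant on the fibre, which is why only vertices below the diagonal index
the rows of `incidence`. -/
theorem pullback_gammaMap {A : Fin (nB n) ≃ Tri n} (hA : List.ofFn A = cOrder n)
    (ω : TopForm n) {Q : Fin n → ℂ} (hQ : ∀ i, Q i ≠ 0) {z : Below n → ℂ} (hz : ∀ v, z v ≠ 0)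
    (v : Fin (nB n) → Below n → ℂ) :
    pullback (fun z' => gammaMap (arrowsOf Q z')) ω z v =
      pullback (stratumParam fun l => (A l).1.1) ω (fun l => arrowsOf Q z (.inl (A l)))
        fun k l => arrowsOf Q z (.inl (A l)) * ∑ b, v k b / z b * incidence n b (tailEquiv n (A l)) := by
  have hT : HasFDerivAt (fun z' l => arrowsOf Q z' (.inl (A l))) _ z :=
    hasFDerivAt_pi.2 fun l => hasFDerivAt_arrowsOf hQ hz (.inl (A l))
  have hG := (differentiable_stratumParam hA fun l => arrowsOf Q z (.inl (A l))).hasFDerivAt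
  have hF := hG.comp z hT
  simp only [pullback]
  rw [show (fun z' => bigCellCoord (gammaMap (arrowsOf Q z'))) =
    (fun t => bigCellCoord (stratumParam (fun l => (A l).1.1) t)) ∘
      fun z' l => arrowsOf Q z' (.inl (A l)) from
        funext fun z' => congrArg bigCellCoord (stratumParam_of_ofFn hA _), hF.fderiv,
    stratumParam_of_ofFn hA]
  simp only [ContinuousAlternatingMap.compContinuousLinearMap_apply]
  congr 1
  funext k
  simp only [Function.comp_apply, ContinuousLinearMap.comp_apply]
  congr 1
  funext l
  simp only [ContinuousLinearMap.coe_pi', smul_apply, sub_apply, smul_eq_mul, incidence_tail,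
    mul_sub, Finset.sum_sub_distrib, ← vertexDeriv_div Q z]
  simp only [div_eq_inv_mul]

theorem exists_pullback_eq {i₁ : Fin (nB n) → Fin n} {ω : TopForm n} (hω : IsMirrorForm i₁ ω)
    (e : Fin (nB n) ≃ Below n) : ∃ ε : ℂ, (ε = 1 ∨ ε = -1) ∧
      ∀ Q : Fin n → ℂ, (∀ i, Q i ≠ 0) → ∀ z : Below n → ℂ, (∀ v, z v ≠ 0) →
        ∀ v : Fin (nB n) → Below n → ℂ,
          pullback (fun z' => gammaMap (arrowsOf Q z')) ω z v = ε * dlogWedge e z v := by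
  obtain ⟨A, hA⟩ := exists_ofFn_cOrder e
  obtain ⟨-, ε, -, hε⟩ := hω
  obtain ⟨h1, h2⟩ := hε _ (isReducedWord_of_ofFn hA)
  set M : Matrix (Fin (nB n)) (Fin (nB n)) ℤ :=
    (incidence n).submatrix e (A.trans (tailEquiv n)) with hM
  have hdet : IsUnit M.det :=
    (Matrix.isUnit_iff_isUnit_det _).1 ((Matrix.isUnit_submatrix_equiv _ _).2 isUnit_incidence)
  -- The sign is the stratum sign for the word `𝐢₀` times the determinant of an integral invertible
  -- matrix; neither depends on `Q`.
  refine ⟨ε (fun l => (A l).1.1) * (M.det : ℂ), ?_, fun Q hQ z hz v => ?_⟩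
  · rcases h1 with h1 | h1 <;> rcases Int.isUnit_iff.1 hdet with h | h <;> rw [h1, h] <;> simp
  · have hne : ∀ l, arrowsOf Q z (.inl (A l)) ≠ 0 := fun l => (arrowsOf_mem hQ hz).1.1 _
    rw [pullback_gammaMap hA ω hQ hz, h2 _ hne, mul_assoc]
    congr 1
    have hcast : (M.det : ℂ) = (M.map (Int.castRingHom ℂ)).det := (Int.castRingHom ℂ).map_det M
    rw [dlogWedge, dlogWedge, hcast, mul_comm, ← Matrix.det_mul]
    congr 1
    ext k l
    rw [Matrix.mul_apply, Matrix.of_apply]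
    simp only [id]
    rw [mul_div_cancel_left₀ _ (hne l), ← e.sum_comp]
    rfl

end Form

/-! ### Products of minors in `V(ρ)` and the lowest weight coefficient. -/

section Representation

variable {n : ℕ}

/-- Inclusion of the first `k + 1` indices. -/
abbrev lead (k : Fin n) : Fin ((k : ℕ) + 1) → Fin (n + 1) := Fin.castLE (Nat.succ_le_succ k.2.le)

/-- A choice of `k + 1` columns for every `k < n`. -/
abbrev ColChoice (n : ℕ) : Type := (k : Fin n) → Fin ((k : ℕ) + 1) → Fin (n + 1)

/-- The product of the minors with rows `0, …, k` and the chosen columns. -/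
def minorProd (φ : ColChoice n) : SLv n → ℂ :=
  fun x => ∏ k, ((x : Mat n).submatrix (lead k) (φ k)).det

theorem vPlus_eq_minorProd : vPlus n = minorProd fun k => lead k := rfl

/-- Cauchy–Binet before collecting terms: expand every column multilinearly, summing over all maps
instead of subsets. -/
theorem det_mul_eq_sum {m N : Type*} [Fintype m] [DecidableEq m] [Fintype N] [DecidableEq N]
    (A : Matrix m N ℂ) (B : Matrix N m ℂ) :
    (A * B).det = ∑ φ : m → N, (∏ l, B (φ l) l) * (A.submatrix id φ).det := by
  simp only [Matrix.det_apply', Matrix.mul_apply, Finset.prod_univ_sum, Finset.mul_sum,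
    Fintype.piFinset_univ]
  rw [Finset.sum_comm]
  refine Finset.sum_congr rfl fun φ _ => Finset.sum_congr rfl fun σ _ => ?_
  rw [Finset.prod_mul_distrib]
  simp only [Matrix.submatrix_apply, id]
  ring

/-- Shows that the span of these products is stable under translation, with coefficients polynomial
in the entries of `g`; hence it is also stable under derivatives. -/
theorem minorProd_mul (ψ : ColChoice n) (x g : SLv n) : minorProd ψ (x * g) =
    ∑ φ : ColChoice n, (∏ k, ∏ l, (g : Mat n) (φ k l) (ψ k l)) * minorProd φ x := by
  have h : ∀ k, (((x * g : SLv n) : Mat n).submatrix (lead k) (ψ k)).det =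
      ∑ φ : Fin ((k : ℕ) + 1) → Fin (n + 1), (∏ l, (g : Mat n) (φ l) (ψ k l)) *
        ((x : Mat n).submatrix (lead k) φ).det := by
    intro k
    rw [Matrix.SpecialLinearGroup.coe_mul, Matrix.submatrix_mul _ _ _ id _ Function.bijective_id,
      det_mul_eq_sum]
    rfl
  simp only [minorProd, h]
  rw [Finset.prod_univ_sum, Fintype.piFinset_univ]
  exact Finset.sum_congr rfl fun φ _ => Finset.prod_mul_distrib

theorem submatrix_lead_mul {M N : Mat n} {k : Fin n} (φ : Fin ((k : ℕ) + 1) → Fin (n + 1))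
    (h : ∀ i j : Fin (n + 1), (i : ℕ) ≤ k → (k : ℕ) < j → M i j = 0) :
    (M * N).submatrix (lead k) φ = M.submatrix (lead k) (lead k) * N.submatrix (lead k) φ := by
  ext i j
  rw [Matrix.submatrix_apply, Matrix.mul_apply, Matrix.mul_apply]
  refine (Finset.sum_of_injOn (lead k) (fun a _ b _ hab => Fin.castLE_injective _ hab)
    (fun _ _ => Finset.mem_coe.2 (Finset.mem_univ _)) (fun b _ hb => ?_) fun a _ => rfl).symm
  rw [h _ _ (Nat.le_of_lt_succ i.2), zero_mul]
  by_contra hlt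
  exact hb ⟨⟨b, by omega⟩, Finset.mem_coe.2 (Finset.mem_univ _), rfl⟩

/-- The index `i` occurs in the leading block of size `k + 1` exactly for the `n - i` values `k ≥
i`. -/
theorem prod_lead {d : Fin (n + 1) → ℂ} :
    ∏ k : Fin n, ∏ l, d (lead k l) = ∏ i : Fin (n + 1), d i ^ (i.rev : ℕ) := by
  let D : ℕ → ℂ := fun i => if h : i < n + 1 then d ⟨i, h⟩ else 1
  have hD : ∀ i : Fin (n + 1), D i = d i := fun i => dif_pos i.2
  have key : ∀ m, ∏ k ∈ Finset.range m, ∏ l ∈ Finset.range (k + 1), D l =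
      ∏ i ∈ Finset.range (m + 1), D i ^ (m - i) := by
    intro m
    induction m with
    | zero => simp
    | succ m ih =>
      rw [Finset.prod_range_succ, ih, Finset.prod_range_succ _ (m + 1), Nat.sub_self, pow_zero,
        mul_one, ← Finset.prod_mul_distrib]
      refine Finset.prod_congr rfl fun i hi => ?_
      rw [Finset.mem_range] at hi
      rw [← pow_succ]
      congr 1
      omega
  have h := key n
  rw [← Fin.prod_univ_eq_prod_range, ← Fin.prod_univ_eq_prod_range] at h
  simp only [← Fin.prod_univ_eq_prod_range, hD] at h
  refine Eq.trans ?_ (h.trans (Finset.prod_congr rfl fun i _ => ?_))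
  · refine Finset.prod_congr rfl fun k _ => Finset.prod_congr rfl fun l _ => ?_
    exact (hD (lead k l)).symm
  · rw [Fin.val_rev]
    congr 1
    omega

theorem det_submatrix_lead {b : Mat n} (hb : ∀ i j, i < j → b i j = 0) (k : Fin n) :
    (b.submatrix (lead k) (lead k)).det = ∏ l, b (lead k l) (lead k l) := by
  rw [Matrix.det_of_isLowerTriangular]
  · rfl
  · intro i j hij
    have hij' : i < j := hij
    exact hb _ _ hij'

theorem minorProd_mem_Vrho (φ : ColChoice n) : minorProd φ ∈ Vrho n := by
  refine ⟨⟨∏ k, (Matrix.of fun i j => MvPolynomial.X (lead k i, φ k j)).det, fun x => ?_⟩,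
    fun b hb x => ?_⟩
  · rw [map_prod, minorProd]
    refine Finset.prod_congr rfl fun k _ => ?_
    rw [RingHom.map_det]
    congr 1
    ext i j
    simp
  · have h : ∀ k, (((b * x : SLv n) : Mat n).submatrix (lead k) (φ k)).det =
        (∏ l, (b : Mat n) (lead k l) (lead k l)) * ((x : Mat n).submatrix (lead k) (φ k)).det := by
      intro k
      rw [Matrix.SpecialLinearGroup.coe_mul, submatrix_lead_mul (M := (b : Mat n)) (φ k),
        Matrix.det_mul, det_submatrix_lead hb]
      intro i j hi hj
      exact hb i j (show (i : ℕ) < j by omega)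
    simp only [minorProd, h]
    rw [Finset.prod_mul_distrib, prod_lead (d := fun i => (b : Mat n) i i)]
    rfl

theorem minorProd_mul_diag (φ : ColChoice n) (x : SLv n) {t : SLv n} (ht : (t : Mat n).IsDiag) :
    minorProd φ (x * t) = (∏ k, ∏ l, (t : Mat n) (φ k l) (φ k l)) * minorProd φ x := by
  simp only [minorProd]
  rw [← Finset.prod_mul_distrib]
  refine Finset.prod_congr rfl fun k _ => ?_
  rw [← Matrix.det_mul_row]
  congr 1
  ext i j
  rw [Matrix.submatrix_apply, Matrix.SpecialLinearGroup.coe_mul, Matrix.mul_apply,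
    Finset.sum_eq_single (φ k j), Matrix.of_apply, Matrix.submatrix_apply, mul_comm]
  · intro b _ hb
    rw [ht hb, mul_zero]
  · simp

theorem w₀Dot_mul_mul_antiMat_apply (M : Mat n) (i j : Fin (n + 1)) :
    ((w₀Dot n : Mat n) * M * antiMat n) i j = (-1) ^ (i + j : ℕ) * M i.rev j.rev := by
  have hi := i.2
  have hj := j.2
  rw [mul_assoc, Matrix.mul_apply, Finset.sum_eq_single i.rev, Matrix.mul_apply,
    Finset.sum_eq_single j.rev, antiMat, Matrix.of_apply, if_pos, coe_w₀Dot_apply, if_pos]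
  · ring
  · simp only [Fin.val_rev]
    omega
  · simp only [Fin.val_rev]
    omega
  · intro b _ hb
    rw [antiMat, Matrix.of_apply, if_neg, mul_zero]
    intro h
    apply hb
    ext
    simp only [Fin.val_rev]
    omega
  · simp
  · intro b _ hb
    rw [coe_w₀Dot_apply, if_neg, zero_mul]
    intro h
    apply hb
    ext
    simp only [Fin.val_rev]
    omega
  · simp

/-- Conjugation reverses the diagonal, so the product of the two characters is `∏ t_i ^ n`, a power
of the determinant. -/
theorem rhoChar_conj {t : SLv n} (ht : (t : Mat n).IsDiag) :
    rhoChar (w₀Dot n * t * (w₀Dot n)⁻¹) = (rhoChar t)⁻¹ := by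
  have hdet : ∏ i, (t : Mat n) i i = 1 := by
    have h := t.det_coe
    rw [← ht.diagonal_diag, Matrix.det_diagonal] at h
    exact h
  refine eq_inv_of_mul_eq_one_left ?_
  have h1 : rhoChar (w₀Dot n * t * (w₀Dot n)⁻¹) = ∏ i, (t : Mat n) i i ^ (i : ℕ) := by
    rw [rhoChar, ← Equiv.prod_comp Fin.revPerm]
    refine Finset.prod_congr rfl fun i _ => ?_
    rw [Matrix.SpecialLinearGroup.coe_mul, Matrix.SpecialLinearGroup.coe_mul, coe_w₀Dot_inv,
      w₀Dot_mul_mul_antiMat_apply, Fin.revPerm_apply, Fin.rev_rev, ← two_mul, pow_mul]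
    simp
  rw [h1, rhoChar, ← Finset.prod_mul_distrib]
  have h2 : ∀ i : Fin (n + 1), (t : Mat n) i i ^ (i : ℕ) * (t : Mat n) i i ^ (i.rev : ℕ) =
      (t : Mat n) i i ^ n := by
    intro i
    rw [← pow_add, Fin.val_rev]
    congr 1
    omega
  simp only [h2]
  rw [Finset.prod_pow, hdet, one_pow]

/-- Weight vectors of a weight different from the lowest one vanish at `ẇ₀`. -/
theorem eval_w₀Dot_eq_zero {f : SLv n → ℂ} (hf : f ∈ otherWeights n) : f (w₀Dot n) = 0 := by
  induction hf using Submodule.span_induction with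
  | mem f hf =>
    obtain ⟨⟨-, hρ⟩, χ, ⟨t, ht, hχ⟩, hw⟩ := hf
    have h1 : f (w₀Dot n * t) = χ t * f (w₀Dot n) := congrFun (hw t ht) (w₀Dot n)
    have h2 := hρ (w₀Dot n * t * (w₀Dot n)⁻¹) (fun i j hij => by
      rw [Matrix.SpecialLinearGroup.coe_mul, Matrix.SpecialLinearGroup.coe_mul, coe_w₀Dot_inv,
        w₀Dot_mul_mul_antiMat_apply, ht fun h => hij.ne (Fin.rev_injective h), mul_zero])
      (w₀Dot n)
    rw [inv_mul_cancel_right, rhoChar_conj ht, h1] at h2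
    by_contra h0
    exact hχ (mul_right_cancel₀ h0 h2)
  | zero => rfl
  | add f g _ _ h h' => rw [Pi.add_apply, h, h', add_zero]
  | smul c f _ h => rw [Pi.smul_apply, h, smul_zero]

theorem minorProd_lead_one : vPlus n 1 = 1 := by
  refine Finset.prod_eq_one fun k _ => ?_
  rw [Matrix.SpecialLinearGroup.coe_one, Matrix.submatrix_one _ (Fin.castLE_injective _),
    Matrix.det_one]

theorem vMinus_w₀Dot : vMinus n (w₀Dot n) = 1 := by
  rw [vMinus, translate, mul_inv_cancel, minorProd_lead_one]

/-- The chosen scalar is pinned down by evaluation at `ẇ₀`, which kills the other weight spaces and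
sends `v⁻_ρ` to `1`. -/
theorem coeffMinus_eq {v : SLv n → ℂ} (hv : ∃ c : ℂ, v - c • vMinus n ∈ otherWeights n) :
    coeffMinus v = v (w₀Dot n) := by
  have h := eval_w₀Dot_eq_zero (Classical.epsilon_spec hv)
  rw [Pi.sub_apply, Pi.smul_apply, vMinus_w₀Dot, smul_eq_mul, mul_one, sub_eq_zero] at h
  exact h.symm

/-! ### Products of minors of the lowest weight -/

/-- Elements of `S` outside `range m` are at least `m`, the missing ones are at most `m - 1`, and
there are equally many of both. -/
theorem sum_lt_of_image_ne {S : Finset ℕ} {m : ℕ} (hS : S.card = m) :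
    ∑ i ∈ Finset.range m, i + (S \ Finset.range m).card ≤ ∑ i ∈ S, i := by
  have h1 := Finset.sum_inter_add_sum_sdiff S (Finset.range m) fun i => i
  have h2 := Finset.sum_inter_add_sum_sdiff (Finset.range m) S fun i => i
  rw [Finset.inter_comm] at h2
  have h3 : (S \ Finset.range m).card = (Finset.range m \ S).card := by
    have := Finset.card_sdiff_add_card_inter S (Finset.range m)
    have h' := Finset.card_sdiff_add_card_inter (Finset.range m) S
    rw [Finset.inter_comm, Finset.card_range] at h'
    omega
  have h4 : (S \ Finset.range m).card * m ≤ ∑ i ∈ S \ Finset.range m, i := by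
    rw [← smul_eq_mul]
    refine Finset.card_nsmul_le_sum _ _ _ fun i hi => ?_
    simp only [Finset.mem_sdiff, Finset.mem_range] at hi
    omega
  have h5 : ∑ i ∈ Finset.range m \ S, i + (Finset.range m \ S).card ≤
      (Finset.range m \ S).card * m := by
    rw [← Finset.sum_const_nat (fun _ _ => rfl), Finset.card_eq_sum_ones, ← Finset.sum_add_distrib]
    refine Finset.sum_le_sum fun i hi => ?_
    simp only [Finset.mem_sdiff, Finset.mem_range] at hi
    omega
  rw [h3] at h4 ⊢
  omega

/-- The entries of a diagonal matrix separating the lowest weight from the others. -/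
def sepEntry (n : ℕ) (i : Fin (n + 1)) : ℂ := 4 ^ (i : ℕ) / 2 ^ n

theorem prod_sepEntry : ∏ i, sepEntry n i = 1 := by
  simp only [sepEntry]
  rw [Finset.prod_div_distrib, Finset.prod_pow_eq_pow_sum, Finset.prod_const, Finset.card_univ,
    Fintype.card_fin, div_eq_one_iff_eq (pow_ne_zero _ (pow_ne_zero _ two_ne_zero)), ← pow_mul,
    Fin.sum_univ_eq_sum_range (fun i => i), show (4 : ℂ) = 2 ^ 2 by norm_num, ← pow_mul, mul_comm 2,
    Finset.sum_range_id_mul_two, Nat.add_sub_cancel, mul_comm]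

/-- A diagonal matrix separating the lowest weight from the others. -/
def sepDiag (n : ℕ) : SLv n :=
  ⟨Matrix.diagonal (sepEntry n), by rw [Matrix.det_diagonal, prod_sepEntry]⟩

theorem rhoChar_sepDiag :
    (rhoChar (sepDiag n))⁻¹ = ∏ k : Fin n, ∏ l, sepEntry n (lead k l).rev := by
  refine inv_eq_of_mul_eq_one_right ?_
  have h1 : rhoChar (sepDiag n) = ∏ k : Fin n, ∏ l, sepEntry n (lead k l) := by
    rw [prod_lead, rhoChar]
    refine Finset.prod_congr rfl fun i _ => ?_
    congr 1
    exact Matrix.diagonal_apply_eq _ _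
  rw [h1, ← Finset.prod_mul_distrib]
  refine Finset.prod_eq_one fun k _ => ?_
  rw [← Finset.prod_mul_distrib]
  refine Finset.prod_eq_one fun l _ => ?_
  rw [sepEntry, sepEntry, div_mul_div_comm, ← pow_add, Fin.val_rev, div_eq_one_iff_eq
    (mul_ne_zero (pow_ne_zero _ two_ne_zero) (pow_ne_zero _ two_ne_zero)), ← mul_pow]
  have := (lead k l).2
  rw [show ((lead k l : Fin (n + 1)) : ℕ) + (n + 1 - ((lead k l : Fin (n + 1)) + 1)) = n by omega]
  norm_num

/-- After reversing indices this is `sum_lt_of_image_ne`: the column sum is maximal only if the set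
of columns consists of the last `k + 1`. -/
theorem exists_perm_of_sum {k : Fin n} {φ : Fin ((k : ℕ) + 1) → Fin (n + 1)}
    (hφ : Function.Injective φ) :
    ∑ l, (φ l : ℕ) ≤ ∑ l, ((lead k l).rev : ℕ) ∧
    (∑ l, (φ l : ℕ) = ∑ l, ((lead k l).rev : ℕ) →
      ∃ π : Equiv.Perm (Fin ((k : ℕ) + 1)), ∀ l, φ l = (lead k (π l)).rev) := by
  set S : Finset ℕ := Finset.univ.image fun l => ((φ l).rev : ℕ) with hS
  have hinj : Function.Injective fun l => ((φ l).rev : ℕ) := fun a b h =>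
    hφ (Fin.rev_injective (Fin.ext h))
  have hcard : S.card = (k : ℕ) + 1 := by
    rw [hS, Finset.card_image_of_injective _ hinj, Finset.card_univ, Fintype.card_fin]
  have h1 := sum_lt_of_image_ne hcard
  have h2 : ∑ i ∈ S, i = ∑ l, ((φ l).rev : ℕ) := by
    rw [hS, Finset.sum_image fun a _ b _ h => hinj h]
  have h3 : ∑ l, (φ l : ℕ) + ∑ l, ((φ l).rev : ℕ) = ((k : ℕ) + 1) * n := by
    rw [← Finset.sum_add_distrib, Finset.sum_const_nat (m := n), Finset.card_univ, Fintype.card_fin]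
    intro l _
    have := (φ l).2
    rw [Fin.val_rev]
    omega
  have h4 : ∑ l, ((lead k l).rev : ℕ) + ∑ i ∈ Finset.range ((k : ℕ) + 1), i = ((k : ℕ) + 1) * n := by
    rw [← Fin.sum_univ_eq_sum_range (fun i => i), ← Finset.sum_add_distrib,
      Finset.sum_const_nat (m := n), Finset.card_univ, Fintype.card_fin]
    intro l _
    have := l.2
    have := k.2
    rw [Fin.val_rev, Fin.val_castLE]
    omega
  rw [h2] at h1
  refine ⟨by omega, fun h => ?_⟩
  have h5 : S ⊆ Finset.range ((k : ℕ) + 1) := by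
    rw [← Finset.sdiff_eq_empty_iff_subset, ← Finset.card_eq_zero]
    omega
  have h6 : ∀ l, ((φ l).rev : ℕ) < (k : ℕ) + 1 := fun l =>
    Finset.mem_range.1 (h5 (Finset.mem_image_of_mem _ (Finset.mem_univ l)))
  refine ⟨Equiv.ofBijective (fun l => ⟨(φ l).rev, h6 l⟩) (Finite.injective_iff_bijective.1
    fun a b hab => hinj (Fin.mk.inj hab)), fun l => ?_⟩
  rw [← Fin.rev_rev (φ l)]
  rfl

theorem vMinus_apply (x : SLv n) : vMinus n x = ∏ k : Fin n,
    ((∏ l : Fin ((k : ℕ) + 1), (-1 : ℂ) ^ (l : ℕ)) *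
      ((x : Mat n).submatrix (lead k) fun l => (lead k l).rev).det) := by
  rw [vMinus, translate, vPlus]
  refine Finset.prod_congr rfl fun k _ => ?_
  rw [← Matrix.det_mul_row]
  congr 1
  ext i j
  have hj := j.2
  have hk := k.2
  rw [Matrix.submatrix_apply, Matrix.SpecialLinearGroup.coe_mul, coe_w₀Dot_inv, Matrix.mul_apply,
    Finset.sum_eq_single (lead k j).rev, Matrix.of_apply, Matrix.submatrix_apply, antiMat,
    Matrix.of_apply, if_pos, mul_comm]
  · rfl
  · simp only [Fin.val_rev, Fin.val_castLE]
    omega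
  · intro b _ hb
    rw [antiMat, Matrix.of_apply, if_neg, mul_zero]
    intro h
    apply hb
    ext
    simp only [Fin.val_rev, Fin.val_castLE] at h ⊢
    omega
  · simp

/-- A product of minors is zero if a column repeats. Otherwise it is a weight vector: either its
weight is separated from the lowest one by `sepDiag`, or its columns are the last ones in some order
and it is a multiple of `v⁻_ρ`. -/
theorem minorProd_good (φ : ColChoice n) :
    ∃ c : ℂ, minorProd φ - c • vMinus n ∈ otherWeights n := by
  by_cases hinj : ∀ k, Function.Injective (φ k)
  · by_cases hχ : ∏ k, ∏ l, (sepDiag n : Mat n) (φ k l) (φ k l) = (rhoChar (sepDiag n))⁻¹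
    -- On `sepDiag` the weights are powers of `4` over a common denominator. Equality of weights
    -- gives equality of the total column sums, and hence of each summand, as each is bounded by its
    -- maximum.
    · have h1 : ∑ k, ∑ l, (φ k l : ℕ) = ∑ k : Fin n, ∑ l, ((lead k l).rev : ℕ) := by
        rw [rhoChar_sepDiag] at hχ
        have h2 : ∀ i, (sepDiag n : Mat n) i i = sepEntry n i :=
          fun i => Matrix.diagonal_apply_eq _ _
        simp only [h2, sepEntry, Finset.prod_div_distrib, Finset.prod_pow_eq_pow_sum] at hχ
        rw [div_left_inj' (pow_ne_zero _ two_ne_zero)] at hχ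
        have h3 : ((4 ^ ∑ k, ∑ l, (φ k l : ℕ) : ℕ) : ℂ) =
            (4 ^ ∑ k : Fin n, ∑ l, ((lead k l).rev : ℕ) : ℕ) := by
          push_cast
          exact_mod_cast hχ
        exact Nat.pow_right_injective (le_refl 2 |>.trans (by norm_num)) (Nat.cast_injective h3)
      rw [Finset.sum_eq_sum_iff_of_le fun k _ => (exists_perm_of_sum (hinj k)).1] at h1
      choose π hπ using fun k => (exists_perm_of_sum (hinj k)).2 (h1 k (Finset.mem_univ k))
      refine ⟨∏ k, (((Equiv.Perm.sign (π k) : ℤ) : ℂ) /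
        ∏ l : Fin ((k : ℕ) + 1), (-1 : ℂ) ^ (l : ℕ)), ?_⟩
      convert Submodule.zero_mem _
      rw [sub_eq_zero]
      funext x
      rw [Pi.smul_apply, smul_eq_mul, vMinus_apply, ← Finset.prod_mul_distrib]
      refine Finset.prod_congr rfl fun k _ => ?_
      have h0 : ∏ l : Fin ((k : ℕ) + 1), (-1 : ℂ) ^ (l : ℕ) ≠ 0 :=
        Finset.prod_ne_zero_iff.2 fun l _ => pow_ne_zero _ (by norm_num)
      rw [← mul_assoc, div_mul_cancel₀ _ h0, ← Matrix.det_permute', funext (hπ k)]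
      rfl
    · refine ⟨0, ?_⟩
      rw [zero_smul, sub_zero]
      refine Submodule.subset_span ⟨minorProd_mem_Vrho φ,
        fun t => ∏ k, ∏ l, (t : Mat n) (φ k l) (φ k l),
        ⟨sepDiag n, Matrix.isDiag_diagonal _, hχ⟩, fun t ht => ?_⟩
      funext x
      exact minorProd_mul_diag φ x ht
  · push Not at hinj
    obtain ⟨k, hk⟩ := hinj
    refine ⟨0, ?_⟩
    convert Submodule.zero_mem _
    rw [zero_smul, sub_zero]
    funext x
    rw [Function.Injective] at hk
    push Not at hk
    obtain ⟨a, b, hab, hne⟩ := hk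
    refine Finset.prod_eq_zero (Finset.mem_univ k) (Matrix.det_zero_of_column_eq hne fun i => ?_)
    rw [Matrix.submatrix_apply, Matrix.submatrix_apply, hab]

/-- The span of the products of minors. -/
def minorSpan (n : ℕ) : Submodule ℂ (SLv n → ℂ) := Submodule.span ℂ (Set.range minorProd)

theorem coeffMinus_of_mem {v : SLv n → ℂ} (hv : v ∈ minorSpan n) :
    coeffMinus v = v (w₀Dot n) := by
  refine coeffMinus_eq ?_
  induction hv using Submodule.span_induction with
  | mem f hf =>
    obtain ⟨φ, rfl⟩ := hf
    exact minorProd_good φ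
  | zero => exact ⟨0, by rw [zero_smul, sub_zero]; exact zero_mem _⟩
  | add f g _ _ h h' =>
    obtain ⟨c, hc⟩ := h
    obtain ⟨c', hc'⟩ := h'
    refine ⟨c + c', ?_⟩
    rw [add_smul, add_sub_add_comm]
    exact add_mem hc hc'
  | smul a f _ h =>
    obtain ⟨c, hc⟩ := h
    refine ⟨a * c, ?_⟩
    rw [mul_smul, ← smul_sub]
    exact Submodule.smul_mem _ _ hc

theorem translate_mem {v : SLv n → ℂ} (hv : v ∈ minorSpan n) (g : SLv n) :
    translate g v ∈ minorSpan n := by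
  induction hv using Submodule.span_induction with
  | mem f hf =>
    obtain ⟨ψ, rfl⟩ := hf
    have h : translate g (minorProd ψ) =
        ∑ φ, (∏ k, ∏ l, (g : Mat n) (φ k l) (ψ k l)) • minorProd φ := by
      funext x
      rw [translate, minorProd_mul, Finset.sum_apply]
      rfl
    rw [h]
    exact sum_mem fun φ _ => Submodule.smul_mem _ _ (Submodule.subset_span ⟨φ, rfl⟩)
  | zero => exact zero_mem _
  | add f g' _ _ h h' => exact add_mem h h'
  | smul a f _ h => exact Submodule.smul_mem _ a h

theorem differentiable_yRoot (i : Fin n) (a b : Fin (n + 1)) :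
    Differentiable ℂ fun s => (yRoot i s : Mat n) a b := by
  simp only [coe_yRoot, yMat, Matrix.of_apply]
  refine (differentiable_const _).fun_add ?_
  split_ifs
  · exact differentiable_id
  · exact differentiable_const _

/-- Differentiability is carried through the induction because the derivative of a sum splits only
for differentiable summands. On generators the coefficients in `minorProd_mul` are differentiable in
`s`. -/
theorem lieF_mem {v : SLv n → ℂ} (hv : v ∈ minorSpan n) :
    (∀ i x, DifferentiableAt ℂ (fun s => translate (yRoot i s) v x) 0) ∧ lieF v ∈ minorSpan n := by
  induction hv using Submodule.span_induction with
  | mem f hf =>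
    obtain ⟨ψ, rfl⟩ := hf
    have hP : ∀ (i : Fin n) (φ : ColChoice n), DifferentiableAt ℂ
        (fun s => ∏ k, ∏ l, (yRoot i s : Mat n) (φ k l) (ψ k l)) 0 := by
      intro i φ
      refine DifferentiableAt.fun_finsetProd fun k _ => DifferentiableAt.fun_finsetProd fun l _ => ?_
      exact differentiable_yRoot i _ _ _
    have h : ∀ (i : Fin n) (x : SLv n), (fun s => translate (yRoot i s) (minorProd ψ) x) = fun s =>
        ∑ φ : ColChoice n, (∏ k, ∏ l, (yRoot i s : Mat n) (φ k l) (ψ k l)) * minorProd φ x :=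
      fun i x => funext fun s => minorProd_mul _ _ _
    refine ⟨fun i x => ?_, ?_⟩
    · rw [h]
      exact DifferentiableAt.fun_sum fun φ _ => (hP i φ).mul_const _
    · have e : lieF (minorProd ψ) = ∑ i : Fin n, ∑ φ : ColChoice n,
          deriv (fun s => ∏ k, ∏ l, (yRoot i s : Mat n) (φ k l) (ψ k l)) 0 • minorProd φ := by
        funext x
        rw [lieF, Finset.sum_apply]
        refine Finset.sum_congr rfl fun i _ => ?_
        rw [h, deriv_fun_sum fun φ _ => (hP i φ).mul_const _, Finset.sum_apply]
        refine Finset.sum_congr rfl fun φ _ => ?_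
        rw [deriv_mul_const (hP i φ)]
        rfl
      rw [e]
      exact sum_mem fun i _ => sum_mem fun φ _ =>
        Submodule.smul_mem _ _ (Submodule.subset_span ⟨φ, rfl⟩)
  | zero =>
    refine ⟨fun i x => differentiableAt_const _, ?_⟩
    have e : lieF (0 : SLv n → ℂ) = 0 := by
      funext x
      exact Finset.sum_eq_zero fun i _ => deriv_const _ _
    rw [e]
    exact zero_mem _
  | add f g _ _ h h' =>
    refine ⟨fun i x => (h.1 i x).fun_add (h'.1 i x), ?_⟩
    have e : lieF (f + g) = lieF f + lieF g := by
      funext x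
      rw [Pi.add_apply, lieF, lieF, lieF, ← Finset.sum_add_distrib]
      exact Finset.sum_congr rfl fun i _ => deriv_fun_add (h.1 i x) (h'.1 i x)
    rw [e]
    exact add_mem h.2 h'.2
  | smul a f _ h =>
    refine ⟨fun i x => (h.1 i x).const_mul a, ?_⟩
    have e : lieF (a • f) = a • lieF f := by
      funext x
      rw [Pi.smul_apply, lieF, lieF, smul_eq_mul, Finset.mul_sum]
      exact Finset.sum_congr rfl fun i _ => deriv_const_mul a (h.1 i x)
    rw [e]
    exact Submodule.smul_mem _ _ h.2

theorem vPlus_mem : vPlus n ∈ minorSpan n := Submodule.subset_span ⟨_, vPlus_eq_minorProd.symm⟩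

end Representation

/-! ### Leading minors and the comparison of the phase functions. -/

section Phase

variable {n : ℕ}

/-- The product of the leading principal minors of sizes `1, …, n`. -/
def leadProd (M : Mat n) : ℂ := ∏ k : Fin n, (M.submatrix (lead k) (lead k)).det

theorem leadProd_transpose (M : Mat n) : leadProd M.transpose = leadProd M :=
  Finset.prod_congr rfl fun _ _ => Matrix.det_transpose _

theorem leadProd_lower_mul {L : Mat n} (hL : ∀ i j, i < j → L i j = 0) (M : Mat n) :
    leadProd (L * M) = leadProd L * leadProd M := by
  simp only [leadProd]
  rw [← Finset.prod_mul_distrib]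
  refine Finset.prod_congr rfl fun k _ => ?_
  rw [submatrix_lead_mul, Matrix.det_mul]
  intro i j hi hj
  exact hL i j (show (i : ℕ) < j by omega)

theorem leadProd_mul_upper {U : Mat n} (hU : ∀ i j, j < i → U i j = 0) (M : Mat n) :
    leadProd (M * U) = leadProd M * leadProd U := by
  rw [← leadProd_transpose, Matrix.transpose_mul, leadProd_lower_mul, leadProd_transpose,
    leadProd_transpose, mul_comm]
  exact fun i j hij => hU j i hij

theorem det_submatrix_lead_of_isUni {V : Mat n} (hV : IsUni V) (k : Fin n) :
    (V.submatrix (lead k) (lead k)).det = 1 := by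
  refine det_of_uni fun i j hij => ?_
  rw [Matrix.submatrix_apply, hV _ _ (show ((j : ℕ)) ≤ i from hij)]
  simp only [Fin.ext_iff, Fin.val_castLE]

theorem IsUni.leadProd_eq_one {V : Mat n} (hV : IsUni V) : leadProd V = 1 :=
  Finset.prod_eq_one fun k _ => det_submatrix_lead_of_isUni hV k

theorem leadProd_diagonal (d : Fin (n + 1) → ℂ) :
    leadProd (Matrix.diagonal d) = ∏ k : Fin n, ∏ l, d (lead k l) := by
  refine Finset.prod_congr rfl fun k _ => ?_
  rw [det_submatrix_lead fun i j hij => Matrix.diagonal_apply_ne _ hij.ne]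
  simp only [Matrix.diagonal_apply_eq]

theorem yMat_eq (i : Fin n) (s : ℂ) : yMat n i s = 1 + Matrix.single i.succ i.castSucc s := by
  ext a b
  rw [yMat, Matrix.of_apply, Matrix.add_apply, Matrix.one_apply, Matrix.single_apply]
  congr 1
  simp only [Fin.ext_iff, Fin.val_succ, Fin.val_castSucc]
  congr 1
  rw [eq_iff_iff, eq_comm, @eq_comm _ (b : ℕ)]

/-- Right multiplication by `y_i(s)` adds `s` times column `i + 1` to column `i`. Only the leading
minor that contains the latter column but not the former is affected, and it stays triangular. -/
theorem IsUni.leadProd_mul_yMat {V : Mat n} (hV : IsUni V) (i : Fin n) (s : ℂ) :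
    leadProd (V * yMat n i s) = 1 + s * V i.castSucc i.succ := by
  rw [leadProd, Finset.prod_eq_single i]
  · rw [Matrix.det_of_isUpperTriangular, Fin.prod_univ_castSucc]
    · have hlast : lead i (Fin.last i) = i.castSucc := rfl
      rw [Matrix.submatrix_apply, hlast, yMat_eq, mul_add, mul_one, Matrix.add_apply,
        Matrix.mul_single_apply_same, hV _ _ le_rfl, if_pos rfl, Finset.prod_eq_one, one_mul,
        mul_comm]
      intro a _
      have ha := a.2
      have hne : lead i a.castSucc ≠ i.castSucc := by
        intro h
        have := congrArg Fin.val h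
        simp at this
        omega
      rw [Matrix.submatrix_apply, Matrix.add_apply, Matrix.mul_single_apply_of_ne _ _ _ _ _ hne,
        add_zero, hV _ _ le_rfl, if_pos rfl]
    · intro a b hab
      have hab' : (b : ℕ) < a := hab
      have ha := a.2
      have hne : lead i b ≠ i.castSucc := by
        intro h
        have := congrArg Fin.val h
        simp at this
        omega
      rw [Matrix.submatrix_apply, yMat_eq, mul_add, mul_one, Matrix.add_apply,
        Matrix.mul_single_apply_of_ne _ _ _ _ _ hne, add_zero,
        hV _ _ (show ((b : ℕ)) ≤ a by omega), if_neg]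
      intro h
      have := congrArg Fin.val h
      simp at this
      omega
  · intro k _ hk
    have hki : (k : ℕ) ≠ i := fun h => hk (Fin.ext h)
    -- For `k ≠ i` the entry of `y_i(s)` does not link the first `k + 1` indices with the others, so
    -- the leading block of the product is the product of the leading blocks.
    have h1 : (V * yMat n i s).submatrix (lead k) (lead k) =
        V.submatrix (lead k) (lead k) * (yMat n i s).submatrix (lead k) (lead k) := by
      have := submatrix_lead_mul (M := (yMat n i s).transpose) (N := V.transpose) (k := k) (lead k)
        (fun a b ha hb => by
          rw [Matrix.transpose_apply, yMat_eq, Matrix.add_apply, Matrix.one_apply,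
            Matrix.single_apply, if_neg, if_neg, add_zero]
          · simp only [Fin.ext_iff, Fin.val_succ, Fin.val_castSucc]
            omega
          · simp only [Fin.ext_iff]
            omega)
      have h2 := congrArg Matrix.transpose this
      rw [← Matrix.transpose_mul, Matrix.transpose_submatrix, Matrix.transpose_transpose] at h2
      rw [h2, Matrix.transpose_mul]
      rfl
    rw [h1, Matrix.det_mul, det_submatrix_lead_of_isUni hV, one_mul, det_submatrix_lead]
    · refine Finset.prod_eq_one fun l _ => ?_
      rw [yMat, Matrix.of_apply, if_pos rfl, if_neg, add_zero]
      omega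
    · intro a b hab
      have hab' : (a : ℕ) < b := hab
      rw [yMat, Matrix.of_apply, if_neg hab.ne, if_neg, add_zero]
      omega
  · simp

theorem isUni_w₀_conj_transpose {U : Mat n} (hU : IsUni U) :
    IsUni ((w₀Dot n : Mat n) * U * antiMat n).transpose := by
  intro i j hij
  rw [Matrix.transpose_apply, w₀Dot_mul_mul_antiMat_apply, hU _ _ (Fin.rev_le_rev.2 hij)]
  by_cases h : i = j
  · subst h
    simp [← two_mul, pow_mul]
  · rw [if_neg h, if_neg fun h' => h (Fin.rev_injective h'.symm), mul_zero]

theorem w₀_conj_yMat (i : Fin n) (s : ℂ) :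
    (w₀Dot n : Mat n) * yMat n i s * antiMat n = (yMat n (i.rev : Fin n) (-s)).transpose := by
  ext a b
  have ha := a.2
  have hb := b.2
  have hi := i.2
  rw [w₀Dot_mul_mul_antiMat_apply, Matrix.transpose_apply, yMat, yMat, Matrix.of_apply,
    Matrix.of_apply]
  simp only [Fin.rev_inj, Fin.val_rev]
  by_cases hab : a = b
  · subst hab
    rw [if_pos rfl, if_neg (by omega), if_neg (by omega), ← two_mul, pow_mul]
    simp
  · rw [if_neg hab, if_neg (Ne.symm hab)]
    by_cases h : n + 1 - ((a : ℕ) + 1) = i + 1 ∧ n + 1 - ((b : ℕ) + 1) = i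
    · rw [if_pos h, if_pos (by omega), show (a : ℕ) + b = 2 * a + 1 by omega, pow_succ, pow_mul]
      simp
    · rw [if_neg h, if_neg (by omega), add_zero, mul_zero]

theorem antiMat_mul_w₀Dot_mul (M : Mat n) : antiMat n * ((w₀Dot n : Mat n) * M) = M := by
  rw [← mul_assoc, antiMat_mul_w₀Dot, one_mul]

/-- Conjugation by `ẇ₀` turns `U` lower unitriangular and `y_i(s)` into an upper root element with
parameter `-s`. Transposition reduces to `IsUni.leadProd_mul_yMat`, and the sign is undone by that
of the conjugated entry. -/
theorem IsUni.leadProd_w₀_conj {U : Mat n} (hU : IsUni U) (i : Fin n) (s : ℂ) :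
    leadProd ((w₀Dot n : Mat n) * (yMat n i s * U) * antiMat n) =
      1 + s * U i.castSucc i.succ := by
  have h1 : (w₀Dot n : Mat n) * (yMat n i s * U) * antiMat n =
      ((w₀Dot n : Mat n) * yMat n i s * antiMat n) * ((w₀Dot n : Mat n) * U * antiMat n) := by
    simp only [mul_assoc, antiMat_mul_w₀Dot_mul]
  rw [h1, w₀_conj_yMat, ← leadProd_transpose, Matrix.transpose_mul, Matrix.transpose_transpose,
    (isUni_w₀_conj_transpose hU).leadProd_mul_yMat, Matrix.transpose_apply,
    w₀Dot_mul_mul_antiMat_apply]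
  have hi := i.2
  have e1 : (i.rev.succ : Fin (n + 1)).rev = i.castSucc := by
    ext
    simp only [Fin.val_rev, Fin.val_succ, Fin.val_castSucc]
    omega
  have e2 : (i.rev.castSucc : Fin (n + 1)).rev = i.succ := by
    ext
    simp only [Fin.val_rev, Fin.val_succ, Fin.val_castSucc]
    omega
  rw [e1, e2, Fin.val_succ, Fin.val_castSucc, show (i.rev : ℕ) + 1 + i.rev = 2 * i.rev + 1 by omega,
    pow_succ, pow_mul]
  simp

theorem w₀_conj_diagonal (d : Fin (n + 1) → ℂ) (z : ℂ) :
    z • ((w₀Dot n : Mat n) * Matrix.diagonal d * antiMat n) =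
      Matrix.diagonal fun i => z * d i.rev := by
  ext a b
  rw [Matrix.smul_apply, w₀Dot_mul_mul_antiMat_apply]
  by_cases h : a = b
  · subst h
    rw [Matrix.diagonal_apply_eq, Matrix.diagonal_apply_eq, ← two_mul, pow_mul]
    simp
  · rw [Matrix.diagonal_apply_ne _ h, Matrix.diagonal_apply_ne _ fun h' => h (Fin.rev_injective h'),
      mul_zero, smul_zero]

/-- The leading minors entering the phase function. -/
theorem leadProd_phase {U V : Mat n} (hU : IsUni U) (hV : IsUni V) {d : Fin (n + 1) → ℂ}
    (hd : ∀ i, d i ≠ 0) {z : ℂ} (hz : z ≠ 0) : ∃ κ : ℂ, κ ≠ 0 ∧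
      leadProd ((w₀Dot n : Mat n) * (z • (U * Matrix.diagonal d * antiMat n * V))) = κ ∧
      (∀ (i : Fin n) s, leadProd ((w₀Dot n : Mat n) * yMat n i s *
        (z • (U * Matrix.diagonal d * antiMat n * V))) = (1 + s * U i.castSucc i.succ) * κ) ∧
      ∀ (i : Fin n) s, leadProd ((w₀Dot n : Mat n) *
        (z • (U * Matrix.diagonal d * antiMat n * V)) * yMat n i s) =
          κ * (1 + s * V i.castSucc i.succ) := by
  set D : Mat n := Matrix.diagonal fun i => z * d i.rev with hD
  have hDlow : ∀ i j : Fin (n + 1), i < j → D i j = 0 :=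
    fun i j hij => Matrix.diagonal_apply_ne _ hij.ne
  have hκ : leadProd D ≠ 0 := by
    rw [hD, leadProd_diagonal]
    exact Finset.prod_ne_zero_iff.2 fun k _ => Finset.prod_ne_zero_iff.2 fun l _ =>
      mul_ne_zero hz (hd _)
  -- Inserting `ẇ₀⁻¹ ẇ₀` after `M` conjugates both `M` and the diagonal part, leaving a
  -- factorization adapted to leading minors.
  have hR : ∀ M W : Mat n, (w₀Dot n : Mat n) * M * (z • (Matrix.diagonal d * antiMat n * W)) =
      ((w₀Dot n : Mat n) * M * antiMat n) * (D * W) := by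
    intro M W
    rw [hD, ← w₀_conj_diagonal]
    simp only [mul_assoc, Matrix.smul_mul, Matrix.mul_smul, antiMat_mul_w₀Dot_mul]
  have hDV : ∀ i j : Fin (n + 1), j < i → (D * V) i j = 0 := by
    intro i j hij
    rw [hD, Matrix.diagonal_mul, hV _ _ hij.le, if_neg hij.ne', mul_zero]
  have hLow : ∀ i j : Fin (n + 1), i < j → ((w₀Dot n : Mat n) * U * antiMat n) i j = 0 := by
    intro i j hij
    have := isUni_w₀_conj_transpose hU j i hij.le
    rwa [if_neg hij.ne'] at this
  have hL1 : leadProd ((w₀Dot n : Mat n) * U * antiMat n) = 1 := by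
    rw [← leadProd_transpose]
    exact (isUni_w₀_conj_transpose hU).leadProd_eq_one
  have e : ∀ W, z • (U * Matrix.diagonal d * antiMat n * W) =
      U * (z • (Matrix.diagonal d * antiMat n * W)) := by
    intro W
    simp only [mul_assoc, Matrix.mul_smul]
  refine ⟨leadProd D, hκ, ?_, fun i s => ?_, fun i s => ?_⟩
  · rw [e, ← mul_assoc, hR, leadProd_lower_mul hLow, hL1, one_mul, leadProd_lower_mul hDlow,
      hV.leadProd_eq_one, mul_one]
  · rw [e, ← mul_assoc, mul_assoc (w₀Dot n : Mat n), hR, leadProd_mul_upper hDV,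
      hU.leadProd_w₀_conj, leadProd_lower_mul hDlow, hV.leadProd_eq_one, mul_one]
  · have e' : (w₀Dot n : Mat n) * (z • (U * Matrix.diagonal d * antiMat n * V)) * yMat n i s =
        (w₀Dot n : Mat n) * (z • (U * Matrix.diagonal d * antiMat n * (V * yMat n i s))) := by
      simp only [mul_assoc, Matrix.smul_mul, Matrix.mul_smul]
    rw [e', e, ← mul_assoc, hR, leadProd_lower_mul hLow, hL1, one_mul, leadProd_lower_mul hDlow,
      hV.leadProd_mul_yMat]

/-- The superdiagonal is a homomorphism from the unipotent group to an additive group. -/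
theorem IsUni.Ffun_mul {M N : Mat n} (hM : IsUni M) (hN : IsUni N) :
    Ffun (M * N) = Ffun M + Ffun N := by
  rw [Ffun, Ffun, Ffun, ← Finset.sum_add_distrib]
  refine Finset.sum_congr rfl fun i _ => ?_
  rw [Matrix.mul_apply, Finset.sum_eq_add i.castSucc i.succ Fin.castSucc_lt_succ.ne]
  · rw [hM _ _ le_rfl, hN _ _ le_rfl, if_pos rfl, if_pos rfl, one_mul, mul_one, add_comm]
  · rintro k - ⟨h1, h2⟩
    rcases lt_or_gt_of_ne h1 with h | h
    · rw [hM _ _ h.le, if_neg h.ne', zero_mul]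
    · have hk : i.succ < k := lt_of_le_of_ne (Fin.le_def.2 (Nat.succ_le_of_lt h)) h2.symm
      rw [hN _ _ hk.le, if_neg hk.ne', mul_zero]
  · simp
  · simp

theorem Ffun_xRoot (i : Fin n) (t : ℂ) : Ffun (xRoot i t : Mat n) = t := by
  rw [Ffun, coe_xRoot, Finset.sum_eq_single i]
  · simp [xMat, Fin.ext_iff]
  · intro b _ hb
    have : (b : ℕ) ≠ i := fun h => hb (Fin.ext h)
    simp [xMat, Fin.ext_iff, this]
  · simp

theorem isUni_xRoot (i : Fin n) (t : ℂ) : IsUni (xRoot i t : Mat n) := by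
  intro a b hab
  have hab' : (b : ℕ) ≤ a := hab
  rw [coe_xRoot, xMat, Matrix.of_apply, if_neg (by omega : ¬ ((a : ℕ) = i ∧ (b : ℕ) = i + 1)),
    add_zero]

theorem Ffun_list_prod {ι : Type*} (f : ι → Fin n) (s : ι → ℂ) (L : List ι) :
    IsUni ((L.map fun a => xRoot (f a) (s a)).prod : Mat n) ∧
    Ffun ((L.map fun a => xRoot (f a) (s a)).prod : Mat n) = (L.map s).sum := by
  induction L with
  | nil =>
    refine ⟨isUni_one, ?_⟩
    simp [Ffun, Fin.castSucc_lt_succ.ne]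
  | cons a L ih =>
    rw [List.map_cons, List.prod_cons, Matrix.SpecialLinearGroup.coe_mul, List.map_cons,
      List.sum_cons]
    exact ⟨(isUni_xRoot _ _).mul ih.1, by
      rw [(isUni_xRoot _ _).Ffun_mul ih.1, Ffun_xRoot, ih.2]⟩

theorem sum_map_of_nodup {ι : Type*} [Fintype ι] [DecidableEq ι] {L : List ι} (hL : L.Nodup)
    (h : ∀ a, a ∈ L) (s : ι → ℂ) : (L.map s).sum = ∑ a, s a := by
  rw [← List.sum_toFinset s hL]
  congr 1
  ext a
  simp [h a]

theorem nodup_dOrder : (dOrder n).Nodup := by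
  rw [dOrder, List.nodup_flatMap]
  refine ⟨fun k _ => ?_, ?_⟩
  · refine (List.nodup_finRange n).filterMap fun a a' b hb hb' => ?_
    simp only [Option.mem_def, Option.dite_none_right_eq_some, Option.some.injEq] at hb hb'
    obtain ⟨_, rfl⟩ := hb
    obtain ⟨_, h⟩ := hb'
    exact (congrArg (fun x : Tri n => x.1.2) h).symm
  · refine (List.nodup_reverse.2 (List.nodup_finRange n)).imp fun {k k'} hkk' => ?_
    intro a ha ha'
    simp only [List.mem_filterMap, Option.dite_none_right_eq_some, Option.some.injEq] at ha ha'
    obtain ⟨j, -, _, rfl⟩ := ha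
    obtain ⟨j', -, _, h⟩ := ha'
    exact hkk' (congrArg (fun x : Tri n => x.1.1) h).symm

theorem mem_dOrder (a : Tri n) : a ∈ dOrder n := by
  rw [dOrder, List.mem_flatMap]
  refine ⟨a.1.1, List.mem_reverse.2 (List.mem_finRange _), ?_⟩
  rw [List.mem_filterMap]
  exact ⟨a.1.2, List.mem_finRange _, dif_pos a.2⟩

theorem Ffun_xc (σ : Arrow n → ℂ) : Ffun (xc σ : Mat n) = ∑ a : Tri n, σ (.inl a) :=
  (Ffun_list_prod _ _ _).2.trans (sum_map_of_nodup nodup_cOrder mem_cOrder fun a => σ (.inl a))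

/-- The inverse changes the sign of `F`, which compensates the sign in `x_𝐝(-σ)`. -/
theorem Ffun_inv_xd_neg (σ : Arrow n → ℂ) :
    Ffun (((xd (-σ))⁻¹ : SLv n) : Mat n) = ∑ a : Tri n, σ (.inr a) := by
  have h1 : Ffun (xd (-σ) : Mat n) = ∑ a : Tri n, -σ (.inr a) :=
    (Ffun_list_prod _ _ _).2.trans (sum_map_of_nodup nodup_dOrder mem_dOrder fun a => -σ (.inr a))
  have h2 := (isUni_inv_xd (-σ)).Ffun_mul (isUni_xd (-σ))
  rw [← Matrix.SpecialLinearGroup.coe_mul, inv_mul_cancel, Matrix.SpecialLinearGroup.coe_one, h1,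
    Finset.sum_neg_distrib] at h2
  have h3 : Ffun (1 : Mat n) = 0 := by simp [Ffun, Fin.castSucc_lt_succ.ne]
  rw [h3] at h2
  linear_combination -h2

theorem deriv_affine (u κ : ℂ) : deriv (fun s : ℂ => (1 + s * u) * κ) 0 = u * κ := by
  have h : HasDerivAt (fun s : ℂ => (1 + s * u) * κ) ((1 * u) * κ) 0 :=
    (((hasDerivAt_id (0 : ℂ)).mul_const u).const_add 1).mul_const κ
  rw [h.deriv, one_mul]

/-- Evaluating at `ẇ₀`, the two numerators are the derivatives at `s = 0` of the leading minor
products of `ẇ₀ y_i(s) b` and `ẇ₀ b y_i(s)`, summed over `i`. By `leadProd_phase` they are `F(x_𝐜)`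
and `F(x_𝐝(-σ)⁻¹)` times the denominator. -/
theorem phaseB_eq {σ : Arrow n → ℂ} (hσ : σ ∈ Zquiver n) :
    phaseB (tau σ, beta σ) = phaseGivental σ := by
  rw [phaseB]
  set b : SLv n := Function.surjInv cover_surjective (beta σ) with hb
  have hcb : cover b = beta σ := Function.surjInv_eq cover_surjective (beta σ)
  obtain ⟨h0, h1⟩ := pmk_bruhat (tauVec_ne_zero (qTilde_ne_zero hσ)) (xc σ) ((xd (-σ))⁻¹)
  -- The chosen lift is only known up to a scalar; the scalar enters `κ` alone and cancels in the
  -- quotient.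
  obtain ⟨z, hz⟩ : ∃ z : ℂˣ, (b : Mat n) = (z : ℂ) • ((xc σ : Mat n) *
      Matrix.diagonal (tauVec (qTilde σ)) * antiMat n * (((xd (-σ))⁻¹ : SLv n) : Mat n)) := by
    rw [beta_eq, h1, pmk_eq h0, cover_eq_mk] at hcb
    exact mk_eq_mk_iff_smul.1 hcb.symm
  obtain ⟨κ, hκ, e0, e1, e2⟩ := leadProd_phase (isUni_xc σ) (isUni_inv_xd (-σ))
    (tauVec_ne_zero (qTilde_ne_zero hσ)) z.ne_zero
  rw [← hz] at e0 e1 e2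
  have hm := translate_mem (vPlus_mem (n := n)) b
  rw [coeffMinus_of_mem (lieF_mem hm).2, coeffMinus_of_mem (translate_mem (lieF_mem vPlus_mem).2 b),
    coeffMinus_of_mem hm]
  have d0 : translate b (vPlus n) (w₀Dot n) = κ := e0
  have d1 : lieF (translate b (vPlus n)) (w₀Dot n) = Ffun (xc σ : Mat n) * κ := by
    rw [lieF, Ffun, Finset.sum_mul]
    refine Finset.sum_congr rfl fun i _ => ?_
    rw [← deriv_affine]
    congr 1
    funext s
    rw [← e1, ← coe_yRoot]
    rfl
  have d2 : translate b (lieF (vPlus n)) (w₀Dot n) =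
      Ffun (((xd (-σ))⁻¹ : SLv n) : Mat n) * κ := by
    rw [translate, lieF, Ffun, Finset.sum_mul]
    refine Finset.sum_congr rfl fun i _ => ?_
    rw [← deriv_affine]
    congr 1
    funext s
    rw [mul_comm _ κ, ← e2, ← coe_yRoot]
    rfl
  rw [d0, d1, d2, ← add_mul, mul_div_cancel_right₀ _ hκ, Ffun_xc, Ffun_inv_xd_neg, phaseGivental,
    Fintype.sum_sum_type]

end Phase

end GiventalMirror

end

theorem theorem8p2 (n : ℕ) (hn : 1 ≤ n) :
    -- (1) `β` has image in `B_-^∨`, and `(τ, β)` is an open embedding of `𝒵` into `Z_B`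
    (Set.MapsTo beta (Zquiver n) (Bminus n : Set (Gv n)) ∧
      IsOpenEmbedding arrowCoord (Zquiver n) pairCoord (ZB n) (fun σ => (tau σ, beta σ))) ∧
    -- (2) `(τ, β)` pulls `ℱ_B` back to `ℱ̃`, and `γ` identifies `𝒵^crit` with the intersection
    -- of `Y_B` and the open Deodhar stratum, on points and as (a priori non-reduced) schemes
    ((∀ σ ∈ Zquiver n, phaseB (tau σ, beta σ) = phaseGivental σ) ∧
      IsMorphism arrowCoord (Zquiver n) bigCellCoord (openStratum (word₀ n)) gammaMap ∧
      Set.BijOn gammaMap (Zcrit n) (PetersonB n ∩ openStratum (word₀ n)) ∧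
      ∃ e : (regularRing bigCellCoord (openStratum (word₀ n)) ⧸
            petersonIdeal (openStratum (word₀ n))) ≃ₐ[ℂ]
          (regularRing arrowCoord (Zquiver n) ⧸ critIdeal n),
        ∀ (f : regularRing bigCellCoord (openStratum (word₀ n)))
          (g : regularRing arrowCoord (Zquiver n)),
          (∀ (σ : Zquiver n) (p : openStratum (word₀ n)), (p : Flag n) = gammaMap σ →
            (g : Zquiver n → ℂ) σ = (f : openStratum (word₀ n) → ℂ) p) →
          e (Ideal.Quotient.mk _ f) = Ideal.Quotient.mk _ g) ∧
    -- (3) every `γ_Q : 𝒵_Q → ℛ^∨_{1,w₀}` is an embedding and pulls `ω` back to `± ⋀ dt_v / t_v`,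
    -- with a sign that does not depend on `Q`
    ((∀ Q : Fin n → ℂ, (∀ i, Q i ≠ 0) →
        IsOpenEmbedding arrowCoord (Zfiber Q) bigCellCoord (Rich n) gammaMap) ∧
      ∀ i₁ : Fin (nB n) → Fin n, IsReducedWord i₁ → ∀ ω : TopForm n, IsMirrorForm i₁ ω →
        ∀ e : Fin (nB n) ≃ Below n, ∃ ε : ℂ, (ε = 1 ∨ ε = -1) ∧
          ∀ Q : Fin n → ℂ, (∀ i, Q i ≠ 0) → ∀ z : Below n → ℂ, (∀ v, z v ≠ 0) →
            ∀ v : Fin (nB n) → Below n → ℂ,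
              pullback (fun z' => gammaMap (arrowsOf Q z')) ω z v = ε * dlogWedge e z v) := by
  refine ⟨⟨fun σ hσ => beta_mem_Bminus hσ, isOpenEmbedding_tau_beta hn⟩,
    ⟨fun σ hσ => phaseB_eq hσ, isMorphism_gammaMap fun σ hσ => gammaMap_mem_openStratum hσ,
      bijOn_gammaMap hn, exists_scheme_iso hn⟩, fun Q hQ => isOpenEmbedding_gammaMap hn hQ,
    fun i₁ _ ω hω e => exists_pullback_eq hω e⟩
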